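/- **Setting.** Let $U\subset\mathbb R^2$ be open and let $a^0,a^1,a^2,a^3:U\to\mathbb R$ be smooth ($C^\infty$). Consider the equation $$\mathcal E:\qquad y''=a^3(x,y)\,y'^3+a^2(x,y)\,y'^2+a^1(x,y)\,y'+a^0(x,y),$$ identified with the section $S_{\mathcal E}=(a^0,a^1,a^2,a^3)$ of the bundle $\pi:\mathbb R^2\times\mathbb R^4\to\mathbb R^2$ with base coordinates $x^1=x$, $x^2=y$ and fibre coordinates $u^1,\dots,u^4$ (the values of $a^0,\dots,a^3$). A point transformation is a diffeomorphism of an open subset of $\mathbb R^2$ onto an open subset of $\mathbb R^2$; point transformations act on equations of this form and hence on sections of $\pi$ and their jets. We say that $\mathcal E$ *can be reduced to linear form by a point transformation* if every $p\in U$ has an open neighbourhood $V\subset U$ and a point transformation $f:V\to f(V)\subset\mathbb R^2$ that transforms $\mathcal E|_V$ to an equation $\tilde y''=A(\tilde x)\tilde y'+B(\tilde x)\tilde y+C(\tilde x)$ with smooth $A,B,C$. **The invariant $\omega^2$.** For a vector field $X$ on the plane let $X^{(k)}$ be its lift to the bundle $J^k\pi$ of $k$-jets of sections of $\pi$ (the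 velocity of the lifted flow of $X$). Let $T_p$ be the tangent space to the plane at $p$. Let $\theta_2=j^2_pS\in J^2\pi$ and $\theta_1=j^1_pS$. Let $K_{\theta_2}$ be the tangent space at $\theta_1$ to the image of $q\mapsto j^1_qS$ and $$A_{\theta_2}=\{\,j^3_pX \mid X^{(1)}_{\theta_1}\in K_{\theta_2}\,\}.$$ The bracket of vector fields induces a bracket of jets, $[j^3_pX,j^3_pY]=j^2_p[X,Y]$. A subspace $H\subset A_{\theta_2}$ is horizontal if $j^3_pX\mapsto X_p$ maps $H$ isomorphically onto $T_p$; then $\omega_H(X_p,Y_p)=[j^3_pX,j^3_pY]$ for $j^3_pX,j^3_pY\in H$ is a $2$-form on $T_p$ with values in $2$-jets of vector fields. There are horizontal $H\subset A_{\theta_2}$ for which all brackets of elements of $H$ have zero $1$-jet at $p$, and $\omega_H$ is the same for all such $H$; it is denoted by $\omega_{\theta_2}$. Put $\omega^2:\theta_2\mapsto\omega_{\theta_2}$, and let $\omega^2_{\mathcal E}$ be the restriction of $\omega^2$ to the image of $p\mapsto j^2_pS_{\mathcal E}$, $p\in U$. **Theorem.** The equation $\mathcal E$ can be reduced to linear form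 by a point transformation if and only if $\omega^2_{\mathcal E}=0$. Equivalently, it can be so reduced if and only if $F^1=F^2=0$ at all points of $U$, where, with $u^i=a^{i-1}$ and lower indices denoting partial derivatives with respect to $x^1=x$, $x^2=y$, $$\begin{aligned} F^1&=3u^1_{22}-2u^2_{12}+u^3_{11}+3u^4u^1_1-3u^3u^1_2+2u^2u^2_2-u^2u^3_1-3u^1u^3_2+6u^1u^4_1,\\ F^2&=u^2_{22}-2u^3_{12}+3u^4_{11}-3u^1u^4_2+3u^2u^4_1-2u^3u^3_1+u^3u^2_2+3u^4u^2_1-6u^4u^1_2 . \end{aligned}$$ -/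

import Mathlib

open scoped ContDiff Topology

noncomputable section

namespace CubicODE

/-! ### The plane, partial derivatives, jets -/

/-- The base `ℝ²`; the coordinates `(x¹, x²) = (x, y)` of a point `p` are `(p 0, p 1)`. -/
abbrev Plane : Type := Fin 2 → ℝ

/-- The fibre `ℝ⁴` of the bundle of equations; the coordinates `(u¹, u², u³, u⁴)` of a point `u`,
which are the values of `(a⁰, a¹, a², a³)`, are `(u 0, u 1, u 2, u 3)`. -/
abbrev Fibre : Type := Fin 4 → ℝ

/-- The partial derivative `∂f/∂xʲ`. -/
def pd {F : Type} [NormedAddCommGroup F] [NormedSpace ℝ F] (j : Fin 2) (f : Plane → F) :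
    Plane → F :=
  fun q => fderiv ℝ f q (Pi.single j 1)

/-- Maps that are smooth in a neighbourhood of `p`. -/
def SmoothNear (F : Type) [NormedAddCommGroup F] [NormedSpace ℝ F] (p : Plane) :
    Submodule ℝ (Plane → F) where
  carrier := {f | ∀ᶠ q in 𝓝 p, ContDiffAt ℝ ∞ f q}
  add_mem' := by
    intro f g hf hg
    filter_upwards [hf, hg] with q h1 h2 using h1.add h2
  zero_mem' := Filter.Eventually.of_forall fun _ => contDiffAt_const
  smul_mem' := by
    intro c f hf
    filter_upwards [hf] with q h using h.const_smul c

theorem contDiffAt_of_smoothNear {F : Type} [NormedAddCommGroup F] [NormedSpace ℝ F] {p : Plane}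
    (f : SmoothNear F p) : ContDiffAt ℝ ∞ f.1 p :=
  Filter.Eventually.self_of_nhds f.2

/-- The maps with `j_p^k f = 0`: the derivatives at `p` of all orders `≤ k` vanish. -/
def vanishing (F : Type) [NormedAddCommGroup F] [NormedSpace ℝ F] (p : Plane) (k : ℕ) :
    Submodule ℝ (SmoothNear F p) where
  carrier := {f | ∀ n ≤ k, iteratedFDeriv ℝ n f.1 p = 0}
  add_mem' := by
    intro f g hf hg n hn
    have h1 : ContDiffAt ℝ n f.1 p := (contDiffAt_of_smoothNear f).of_le (by exact_mod_cast le_top)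
    have h2 : ContDiffAt ℝ n g.1 p := (contDiffAt_of_smoothNear g).of_le (by exact_mod_cast le_top)
    have := iteratedFDeriv_add_apply h1 h2
    rw [hf n hn, hg n hn, add_zero] at this
    exact this
  zero_mem' := by
    intro n _
    change iteratedFDeriv ℝ n (0 : Plane → F) p = 0
    simp
  smul_mem' := by
    intro c f hf n hn
    have h1 : ContDiffAt ℝ n f.1 p := (contDiffAt_of_smoothNear f).of_le (by exact_mod_cast le_top)
    have := iteratedFDeriv_const_smul_apply (a := c) h1
    rw [hf n hn, smul_zero] at this
    exact this

/-- The space of `k`-jets at `p` of maps `ℝ² → F`. For `F = ℝ²` these are the `k`-jets of vector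
fields, `W_p / L_p^k`; for `F = ℝ⁴` they are the points over `p` of the bundle of `k`-jets of
sections. -/
abbrev Jet (F : Type) [NormedAddCommGroup F] [NormedSpace ℝ F] (p : Plane) (k : ℕ) : Type :=
  SmoothNear F p ⧸ vanishing F p k

/-- The jet `j_p^k f`. -/
def jet {F : Type} [NormedAddCommGroup F] [NormedSpace ℝ F] {p : Plane} (k : ℕ)
    (f : SmoothNear F p) : Jet F p k :=
  Submodule.Quotient.mk f

/-- The projection `ρ_{k,l} : j_p^k f ↦ j_p^l f`, `l ≤ k`. -/
def proj {F : Type} [NormedAddCommGroup F] [NormedSpace ℝ F] {p : Plane} {k l : ℕ} (h : l ≤ k) :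
    Jet F p k →ₗ[ℝ] Jet F p l :=
  Submodule.mapQ (vanishing F p k) (vanishing F p l) LinearMap.id
    (fun _ hf n hn => hf n (hn.trans h))

/-- The value `j_p^k f ↦ f(p)`. For vector fields this is the projection
`ρ_{k,0} : j_p^k X ↦ X_p` onto the tangent space `T_p = ℝ²`. -/
def value {F : Type} [NormedAddCommGroup F] [NormedSpace ℝ F] {p : Plane} (k : ℕ) :
    Jet F p k →ₗ[ℝ] F :=
  (vanishing F p k).liftQ
    { toFun := fun f => f.1 p
      map_add' := fun _ _ => rfl
      map_smul' := fun _ _ => rfl }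
    (by
      intro f hf
      have h := hf 0 (Nat.zero_le k)
      have h' := congrArg (fun m => m (fun _ => (0 : Plane))) h
      simpa using h')

theorem pd_mem {F : Type} [NormedAddCommGroup F] [NormedSpace ℝ F] {p : Plane} (j : Fin 2)
    {f : Plane → F} (hf : f ∈ SmoothNear F p) : pd j f ∈ SmoothNear F p := by
  have hf' : ∀ᶠ q in 𝓝 p, ContDiffAt ℝ ∞ f q := hf
  change ∀ᶠ q in 𝓝 p, ContDiffAt ℝ ∞ (pd j f) q
  filter_upwards [hf'] with q h
  exact (h.fderiv_right (m := ∞) (by simp)).clm_apply contDiffAt_const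

theorem comp_mem {n : ℕ} {p : Plane} {f : Plane → Fin n → ℝ} (hf : f ∈ SmoothNear (Fin n → ℝ) p)
    (i : Fin n) : ∀ᶠ q in 𝓝 p, ContDiffAt ℝ ∞ (fun x => f x i) q := by
  have hf' : ∀ᶠ q in 𝓝 p, ContDiffAt ℝ ∞ f q := hf
  filter_upwards [hf'] with q h
  exact contDiffAt_pi.1 h i

/-! ### The bracket of jets of vector fields -/

theorem bilin_vanish {E F G : Type} [NormedAddCommGroup E] [NormedSpace ℝ E]
    [NormedAddCommGroup F] [NormedSpace ℝ F] [NormedAddCommGroup G] [NormedSpace ℝ G]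
    (B : E →L[ℝ] F →L[ℝ] G) {p : Plane} {f : Plane → E} {g : Plane → F}
    (hf : ∀ᶠ q in 𝓝 p, ContDiffAt ℝ ∞ f q) (hg : ∀ᶠ q in 𝓝 p, ContDiffAt ℝ ∞ g q) {n : ℕ}
    (h : (∀ i ≤ n, iteratedFDeriv ℝ i f p = 0) ∨ (∀ i ≤ n, iteratedFDeriv ℝ i g p = 0)) :
    iteratedFDeriv ℝ n (fun y => B (f y) (g y)) p = 0 := by
  obtain ⟨s, hs, hso, hps⟩ := eventually_nhds_iff.1 (hf.and hg)
  have hfs : ContDiffOn ℝ ∞ f s := fun x hx => (hs x hx).1.contDiffWithinAt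
  have hgs : ContDiffOn ℝ ∞ g s := fun x hx => (hs x hx).2.contDiffWithinAt
  have key := B.norm_iteratedFDerivWithin_le_of_bilinear (n := n) hfs hgs hso.uniqueDiffOn hps
    (by exact_mod_cast le_top)
  rw [iteratedFDerivWithin_of_isOpen n hso hps] at key
  have hz : (∑ i ∈ Finset.range (n + 1), (n.choose i : ℝ) * ‖iteratedFDerivWithin ℝ i f s p‖ *
      ‖iteratedFDerivWithin ℝ (n - i) g s p‖) = 0 := by
    refine Finset.sum_eq_zero fun i hi => ?_
    have hi' : i ≤ n := Nat.lt_succ_iff.1 (Finset.mem_range.1 hi)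
    rw [iteratedFDerivWithin_of_isOpen i hso hps, iteratedFDerivWithin_of_isOpen (n - i) hso hps]
    rcases h with h | h
    · rw [h i hi']; simp
    · rw [h (n - i) (Nat.sub_le _ _)]; simp
  rw [hz, mul_zero] at key
  exact norm_le_zero_iff.1 key

theorem fderiv_smooth {F : Type} [NormedAddCommGroup F] [NormedSpace ℝ F] {p : Plane}
    (f : SmoothNear F p) : ∀ᶠ q in 𝓝 p, ContDiffAt ℝ ∞ (fderiv ℝ f.1) q := by
  filter_upwards [show ∀ᶠ q in 𝓝 p, ContDiffAt ℝ ∞ f.1 q from f.2] with q h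
  exact h.fderiv_right (m := ∞) (by simp)

theorem fderiv_vanish {F : Type} [NormedAddCommGroup F] [NormedSpace ℝ F] {p : Plane} {m : ℕ}
    {f : SmoothNear F p} (hf : f ∈ vanishing F p (m + 1)) {i : ℕ} (hi : i ≤ m) :
    iteratedFDeriv ℝ i (fderiv ℝ f.1) p = 0 := by
  rw [← norm_eq_zero, norm_iteratedFDeriv_fderiv, hf (i + 1) (by omega), norm_zero]

/-- The Lie bracket of vector fields defined near `p`. -/
def lieB {p : Plane} (X Y : SmoothNear Plane p) : SmoothNear Plane p :=
  ⟨VectorField.lieBracket ℝ X.1 Y.1, by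
    have h1 : ∀ᶠ q in 𝓝 p, ContDiffAt ℝ ∞ X.1 q := X.2
    have h2 : ∀ᶠ q in 𝓝 p, ContDiffAt ℝ ∞ Y.1 q := Y.2
    change ∀ᶠ q in 𝓝 p, ContDiffAt ℝ ∞ (VectorField.lieBracket ℝ X.1 Y.1) q
    filter_upwards [h1, h2] with q hX hY
    exact hX.lieBracket_vectorField (m := ∞) hY (by simp)⟩

theorem lieB_swap {p : Plane} (X Y : SmoothNear Plane p) : lieB X Y = -lieB Y X := by
  apply Subtype.ext
  funext q
  change fderiv ℝ Y.1 q (X.1 q) - fderiv ℝ X.1 q (Y.1 q) =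
    -(fderiv ℝ X.1 q (Y.1 q) - fderiv ℝ Y.1 q (X.1 q))
  abel

theorem lieB_vanish {p : Plane} {m : ℕ} {X : SmoothNear Plane p} (Y : SmoothNear Plane p)
    (hX : X ∈ vanishing Plane p (m + 1)) : lieB X Y ∈ vanishing Plane p m := by
  intro n hn
  have hX0 : ∀ i ≤ n, iteratedFDeriv ℝ i X.1 p = 0 := fun i hi => hX i (by omega)
  have hX1 : ∀ i ≤ n, iteratedFDeriv ℝ i (fderiv ℝ X.1) p = 0 :=
    fun i hi => fderiv_vanish hX (hi.trans hn)
  have e1 := bilin_vanish (ContinuousLinearMap.id ℝ (Plane →L[ℝ] Plane)) (n := n)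
    (fderiv_smooth Y) X.2 (Or.inr hX0)
  have e2 := bilin_vanish (ContinuousLinearMap.id ℝ (Plane →L[ℝ] Plane)) (n := n)
    (fderiv_smooth X) Y.2 (Or.inl hX1)
  simp only [ContinuousLinearMap.id_apply] at e1 e2
  have s1 : ContDiffAt ℝ n (fun q => fderiv ℝ Y.1 q (X.1 q)) p :=
    ((fderiv_smooth Y).self_of_nhds.clm_apply (contDiffAt_of_smoothNear X)).of_le (by exact_mod_cast le_top)
  have s2 : ContDiffAt ℝ n (fun q => fderiv ℝ X.1 q (Y.1 q)) p :=
    ((fderiv_smooth X).self_of_nhds.clm_apply (contDiffAt_of_smoothNear Y)).of_le (by exact_mod_cast le_top)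
  have h := iteratedFDeriv_sub_apply s1 s2
  rw [e1, e2, sub_zero] at h
  exact h

theorem jet_eq_of_eventuallyEq {F : Type} [NormedAddCommGroup F] [NormedSpace ℝ F] {p : Plane}
    {f g : SmoothNear F p} (h : f.1 =ᶠ[𝓝 p] g.1) (k : ℕ) : jet k f = jet k g := by
  refine (Submodule.Quotient.eq _).2 fun n _ => ?_
  have hfg : (f - g).1 =ᶠ[𝓝 p] (fun _ => (0 : F)) := by
    filter_upwards [h] with q hq
    exact sub_eq_zero.2 hq
  rw [(Filter.EventuallyEq.iteratedFDeriv ℝ hfg n).self_of_nhds]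
  simp

theorem jet_neg {F : Type} [NormedAddCommGroup F] [NormedSpace ℝ F] {p : Plane} (k : ℕ)
    (f : SmoothNear F p) : jet k (-f) = -jet k f :=
  rfl

theorem lieB_add {p : Plane} (X X' Y : SmoothNear Plane p) (m : ℕ) :
    jet m (lieB (X + X') Y) = jet m (lieB X Y) + jet m (lieB X' Y) := by
  change _ = jet m (lieB X Y + lieB X' Y)
  refine jet_eq_of_eventuallyEq ?_ m
  filter_upwards [show ∀ᶠ q in 𝓝 p, ContDiffAt ℝ ∞ X.1 q from X.2,
    show ∀ᶠ q in 𝓝 p, ContDiffAt ℝ ∞ X'.1 q from X'.2] with q h h'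
  exact VectorField.lieBracket_add_left (h.differentiableAt (by simp))
    (h'.differentiableAt (by simp))

theorem lieB_smul {p : Plane} (c : ℝ) (X Y : SmoothNear Plane p) (m : ℕ) :
    jet m (lieB (c • X) Y) = c • jet m (lieB X Y) := by
  change _ = jet m (c • lieB X Y)
  refine jet_eq_of_eventuallyEq ?_ m
  filter_upwards [show ∀ᶠ q in 𝓝 p, ContDiffAt ℝ ∞ X.1 q from X.2] with q h
  exact VectorField.lieBracket_const_smul_left (h.differentiableAt (by simp))

/-- `(X, Y) ↦ j_p^m [X, Y]`. -/
def jetLieB {p : Plane} (m : ℕ) :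
    SmoothNear Plane p →ₗ[ℝ] SmoothNear Plane p →ₗ[ℝ] Jet Plane p m :=
  LinearMap.mk₂ ℝ (fun X Y => jet m (lieB X Y))
    (fun X X' Y => lieB_add X X' Y m)
    (fun c X Y => lieB_smul c X Y m)
    (fun X Y Y' => by
      rw [lieB_swap X (Y + Y'), lieB_swap X Y, lieB_swap X Y', jet_neg, jet_neg, jet_neg, lieB_add,
        neg_add])
    (fun c X Y => by
      rw [lieB_swap X (c • Y), lieB_swap X Y, jet_neg, jet_neg, lieB_smul, smul_neg])

theorem jetLieB_left {p : Plane} (m : ℕ) :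
    vanishing Plane p (m + 1) ≤ LinearMap.ker (jetLieB (p := p) m) := by
  intro X hX
  rw [LinearMap.mem_ker]
  refine LinearMap.ext fun Y => ?_
  exact (Submodule.Quotient.mk_eq_zero _).2 (lieB_vanish Y hX)

/-- The bracket `[j_p^{m+1} X, j_p^{m+1} Y] = j_p^m [X, Y]`, a bilinear map
`W_p/L_p^{m+1} × W_p/L_p^{m+1} → W_p/L_p^m`. -/
def bracket {p : Plane} (m : ℕ) :
    Jet Plane p (m + 1) →ₗ[ℝ] Jet Plane p (m + 1) →ₗ[ℝ] Jet Plane p m :=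
  (vanishing Plane p (m + 1)).liftQ
    (LinearMap.flip ((vanishing Plane p (m + 1)).liftQ (jetLieB (p := p) m).flip (by
      intro Y hY
      rw [LinearMap.mem_ker]
      refine LinearMap.ext fun X => ?_
      change jet m (lieB X Y) = 0
      rw [lieB_swap, jet_neg, neg_eq_zero]
      exact (Submodule.Quotient.mk_eq_zero _).2 (lieB_vanish X hY))))
    (by
      intro X hX
      rw [LinearMap.mem_ker]
      refine LinearMap.ext fun y => ?_
      obtain ⟨Y, rfl⟩ := Submodule.Quotient.mk_surjective _ y
      exact (Submodule.Quotient.mk_eq_zero _).2 (lieB_vanish Y hX))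

theorem bracket_jet {p : Plane} (m : ℕ) (X Y : SmoothNear Plane p) :
    bracket m (jet (m + 1) X) (jet (m + 1) Y) = jet m (lieB X Y) :=
  rfl

/-! ### Transformation of equations

A section `S : p ↦ (a⁰(p), a¹(p), a²(p), a³(p))` is identified with the equation
`y'' = a³ y'³ + a² y'² + a¹ y' + a⁰`. -/

/-- The right-hand side of the equation with coefficients `u`, at the slope `z = y'`. -/
def cubic (u : Fibre) (z : ℝ) : ℝ := u 3 * z ^ 3 + u 2 * z ^ 2 + u 1 * z + u 0

/-- For `(x̃, ỹ) = f(x, y)`: the derivative `dx̃/dx` (`i = 0`) or `dỹ/dx` (`i = 1`) along a curve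
through `p` with `y' = z`. -/
def total1 (f : Plane → Plane) (i : Fin 2) (p : Plane) (z : ℝ) : ℝ :=
  pd 0 f p i + pd 1 f p i * z

/-- For `(x̃, ỹ) = f(x, y)`: the second derivative `d²x̃/dx²` (`i = 0`) or `d²ỹ/dx²` (`i = 1`) along
a curve through `p` with `y' = z` and `y'' = w`. -/
def total2 (f : Plane → Plane) (i : Fin 2) (p : Plane) (z w : ℝ) : ℝ :=
  pd 0 (pd 0 f) p i + 2 * pd 0 (pd 1 f) p i * z + pd 1 (pd 1 f) p i * z ^ 2 + pd 1 f p i * w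

/-- `f` transforms, on the open set `V`, the equation `a` to the equation `b`: the prolongation
`(x, y, y', y'') ↦ (x̃, ỹ, dỹ/dx̃, d²ỹ/dx̃²)` of `f` takes the elements `(p, z, w)` over `V` that
satisfy the first equation exactly to elements that satisfy the second one. (The prolongation is
defined where `dx̃/dx ≠ 0`.) -/
def Transforms (f : Plane → Plane) (V : Set Plane) (a b : Plane → Fibre) : Prop :=
  ∀ p ∈ V, ∀ z w : ℝ, total1 f 0 p z ≠ 0 →
    (w = cubic (a p) z ↔
      (total1 f 0 p z * total2 f 1 p z w - total1 f 1 p z * total2 f 0 p z w)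
          / total1 f 0 p z ^ 3
        = cubic (b (f p)) (total1 f 1 p z / total1 f 0 p z))

/-- On the set `V` the equation `b` has linear form `y'' = A(x) y' + B(x) y + C(x)`, with smooth
functions `A`, `B`, `C`. -/
def IsLinearOn (V : Set Plane) (b : Plane → Fibre) : Prop :=
  ∃ A B C : ℝ → ℝ,
    ContDiffOn ℝ ∞ A ((fun q : Plane => q 0) '' V) ∧
    ContDiffOn ℝ ∞ B ((fun q : Plane => q 0) '' V) ∧
    ContDiffOn ℝ ∞ C ((fun q : Plane => q 0) '' V) ∧
    ∀ q ∈ V, b q = ![B (q 0) * q 1 + C (q 0), A (q 0), 0, 0]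

/-- A point transformation: a diffeomorphism of an open subset of `ℝ²` onto an open subset
of `ℝ²`. -/
def IsPointTransformation (f : OpenPartialHomeomorph Plane Plane) : Prop :=
  ContDiffOn ℝ ∞ f f.source ∧ ContDiffOn ℝ ∞ f.symm f.target

/-- The equation `a` on the open set `U` can be reduced to linear form by a point transformation
(in a neighbourhood of every point of `U`). -/
def ReducibleToLinear (U : Set Plane) (a : Plane → Fibre) : Prop :=
  ∀ p ∈ U, ∃ f : OpenPartialHomeomorph Plane Plane, IsPointTransformation f ∧
    p ∈ f.source ∧ f.source ⊆ U ∧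
    ∃ b : Plane → Fibre, IsLinearOn f.target b ∧ Transforms f f.source a b

/-! ### Lifting of vector fields -/

/-- The deformation velocity `ψ_X(j_q^1 S) = d/dt|_{t = 0} (f_t^{(0)} ∘ S ∘ f_t^{-1})(q)` of the
section `S` under the flow `f_t` of `X`, in coordinates. -/
def psi (X : Plane → Plane) (S : Plane → Fibre) : Plane → Fibre := fun q =>
  ![ -(pd 0 S q 0) * X q 0 - pd 1 S q 0 * X q 1
      - 2 * S q 0 * pd 0 X q 0 + S q 0 * pd 1 X q 1 - S q 1 * pd 0 X q 1
      + pd 0 (pd 0 X) q 1,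
     -(pd 0 S q 1) * X q 0 - pd 1 S q 1 * X q 1
      - 3 * S q 0 * pd 1 X q 0 - S q 1 * pd 0 X q 0 - 2 * S q 2 * pd 0 X q 1
      - pd 0 (pd 0 X) q 0 + 2 * pd 0 (pd 1 X) q 1,
     -(pd 0 S q 2) * X q 0 - pd 1 S q 2 * X q 1
      - 2 * S q 1 * pd 1 X q 0 - S q 2 * pd 1 X q 1 - 3 * S q 3 * pd 0 X q 1
      - 2 * pd 0 (pd 1 X) q 0 + pd 1 (pd 1 X) q 1,
     -(pd 0 S q 3) * X q 0 - pd 1 S q 3 * X q 1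
      - S q 2 * pd 1 X q 0 + S q 3 * pd 0 X q 0 - 2 * S q 3 * pd 1 X q 1
      - pd 1 (pd 1 X) q 0 ]

theorem psi_mem {p : Plane} {X : Plane → Plane} {S : Plane → Fibre}
    (hX : X ∈ SmoothNear Plane p) (hS : S ∈ SmoothNear Fibre p) : psi X S ∈ SmoothNear Fibre p := by
  change ∀ᶠ q in 𝓝 p, ContDiffAt ℝ ∞ (psi X S) q
  have hX' := fun i => comp_mem hX i
  have hS' := fun i => comp_mem hS i
  have hXj := fun j i => comp_mem (pd_mem j hX) i
  have hSj := fun j i => comp_mem (pd_mem j hS) i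
  have hXjk := fun j k i => comp_mem (pd_mem j (pd_mem k hX)) i
  simp only [← Filter.eventually_all] at hX' hS' hXj hSj hXjk
  filter_upwards [hX', hS', hXj, hSj, hXjk] with q h1 h2 h3 h4 h5
  refine contDiffAt_pi.2 fun i => ?_
  fin_cases i <;>
    simp only [psi, Fin.zero_eta, Fin.mk_one, Fin.reduceFinMk, Matrix.cons_val] <;> fun_prop

/-- The coefficients of the transformed equation: if the substitution with first derivatives
`x̃_x, x̃_y, ỹ_x, ỹ_y = α, β, γ, δ` and second derivatives `x̃_xx, x̃_xy, x̃_yy = A, A', A''`,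
`ỹ_xx, ỹ_xy, ỹ_yy = B, B', B''` takes `u` to `v`, then `u` is given by the formulas below. -/
theorem coeff_of_transforms {f : Plane → Plane} {p : Plane} {a b : Plane → Fibre}
    (h : Transforms f {p} a b) {α β γ δ A A' A'' B B' B'' : ℝ}
    (hα : α = pd 0 f p 0) (hβ : β = pd 1 f p 0) (hγ : γ = pd 0 f p 1) (hδ : δ = pd 1 f p 1)
    (hA : A = pd 0 (pd 0 f) p 0) (hA' : A' = pd 0 (pd 1 f) p 0) (hA'' : A'' = pd 1 (pd 1 f) p 0)
    (hB : B = pd 0 (pd 0 f) p 1) (hB' : B' = pd 0 (pd 1 f) p 1) (hB'' : B'' = pd 1 (pd 1 f) p 1)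
    {u v : Fibre} (hu : u = a p) (hv : v = b (f p))
    (h0 : α ≠ 0) (h1 : α + β ≠ 0) (h2 : α - β ≠ 0) (h3 : α + 2 * β ≠ 0) :
    (α * δ - β * γ) * u 0 = v 0 * α ^ 3 + v 1 * γ * α ^ 2 + v 2 * γ ^ 2 * α + v 3 * γ ^ 3
      + γ * A - α * B ∧
    (α * δ - β * γ) * u 1 = 3 * v 0 * α ^ 2 * β + v 1 * (δ * α ^ 2 + 2 * γ * α * β)
      + v 2 * (2 * γ * δ * α + γ ^ 2 * β) + 3 * v 3 * γ ^ 2 * δ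
      + δ * A + 2 * γ * A' - β * B - 2 * α * B' ∧
    (α * δ - β * γ) * u 2 = 3 * v 0 * α * β ^ 2 + v 1 * (γ * β ^ 2 + 2 * δ * α * β)
      + v 2 * (δ ^ 2 * α + 2 * γ * δ * β) + 3 * v 3 * γ * δ ^ 2
      + 2 * δ * A' + γ * A'' - 2 * β * B' - α * B'' ∧
    (α * δ - β * γ) * u 3 = v 0 * β ^ 3 + v 1 * δ * β ^ 2 + v 2 * δ ^ 2 * β + v 3 * δ ^ 3
      + δ * A'' - β * B'' := by
  have key : ∀ z : ℝ, α + β * z ≠ 0 →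
      (α + β * z) * (B + 2 * B' * z + B'' * z ^ 2 + δ * cubic u z)
        - (γ + δ * z) * (A + 2 * A' * z + A'' * z ^ 2 + β * cubic u z)
      = v 3 * (γ + δ * z) ^ 3 + v 2 * (γ + δ * z) ^ 2 * (α + β * z)
        + v 1 * (γ + δ * z) * (α + β * z) ^ 2 + v 0 * (α + β * z) ^ 3 := by
    intro z hz
    have e := (h p rfl z (cubic u z) (by rw [total1, ← hα, ← hβ]; exact hz)).1 (by rw [hu])
    simp only [total1, total2, ← hα, ← hβ, ← hγ, ← hδ, ← hA, ← hA', ← hA'', ← hB, ← hB', ← hB'',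
      ← hv] at e
    rw [div_eq_iff (pow_ne_zero 3 hz)] at e
    rw [e, cubic]
    generalize α + β * z = D at hz
    field_simp
  have k0 := key 0 (by simpa using h0)
  have k1 := key 1 (by simpa using h1)
  have k2 := key (-1) (by intro h; apply h2; linarith)
  have k3 := key 2 (by intro h; apply h3; linarith)
  simp only [cubic] at k0 k1 k2 k3
  refine ⟨?_, ?_, ?_, ?_⟩
  · linear_combination k0
  · linear_combination k1 - k0 / 2 - k2 / 3 - k3 / 6
  · linear_combination k1 / 2 + k2 / 2 - k0
  · linear_combination k0 / 2 - k1 / 2 - k2 / 6 + k3 / 6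

/-- `psi` is the deformation velocity: let `b t` be the equations obtained from `S` by point
transformations `f_t` (that is, `g t = f_t⁻¹` transforms `b t` to `S`) with `f_0 = id`, for which
the 2-jet of `g t` at `p` has velocity `-j_p² X` at `t = 0`, as is the case for the flow `f_t` of
`X`. Then `d/dt|_{t = 0} (b t)(p) = psi X S p`. -/
theorem hasDerivAt_psi {p : Plane} {X : Plane → Plane} {S : Plane → Fibre}
    (hS : DifferentiableAt ℝ S p) {g : ℝ → Plane → Plane} {b : ℝ → Plane → Fibre}
    (hb : ∀ᶠ t in 𝓝 (0 : ℝ), Transforms (g t) {p} (b t) S)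
    (hg : g 0 =ᶠ[𝓝 p] id)
    (hg0 : ∀ i, HasDerivAt (fun t => g t p i) (-X p i) 0)
    (hg1 : ∀ j i, HasDerivAt (fun t => pd j (g t) p i) (-pd j X p i) 0)
    (hg2 : ∀ j k i, HasDerivAt (fun t => pd j (pd k (g t)) p i) (-pd j (pd k X) p i) 0)
    (k : Fin 4) : HasDerivAt (fun t => b t p k) (psi X S p k) 0 := by
  have e0 : g 0 p = p := hg.self_of_nhds
  have E1 : ∀ j, pd j (g 0) =ᶠ[𝓝 p] fun _ => Pi.single j 1 := by
    intro j
    filter_upwards [hg.eventuallyEq_nhds] with q hq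
    rw [pd, hq.fderiv_eq]
    simp
  have E2 : ∀ j k, pd j (pd k (g 0)) p = 0 := by
    intro j k
    rw [pd, (E1 k).fderiv_eq]
    simp
  have e1 : ∀ j, pd j (g 0) p = Pi.single j 1 := fun j => (E1 j).self_of_nhds
  have hv : ∀ i, HasDerivAt (fun t => S (g t p) i) (-(pd 0 S p i * X p 0 + pd 1 S p i * X p 1)) 0 := by
    intro i
    have c : HasDerivAt (fun t => g t p) (-X p) 0 := hasDerivAt_pi.2 hg0
    have c' : HasFDerivAt S (fderiv ℝ S p) (g 0 p) := by rw [e0]; exact hS.hasFDerivAt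
    have r := hasDerivAt_pi.1 (c'.comp_hasDerivAt 0 c) i
    have hx : X p = X p 0 • Pi.single 0 1 + X p 1 • Pi.single 1 1 := by
      ext i; fin_cases i <;> simp
    refine r.congr_deriv ?_
    rw [map_neg, hx, map_add, map_smul, map_smul]
    simp [pd, mul_comm]
  have hα := hg1 0 0
  have hβ := hg1 1 0
  have hγ := hg1 0 1
  have hδ := hg1 1 1
  have ev : ∀ c : ℝ, ∀ᶠ t in 𝓝 (0 : ℝ), pd 0 (g t) p 0 + c * pd 1 (g t) p 0 ≠ 0 := by
    intro c
    refine (hα.continuousAt.add (hβ.continuousAt.const_mul c)).eventually_ne ?_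
    simp [e1]
  have hJ := (hα.mul hδ).sub (hβ.mul hγ)
  have evJ : ∀ᶠ t in 𝓝 (0 : ℝ),
      pd 0 (g t) p 0 * pd 1 (g t) p 1 - pd 1 (g t) p 0 * pd 0 (g t) p 1 ≠ 0 := by
    refine hJ.continuousAt.eventually_ne ?_
    simp [e1]
  have main : ∀ {N : ℝ → ℝ} {N' : ℝ}, HasDerivAt N N' 0 →
      (∀ᶠ t in 𝓝 (0 : ℝ), (pd 0 (g t) p 0 * pd 1 (g t) p 1 - pd 1 (g t) p 0 * pd 0 (g t) p 1)
        * b t p k = N t) →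
      N' + (pd 0 X p 0 + pd 1 X p 1) * N 0 = psi X S p k →
      HasDerivAt (fun t => b t p k) (psi X S p k) 0 := by
    intro N N' hN hE hval
    have hq := hN.div hJ (by simp [e1])
    refine (hq.congr_deriv ?_).congr_of_eventuallyEq ?_
    · rw [← hval]
      simp [e1]
      ring
    · filter_upwards [hE, evJ] with t ht hne
      exact (eq_div_iff hne).2 ((mul_comm _ _).trans ht)
  have co := fun t (ht : Transforms (g t) {p} (b t) S) => coeff_of_transforms ht rfl rfl rfl rfl rfl
    rfl rfl rfl rfl rfl rfl rfl
  have evs := ((((hb.and (ev 0)).and (ev 1)).and (ev (-1))).and (ev 2))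
  have co' : ∀ᶠ t in 𝓝 (0 : ℝ), _ := evs.mono fun t ht =>
    co t ht.1.1.1.1 (by simpa using ht.1.1.1.2) (by simpa using ht.1.1.2)
      (by have := ht.1.2; intro h; apply this; linarith) ht.2
  fin_cases k
  · refine main
      ((((((((hv 0)).mul (hα.pow 3)).add ((((hv 1)).mul hγ).mul (hα.pow 2))).add
        ((((hv 2)).mul (hγ.pow 2)).mul hα)).add (((hv 3)).mul (hγ.pow 3))).add (hγ.mul
        (hg2 0 0 0))).sub (hα.mul (hg2 0 0 1)))
      (co'.mono fun t ht => ht.1) ?_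
    simp [e0, e1, E2, psi]
    ring
  · refine main
      ((((((((((((hv 0).const_mul 3)).mul (hα.pow 2)).mul hβ).add (((hv 1)).mul
        ((hδ.mul (hα.pow 2)).add ((((hγ.const_mul 2)).mul hα).mul hβ)))).add (((hv
        2)).mul (((((hγ.const_mul 2)).mul hδ).mul hα).add (((hγ.pow 2)).mul hβ)))).add
        (((((hv 3).const_mul 3)).mul (hγ.pow 2)).mul hδ)).add (hδ.mul (hg2 0 0
        0))).add (((hγ.const_mul 2)).mul (hg2 0 1 0))).sub (hβ.mul (hg2 0 0 1))).sub
        (((hα.const_mul 2)).mul (hg2 0 1 1)))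
      (co'.mono fun t ht => ht.2.1) ?_
    simp [e0, e1, E2, psi]
    ring
  · refine main
      ((((((((((((hv 0).const_mul 3)).mul hα).mul (hβ.pow 2)).add (((hv 1)).mul
        ((hγ.mul (hβ.pow 2)).add ((((hδ.const_mul 2)).mul hα).mul hβ)))).add (((hv
        2)).mul ((((hδ.pow 2)).mul hα).add ((((hγ.const_mul 2)).mul hδ).mul hβ)))).add
        (((((hv 3).const_mul 3)).mul hγ).mul (hδ.pow 2))).add (((hδ.const_mul 2)).mul
        (hg2 0 1 0))).add (hγ.mul (hg2 1 1 0))).sub (((hβ.const_mul 2)).mul (hg2 0 1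
        1))).sub (hα.mul (hg2 1 1 1)))
      (co'.mono fun t ht => ht.2.2.1) ?_
    simp [e0, e1, E2, psi]
    ring
  · refine main
      ((((((((hv 0)).mul (hβ.pow 3)).add ((((hv 1)).mul hδ).mul (hβ.pow 2))).add
        ((((hv 2)).mul (hδ.pow 2)).mul hβ)).add (((hv 3)).mul (hδ.pow 3))).add (hδ.mul
        (hg2 1 1 0))).sub (hβ.mul (hg2 1 1 1)))
      (co'.mono fun t ht => ht.2.2.2) ?_
    simp [e0, e1, E2, psi]
    ring

/-- The deformation velocity as a germ of sections. -/
def psiGerm {p : Plane} (X : SmoothNear Plane p) (S : SmoothNear Fibre p) : SmoothNear Fibre p :=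
  ⟨psi X.1 S.1, psi_mem X.2 S.2⟩

/-- The germ of `∂S/∂xʲ`. -/
def pdGerm {p : Plane} (j : Fin 2) (S : SmoothNear Fibre p) : SmoothNear Fibre p :=
  ⟨pd j S.1, pd_mem j S.2⟩

/-- The value at `θ_k = j_p^k S` of the total derivative
`D_j^k = ∂/∂xʲ + ∑ u^i_{σj} ∂/∂u^i_σ`. The standard coordinates `x^j, u^i_σ` identify the tangent
space of the bundle of `k`-jets at `θ_k` with `ℝ² × (the space of k-jets at p)`. -/
def totalD {p : Plane} (k : ℕ) (S : SmoothNear Fibre p) (j : Fin 2) : Plane × Jet Fibre p k :=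
  (Pi.single j 1, jet k (pdGerm j S))

/-- The value at `θ_k = j_p^k S` of the lifted vector field
`X^{(k)} = X¹ D_1^k + X² D_2^k + ∑ D_σ(ψ^i_X) ∂/∂u^i_σ`. -/
def liftVF {p : Plane} (k : ℕ) (X : SmoothNear Plane p) (S : SmoothNear Fibre p) :
    Plane × Jet Fibre p k :=
  X.1 p 0 • totalD k S 0 + X.1 p 1 • totalD k S 1 + (0, jet k (psiGerm X S))

/-- The tangent space `K_{θ_{k+1}} = ⟨D_1^k, D_2^k⟩` at `j_p^k S` of the image of the section `j_k S`,
`θ_{k+1} = j_p^{k+1} S`. -/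
def tangentK {p : Plane} (k : ℕ) (S : SmoothNear Fibre p) :
    Submodule ℝ (Plane × Jet Fibre p k) :=
  Submodule.span ℝ {totalD k S 0, totalD k S 1}

/-! ### The spaces `A_θ`, horizontal subspaces, and the invariant `ω²` -/

/-- `A_{θ_{k+1}} = { j_p^{k+2} X | X^{(k)}_{θ_k} ∈ K_{θ_{k+1}} }`. (Whether the condition holds
depends only on `j_p^{k+2} X` and on `θ_{k+1} = j_p^{k+1} S`.) -/
def spaceA {p : Plane} (k : ℕ) (θ : Jet Fibre p (k + 1)) : Set (Jet Plane p (k + 2)) :=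
  {ξ | ∃ (X : SmoothNear Plane p) (S : SmoothNear Fibre p),
    jet (k + 2) X = ξ ∧ jet (k + 1) S = θ ∧ liftVF k X S ∈ tangentK k S}

/-- `H` is a horizontal subspace of `A_{θ_{k+1}}`: a subspace contained in `A_{θ_{k+1}}` on which
`ρ_{k+2,0}` is an isomorphism onto `T_p`. -/
structure IsHorizontal {p : Plane} (k : ℕ) (θ : Jet Fibre p (k + 1))
    (H : Submodule ℝ (Jet Plane p (k + 2))) : Prop where
  subset : (H : Set (Jet Plane p (k + 2))) ⊆ spaceA k θ
  bijective : Function.Bijective ((value (k + 2)).domRestrict H)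

/-- The inverse `(ρ_{k+2,0}|_H)^{-1} : T_p → H` for a horizontal subspace `H`. -/
def horizontalLift {p : Plane} {k : ℕ} {θ : Jet Fibre p (k + 1)}
    {H : Submodule ℝ (Jet Plane p (k + 2))} (hH : IsHorizontal k θ H) :
    Plane →ₗ[ℝ] Jet Plane p (k + 2) :=
  H.subtype ∘ₗ (LinearEquiv.ofBijective _ hH.bijective).symm.toLinearMap

/-- The 2-form `ω_H(X_p, Y_p) = [(ρ_{k+2,0}|_H)^{-1} X_p, (ρ_{k+2,0}|_H)^{-1} Y_p]` on `T_p`. -/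
def omegaH {p : Plane} {k : ℕ} {θ : Jet Fibre p (k + 1)}
    {H : Submodule ℝ (Jet Plane p (k + 2))} (hH : IsHorizontal k θ H) :
    Plane →ₗ[ℝ] Plane →ₗ[ℝ] Jet Plane p (k + 1) :=
  (bracket (k + 1)).compl₁₂ (horizontalLift hH) (horizontalLift hH)

/-- `H` is a horizontal subspace of `A_{θ₂}` with `ρ_{2,1}([ξ, η]) = 0` for all `ξ, η ∈ H`. -/
structure IsSpecial {p : Plane} (θ : Jet Fibre p 2) (H : Submodule ℝ (Jet Plane p 3)) : Prop where
  horizontal : IsHorizontal 1 θ H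
  bracket_eq_zero : ∀ ξ ∈ H, ∀ η ∈ H,
    proj (F := Plane) (p := p) (show 1 ≤ 2 by norm_num) (bracket 2 ξ η) = 0

open Classical in
/-- The invariant `ω²` at the point `θ₂` over `p`: the 2-form `ω_H` on `T_p`, for any `H` as in
`IsSpecial`. (Such `H` always exist, and `ω_H` does not depend on the choice.) -/
def omega2 {p : Plane} (θ : Jet Fibre p 2) : Plane →ₗ[ℝ] Plane →ₗ[ℝ] Jet Plane p 2 :=
  if h : ∃ H : Submodule ℝ (Jet Plane p 3), IsSpecial θ H then omegaH h.choose_spec.horizontal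
  else 0

theorem section_mem {U : Set Plane} (hU : IsOpen U) {a : Plane → Fibre} (ha : ContDiffOn ℝ ∞ a U)
    {p : Plane} (hp : p ∈ U) : a ∈ SmoothNear Fibre p := by
  change ∀ᶠ q in 𝓝 p, ContDiffAt ℝ ∞ a q
  filter_upwards [hU.mem_nhds hp] with q hq
  exact ha.contDiffAt (hU.mem_nhds hq)

/-- The jet `j_p^k S_E` of the section `S_E = a` of an equation given on the open set `U`. -/
def jetSection {U : Set Plane} (hU : IsOpen U) {a : Plane → Fibre} (ha : ContDiffOn ℝ ∞ a U)
    (k : ℕ) {p : Plane} (hp : p ∈ U) : Jet Fibre p k :=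
  jet k ⟨a, section_mem hU ha hp⟩

/-! ### The functions `F¹`, `F²` of the coefficients of an equation -/

/-- `F¹ = 3u¹₂₂ - 2u²₁₂ + u³₁₁ + 3u⁴u¹₁ - 3u³u¹₂ + 2u²u²₂ - u²u³₁ - 3u¹u³₂ + 6u¹u⁴₁` on the 2-jets of
the section `a`. -/
def F1 (a : Plane → Fibre) (p : Plane) : ℝ :=
  3 * pd 1 (pd 1 a) p 0 - 2 * pd 0 (pd 1 a) p 1 + pd 0 (pd 0 a) p 2
    + 3 * a p 3 * pd 0 a p 0 - 3 * a p 2 * pd 1 a p 0 + 2 * a p 1 * pd 1 a p 1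
    - a p 1 * pd 0 a p 2 - 3 * a p 0 * pd 1 a p 2 + 6 * a p 0 * pd 0 a p 3

/-- `F² = u²₂₂ - 2u³₁₂ + 3u⁴₁₁ - 3u¹u⁴₂ + 3u²u⁴₁ - 2u³u³₁ + u³u²₂ + 3u⁴u²₁ - 6u⁴u¹₂` on the 2-jets of
the section `a`. -/
def F2 (a : Plane → Fibre) (p : Plane) : ℝ :=
  pd 1 (pd 1 a) p 1 - 2 * pd 0 (pd 1 a) p 2 + 3 * pd 0 (pd 0 a) p 3
    - 3 * a p 0 * pd 1 a p 3 + 3 * a p 1 * pd 0 a p 3 - 2 * a p 2 * pd 0 a p 2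
    + a p 2 * pd 1 a p 1 + 3 * a p 3 * pd 0 a p 1 - 6 * a p 3 * pd 1 a p 0

end CubicODE

end

noncomputable section

/-! ### Linear total differential equations -/

section Frobenius

variable {P E : Type*} [NormedAddCommGroup P] [NormedSpace ℝ P] [NormedAddCommGroup E]
  [NormedSpace ℝ E]

/-! The equation `a` is encoded in an overdetermined linear system for one function `s`: each of
`s_xx`, `s_xy`, `s_yy` is a combination of `s_x`, `s_y`, `s`, where the coefficients of `s_x` and
`s_y` are read off from `a` (`coeffA`, `coeffB`). Along a curve with `y' = z`, `y'' = w`, the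
Wronskian of three solutions is their determinant `det3 s s_x s_y` times `w - cubic a z`
(`wron_of_solves`). Hence for independent solutions the integral curves of the equation are those
along which the solutions are linearly dependent, that is, those which become straight lines under
`(s₁/s₀, s₂/s₀)`.

Cross-differentiation gives six integrability conditions. They force the coefficients of `s`
(`coeffC`), and then reduce to `F¹ = F² = 0` (`isFlatAt_iff`). If these hold, the system has three
independent local solutions, by a Frobenius theorem for flat linear total differential equations,
and the quotients reduce the equation to `y'' = 0`.

Conversely, an equation in linear form has `F¹ = F² = 0`, so its system has three independent
solutions. Composed with the point transformation and multiplied by a function that makes their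
determinant `±1`, they solve a system of the same kind for `a` (`F_eq_zero_of_wron`). That system is
therefore integrable, and `F¹ = F² = 0` for `a`.

As for `ω²`, take jets of `X`, `Y` in a special `H` with values `∂_x`, `∂_y` at `p`. The 1-jets of
`ψ_X`, `ψ_Y` vanish at `p`, and so does the 1-jet of `[X, Y]`. These equations determine the second
derivatives of `[X, Y]` at `p`: they are multiples of `F¹` and `F²` (`pd_pd_lieB_eq`). So `ω_H = 0`
exactly when `F¹ = F² = 0`, for every special `H`. A special `H` is constructed from explicit Taylor
polynomials (`exists_symmetry_jet`, `exists_isSpecial`). -/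

theorem norm_le_of_norm_deriv_le {f f' : ℝ → E}
    (hf : ∀ t ∈ Set.Icc (0 : ℝ) 1, HasDerivWithinAt f (f' t) (Set.Icc 0 1) t) {δ ε : ℝ}
    (hε : 0 ≤ ε) (h0 : ‖f 0‖ ≤ δ) (hb : ∀ t ∈ Set.Icc (0 : ℝ) 1, ‖f' t‖ ≤ ‖f t‖ + ε) :
    ∀ t ∈ Set.Icc (0 : ℝ) 1, ‖f t‖ ≤ 3 * (δ + ε) := by
  intro t ht
  have hδ : 0 ≤ δ := (norm_nonneg _).trans h0
  have key := norm_le_gronwallBound_of_norm_deriv_right_le (f := f) (f' := f') (K := 1) (ε := ε)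
    (fun t ht => (hf t ht).continuousWithinAt)
    (fun x hx => ((hf x ⟨hx.1, hx.2.le⟩).mono_of_mem_nhdsWithin
      (Icc_mem_nhdsGE_of_mem hx)))
    h0 (fun x hx => by rw [one_mul]; exact hb x ⟨hx.1, hx.2.le⟩) t ht
  rw [gronwallBound_of_K_ne_0 one_ne_zero] at key
  refine key.trans ?_
  -- Grönwall with constant 1 on `[0, 1]` bounds the norm by `δ e + ε (e - 1)`, up to monotonicity
  -- in `t`; the 3 of the statement is an upper bound for `e`.
  have he : Real.exp (1 * (t - 0)) ≤ 3 := by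
    have : Real.exp (1 * (t - 0)) ≤ Real.exp 1 := Real.exp_le_exp.2 (by linarith [ht.2])
    linarith [Real.exp_one_lt_d9]
  nlinarith

/-- The bound `1/2` lets Picard–Lindelöf cover all of `[0, 1]` at once: on the ball of radius `‖v‖ +
1` about `v` the speed is at most `(2‖v‖ + 1)/2 ≤ ‖v‖ + 1`, so a solution cannot leave the ball
before time 1. -/
theorem exists_radial_solution [CompleteSpace E] (N : ℝ → E →L[ℝ] E)
    (hN : ContinuousOn N (Set.Icc 0 1)) (hb : ∀ t ∈ Set.Icc (0 : ℝ) 1, ‖N t‖ ≤ 1 / 2) (v : E) :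
    ∃ γ : ℝ → E, γ 0 = v ∧
      ∀ t ∈ Set.Icc (0 : ℝ) 1, HasDerivWithinAt γ (N t (γ t)) (Set.Icc 0 1) t := by
  have hP : IsPicardLindelof (fun t x => N t x) (tmin := 0) (tmax := 1)
      ⟨0, Set.left_mem_Icc.2 zero_le_one⟩ v (‖v‖₊ + 1) 0 (‖v‖₊ + 1) 1 := by
    refine ⟨fun t ht => ?_, fun x _ => hN.clm_apply continuousOn_const, fun t ht x hx => ?_, ?_⟩
    · refine ((N t).lipschitz.weaken ?_).lipschitzOnWith
      exact_mod_cast (hb t ht).trans (by norm_num)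
    · have hx' : ‖x‖ ≤ 2 * ‖v‖ + 1 := by
        have h1 := mem_closedBall_iff_norm.1 hx
        have h2 := norm_le_norm_add_norm_sub' x v
        push_cast at h1
        linarith
      refine ((N t).le_of_opNorm_le (hb t ht) x).trans ?_
      push_cast
      linarith [norm_nonneg v]
    · simp
  exact hP.exists_eq_forall_mem_Icc_hasDerivWithinAt₀

/-- A linear total differential equation `dΦ = w Φ` with vanishing curvature has local solutions
with arbitrary initial value. -/
theorem exists_hasFDerivAt_of_flat [CompleteSpace E] {p₀ : P} {w : P → P →L[ℝ] E →L[ℝ] E}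
    (hw : ∀ᶠ q in 𝓝 p₀, ContDiffAt ℝ ∞ w q)
    (hflat : ∀ᶠ q in 𝓝 p₀, ∀ h k : P, fderiv ℝ w q h k + w q k ∘L w q h =
      fderiv ℝ w q k h + w q h ∘L w q k) (v : E) :
    ∃ Φ : P → E, Φ p₀ = v ∧ ∀ᶠ q in 𝓝 p₀, HasFDerivAt Φ ((w q).flip (Φ q)) q := by
  have hw0 := hw.self_of_nhds
  obtain ⟨K₁, t₁, ht₁, hK₁⟩ :=
    (hw0.of_le (by exact_mod_cast le_top : (1 : WithTop ℕ∞) ≤ ∞)).exists_lipschitzOnWith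
  obtain ⟨K₂, t₂, ht₂, hK₂⟩ :=
    ((hw0.fderiv_right (m := ∞) (by simp)).of_le
      (by exact_mod_cast le_top : (1 : WithTop ℕ∞) ≤ ∞)).exists_lipschitzOnWith
  have hd : ∀ᶠ q in 𝓝 p₀, DifferentiableAt ℝ w q := by
    filter_upwards [hw] with q hq using hq.differentiableAt (by simp)
  have hbd : ∀ᶠ q in 𝓝 p₀, ‖w q‖ < ‖w p₀‖ + 1 := by
    have h : ContinuousAt (fun q => ‖w q‖) p₀ := ContinuousAt.norm (f := w) hw0.continuousAt
    exact h.eventually_lt_const (lt_add_one _)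
  have ht : ∀ᶠ q in 𝓝 p₀, q ∈ t₁ ∧ q ∈ t₂ := Filter.Eventually.and ht₁ ht₂
  obtain ⟨r₀, hr₀, hball⟩ := Metric.eventually_nhds_iff_ball.1 (((hflat.and hd).and hbd).and ht)
  obtain ⟨C, hC1, hCw, hC₁, hC₂⟩ : ∃ C : ℝ, 1 ≤ C ∧ ‖w p₀‖ + 1 ≤ C ∧ K₁ ≤ C ∧ K₂ ≤ C :=
    ⟨‖w p₀‖ + 1 + K₁ + K₂, by linarith [norm_nonneg (w p₀), K₁.2, K₂.2],
      by linarith [K₁.2, K₂.2], by linarith [norm_nonneg (w p₀), K₂.2],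
      by linarith [norm_nonneg (w p₀), K₁.2]⟩
  -- `C * r ≤ 1 / 2` gives `‖w (p₀ + t • k) k‖ ≤ 1 / 2` for `‖k‖ < r`, the hypothesis of
  -- `exists_radial_solution`.
  obtain ⟨r, hr, hrr, hrC⟩ : ∃ r : ℝ, 0 < r ∧ r ≤ r₀ ∧ C * r ≤ 1 / 2 :=
    ⟨min r₀ (1 / (2 * C)), lt_min hr₀ (by positivity), min_le_left _ _, by
      calc C * min r₀ (1 / (2 * C)) ≤ C * (1 / (2 * C)) := by gcongr; exact min_le_right _ _
        _ = 1 / 2 := by field_simp⟩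
  have hmem : ∀ k : P, ‖k‖ < r → ∀ t ∈ Set.Icc (0 : ℝ) 1, p₀ + t • k ∈ Metric.ball p₀ r₀ := by
    intro k hk t ht
    rw [mem_ball_iff_norm, add_sub_cancel_left, norm_smul, Real.norm_of_nonneg ht.1]
    nlinarith [norm_nonneg k, ht.2]
  have hflat' := fun q hq => (hball q hq).1.1.1
  have hd' := fun q hq => (hball q hq).1.1.2
  have hb' : ∀ q ∈ Metric.ball p₀ r₀, ‖w q‖ ≤ C := fun q hq => (hball q hq).1.2.le.trans hCw
  have hL₁ : ∀ x ∈ Metric.ball p₀ r₀, ∀ y ∈ Metric.ball p₀ r₀, ‖w y - w x‖ ≤ C * ‖y - x‖ := by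
    intro x hx y hy
    refine (hK₁.norm_sub_le (hball y hy).2.1 (hball x hx).2.1).trans ?_
    gcongr
  have hL₂ : ∀ x ∈ Metric.ball p₀ r₀, ∀ y ∈ Metric.ball p₀ r₀,
      ‖w y - w x - fderiv ℝ w x (y - x)‖ ≤ C * ‖y - x‖ * ‖y - x‖ := by
    intro x hx y hy
    have hseg := (convex_ball p₀ r₀).segment_subset hx hy
    refine Convex.norm_image_sub_le_of_norm_fderiv_le' (𝕜 := ℝ) (f := w) (s := segment ℝ x y)
      (fun z hz => hd' z (hseg hz)) (fun z hz => ?_) (convex_segment x y)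
      (left_mem_segment ℝ x y) (right_mem_segment ℝ x y)
    refine (hK₂.norm_sub_le (hball z (hseg hz)).2.2 (hball x hx).2.2).trans ?_
    have hzx : ‖z - x‖ ≤ ‖y - x‖ := norm_sub_le_of_mem_segment hz
    gcongr
  have hNb : ∀ k : P, ‖k‖ < r → ∀ t ∈ Set.Icc (0 : ℝ) 1, ‖w (p₀ + t • k) k‖ ≤ 1 / 2 := by
    intro k hk t ht
    refine ((w (p₀ + t • k)).le_of_opNorm_le (hb' _ (hmem k hk t ht)) k).trans ?_
    nlinarith
  have hcurve : ∀ (k : P) (t : ℝ), HasDerivAt (fun t : ℝ => p₀ + t • k) k t := fun k t => by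
    simpa using ((hasDerivAt_id t).smul_const k).const_add p₀
  have hex : ∀ k : P, ‖k‖ < r → ∃ γ : ℝ → E, γ 0 = v ∧ ∀ t ∈ Set.Icc (0 : ℝ) 1,
      HasDerivWithinAt γ (w (p₀ + t • k) k (γ t)) (Set.Icc 0 1) t := by
    intro k hk
    refine exists_radial_solution (fun t => w (p₀ + t • k) k) (fun t ht => ?_) (hNb k hk) v
    refine ContinuousAt.continuousWithinAt ?_
    have h1 : ContinuousAt (fun t : ℝ => w (p₀ + t • k)) t :=
      ContinuousAt.comp (g := w) (f := fun t : ℝ => p₀ + t • k)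
        (hd' _ (hmem k hk t ht)).continuousAt (hcurve k t).continuousAt
    exact h1.clm_apply continuousAt_const
  choose! γ hγ0 hγ using hex
  have hγb : ∀ k : P, ‖k‖ < r → ∀ t ∈ Set.Icc (0 : ℝ) 1, ‖γ k t‖ ≤ 3 * ‖v‖ := by
    intro k hk t ht
    have := norm_le_of_norm_deriv_le (hγ k hk) le_rfl (δ := ‖v‖) (by rw [hγ0 k hk]) (fun s hs => by
      refine ((w (p₀ + s • k) k).le_of_opNorm_le (hNb k hk s hs) _).trans ?_
      linarith [norm_nonneg (γ k s)]) t ht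
    simpa using this
  -- The solution is obtained by integrating the equation along the segments that issue from `p₀`.
  -- Flatness is needed only to see that the derivatives in the other directions are also correct.
  refine ⟨fun q => γ (q - p₀) 1, ?_, ?_⟩
  · have h0 : ‖(0 : P)‖ < r := by simpa using hr
    have := norm_le_of_norm_deriv_le (f := fun t => γ 0 t - v) (f' := fun _ => 0)
      (fun t ht => by simpa using (hγ 0 h0 t ht).sub_const v) le_rfl (δ := 0)
      (by simp [hγ0 0 h0]) (fun t _ => by simp) 1 (by simp)
    simpa [sub_eq_zero] using this
  filter_upwards [Metric.ball_mem_nhds p₀ hr] with q hq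
  set k := q - p₀ with hk_def
  have hk : ‖k‖ < r := mem_ball_iff_norm.1 hq
  have hqk : p₀ + k = q := by simp [k]
  have hnear : ∀ᶠ h in 𝓝 (0 : P), ‖k + h‖ < r := by
    have : ContinuousAt (fun h : P => ‖k + h‖) 0 := by fun_prop
    exact this.eventually_lt_const (by simpa using hk)
  -- Neighbouring rays `k` and `k + h` are compared through `D t = γ (k + h) t - γ k t - t • w h (γ
  -- k t)`. Flatness turns `D'` into `w k D` plus terms quadratic in `h`, so Grönwall gives `D 1 =
  -- O(‖h‖²)`, which is more than differentiability. No smooth dependence on parameters is required.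
  have main : ∀ h : P, ‖k + h‖ < r → ‖γ (k + h) 1 - γ k 1 - w q h (γ k 1)‖ ≤
      (3 * ((1 + C) * (3 * ‖v‖) + (1 + C) * (3 * ((1 + C) * (3 * ‖v‖))))) * (‖h‖ * ‖h‖) := by
    intro h hkh
    have hC0 : 0 ≤ C := by linarith
    have hdiff : ∀ t : ℝ, p₀ + t • (k + h) - (p₀ + t • k) = t • h := fun t => by
      rw [smul_add]; abel
    have hth : ∀ t ∈ Set.Icc (0 : ℝ) 1, ‖t • h‖ ≤ ‖h‖ := fun t ht => by
      rw [norm_smul, Real.norm_of_nonneg ht.1]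
      nlinarith [norm_nonneg h, ht.2]
    have hCk : ∀ k : P, ‖k‖ < r → C * ‖k‖ ≤ 1 / 2 := fun k hk =>
      (mul_le_mul_of_nonneg_left hk.le hC0).trans hrC
    have hwd : ∀ t ∈ Set.Icc (0 : ℝ) 1, ‖w (p₀ + t • (k + h)) - w (p₀ + t • k)‖ ≤ C * ‖h‖ := by
      intro t ht
      refine (hL₁ _ (hmem k hk t ht) _ (hmem (k + h) hkh t ht)).trans ?_
      rw [hdiff]
      gcongr
      exact hth t ht
    have hN : ∀ t ∈ Set.Icc (0 : ℝ) 1,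
        ‖w (p₀ + t • (k + h)) (k + h) - w (p₀ + t • k) k‖ ≤ (1 + C) * ‖h‖ := by
      intro t ht
      have e : w (p₀ + t • (k + h)) (k + h) - w (p₀ + t • k) k =
          (w (p₀ + t • (k + h)) - w (p₀ + t • k)) (k + h) + w (p₀ + t • k) h := by
        simp
        abel
      rw [e]
      refine (norm_add_le _ _).trans ?_
      have h1 := ContinuousLinearMap.le_of_opNorm_le _ (hwd t ht) (k + h)
      have h2 := (w (p₀ + t • k)).le_of_opNorm_le (hb' _ (hmem k hk t ht)) h
      have h3 := hCk (k + h) hkh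
      nlinarith [norm_nonneg h]
    have hN2 : ∀ t ∈ Set.Icc (0 : ℝ) 1,
        ‖w (p₀ + t • (k + h)) (k + h) - w (p₀ + t • k) k - w (p₀ + t • k) h
          - t • fderiv ℝ w (p₀ + t • k) h k‖ ≤ (1 + C) * (‖h‖ * ‖h‖) := by
      intro t ht
      have e : w (p₀ + t • (k + h)) (k + h) - w (p₀ + t • k) k - w (p₀ + t • k) h
          - t • fderiv ℝ w (p₀ + t • k) h k =
          (w (p₀ + t • (k + h)) - w (p₀ + t • k) - fderiv ℝ w (p₀ + t • k) (t • h)) k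
            + (w (p₀ + t • (k + h)) - w (p₀ + t • k)) h := by
        simp
        abel
      rw [e]
      refine (norm_add_le _ _).trans ?_
      have h1 := hL₂ _ (hmem k hk t ht) _ (hmem (k + h) hkh t ht)
      rw [hdiff] at h1
      have h1' := ContinuousLinearMap.le_of_opNorm_le _ h1 k
      have h2 := ContinuousLinearMap.le_of_opNorm_le _ (hwd t ht) h
      have h3 := hCk k hk
      have h4 : C * ‖t • h‖ * ‖t • h‖ * ‖k‖ ≤ ‖h‖ * ‖h‖ := by
        have h5 : ‖t • h‖ * ‖t • h‖ ≤ ‖h‖ * ‖h‖ := by gcongr <;> exact hth t ht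
        calc C * ‖t • h‖ * ‖t • h‖ * ‖k‖ = (C * ‖k‖) * (‖t • h‖ * ‖t • h‖) := by ring
          _ ≤ 1 * (‖h‖ * ‖h‖) := by gcongr; linarith
          _ = ‖h‖ * ‖h‖ := one_mul _
      nlinarith
    have hδ : ∀ t ∈ Set.Icc (0 : ℝ) 1,
        ‖γ (k + h) t - γ k t‖ ≤ 3 * ((1 + C) * ‖h‖ * (3 * ‖v‖)) := by
      intro t ht
      have := norm_le_of_norm_deriv_le (f := fun t => γ (k + h) t - γ k t) (δ := 0)
        (fun t ht => (hγ (k + h) hkh t ht).sub (hγ k hk t ht))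
        (ε := (1 + C) * ‖h‖ * (3 * ‖v‖)) (by positivity) (by simp [hγ0 _ hk, hγ0 _ hkh])
        (fun t ht => ?_) t ht
      · simpa using this
      have e : w (p₀ + t • (k + h)) (k + h) (γ (k + h) t) - w (p₀ + t • k) k (γ k t) =
          w (p₀ + t • k) k (γ (k + h) t - γ k t)
            + (w (p₀ + t • (k + h)) (k + h) - w (p₀ + t • k) k) (γ (k + h) t) := by
        simp
      rw [e]
      refine (norm_add_le _ _).trans ?_
      have h1 := ContinuousLinearMap.le_of_opNorm_le _ (hNb k hk t ht) (γ (k + h) t - γ k t)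
      have h2 := ContinuousLinearMap.le_of_opNorm_le_of_le _ (hN t ht) (hγb _ hkh t ht)
      have h3 := norm_nonneg (γ (k + h) t - γ k t)
      linarith
    have hD := norm_le_of_norm_deriv_le (δ := 0)
      (f := fun t => γ (k + h) t - γ k t - t • w (p₀ + t • k) h (γ k t))
      (f' := fun t => w (p₀ + t • (k + h)) (k + h) (γ (k + h) t) - w (p₀ + t • k) k (γ k t)
        - (t • (w (p₀ + t • k) h (w (p₀ + t • k) k (γ k t)) + fderiv ℝ w (p₀ + t • k) k h (γ k t))
          + (1 : ℝ) • w (p₀ + t • k) h (γ k t)))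
      (ε := (1 + C) * (‖h‖ * ‖h‖) * (3 * ‖v‖)
        + (1 + C) * ‖h‖ * (3 * ((1 + C) * ‖h‖ * (3 * ‖v‖))))
      (fun t ht => ?_) (by positivity) (by simp [hγ0 _ hk, hγ0 _ hkh]) (fun t ht => ?_) 1
      (by simp)
    · simp only [one_smul, hqk] at hD
      refine hD.trans (le_of_eq ?_)
      ring
    · refine ((hγ (k + h) hkh t ht).sub (hγ k hk t ht)).sub
        (HasDerivWithinAt.smul (hasDerivWithinAt_id t _) ?_)
      have hwt : HasDerivWithinAt (fun t : ℝ => w (p₀ + t • k)) (fderiv ℝ w (p₀ + t • k) k)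
          (Set.Icc 0 1) t :=
        (HasFDerivAt.comp_hasDerivAt (l := w) t (hd' _ (hmem k hk t ht)).hasFDerivAt
          (hcurve k t)).hasDerivWithinAt
      have hwt' := hwt.clm_apply (hasDerivWithinAt_const t (Set.Icc (0 : ℝ) 1) h)
      have := hwt'.clm_apply (hγ k hk t ht)
      refine this.congr_deriv ?_
      simp
      abel
    -- The derivative of `t • w h (γ k t)` contains `∂_k w h + w h ∘ w k`; flatness replaces it by
    -- `∂_h w k + w k ∘ w h`. The first term then belongs to the Taylor expansion of `w (p₀ + t • (k
    -- + h))`, and the second is absorbed into `w k D`.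
    · have hfl := congrArg (fun A : E →L[ℝ] E => t • A (γ k t)) (hflat' _ (hmem k hk t ht) k h)
      simp only [add_apply, ContinuousLinearMap.comp_apply] at hfl
      have e : w (p₀ + t • (k + h)) (k + h) (γ (k + h) t) - w (p₀ + t • k) k (γ k t)
        - (t • (w (p₀ + t • k) h (w (p₀ + t • k) k (γ k t)) + fderiv ℝ w (p₀ + t • k) k h (γ k t))
          + (1 : ℝ) • w (p₀ + t • k) h (γ k t)) =
          w (p₀ + t • k) k (γ (k + h) t - γ k t - t • w (p₀ + t • k) h (γ k t))
          + ((w (p₀ + t • (k + h)) (k + h) - w (p₀ + t • k) k - w (p₀ + t • k) h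
            - t • fderiv ℝ w (p₀ + t • k) h k) (γ k t)
          + (w (p₀ + t • (k + h)) (k + h) - w (p₀ + t • k) k) (γ (k + h) t - γ k t)) := by
        rw [add_comm (w (p₀ + t • k) h (w (p₀ + t • k) k (γ k t))), hfl]
        simp only [map_sub, map_smul, map_add, sub_apply,
          smul_apply, add_apply, smul_add, one_smul]
        abel
      rw [e]
      refine (norm_add_le _ _).trans ?_
      have h1 := ContinuousLinearMap.le_of_opNorm_le _ (hNb k hk t ht)
        (γ (k + h) t - γ k t - t • w (p₀ + t • k) h (γ k t))
      have h2 := ContinuousLinearMap.le_of_opNorm_le_of_le _ (hN2 t ht) (hγb _ hk t ht)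
      have h3 := ContinuousLinearMap.le_of_opNorm_le_of_le _ (hN t ht) (hδ t ht)
      refine add_le_add (h1.trans ?_) ((norm_add_le _ _).trans (add_le_add h2 h3))
      linarith [norm_nonneg (γ (k + h) t - γ k t - t • w (p₀ + t • k) h (γ k t))]
  rw [hasFDerivAt_iff_isLittleO_nhds_zero]
  have hO : (fun h => γ (q + h - p₀) 1 - γ (q - p₀) 1 - (w q).flip (γ (q - p₀) 1) h) =O[𝓝 0]
      fun h : P => ‖h‖ * ‖h‖ := by
    refine Asymptotics.IsBigO.of_bound
      (3 * ((1 + C) * (3 * ‖v‖) + (1 + C) * (3 * ((1 + C) * (3 * ‖v‖))))) (hnear.mono fun h hh =>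
          ?_)
    have := main h hh
    rw [show q + h - p₀ = k + h by simp [k]; abel, Real.norm_of_nonneg (by positivity)]
    exact this
  refine hO.trans_isLittleO ?_
  have h0 : (fun h : P => ‖h‖) =o[𝓝 0] fun _ => (1 : ℝ) :=
    (Asymptotics.isLittleO_one_iff ℝ).2 (by simpa using (continuous_norm (E := P)).tendsto 0)
  have h1 : (fun h : P => ‖h‖ * ‖h‖) =o[𝓝 0] fun h : P => 1 * ‖h‖ :=
    h0.mul_isBigO (Asymptotics.isBigO_refl _ _)
  simp only [one_mul] at h1
  exact h1.of_norm_right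

/-- Solutions of a smooth linear total differential equation are smooth. -/
theorem contDiffAt_of_hasFDerivAt {p₀ : P} {w : P → P →L[ℝ] E →L[ℝ] E} {Φ : P → E}
    (hw : ∀ᶠ q in 𝓝 p₀, ContDiffAt ℝ ∞ w q)
    (hΦ : ∀ᶠ q in 𝓝 p₀, HasFDerivAt Φ ((w q).flip (Φ q)) q) :
    ∀ᶠ q in 𝓝 p₀, ContDiffAt ℝ ∞ Φ q := by
  obtain ⟨s, hs, hso, hps⟩ := eventually_nhds_iff.1 (hw.and hΦ)
  have hws : ContDiffOn ℝ ∞ w s := fun x hx => (hs x hx).1.contDiffWithinAt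
  have key : ∀ n : ℕ, ContDiffOn ℝ n Φ s := by
    intro n
    induction n with
    | zero =>
      exact contDiffOn_zero.2 fun x hx => (hs x hx).2.continuousAt.continuousWithinAt
    | succ n ih =>
      push_cast
      refine (contDiffOn_succ_iff_fderiv_of_isOpen hso).2
        ⟨fun x hx => (hs x hx).2.differentiableAt.differentiableWithinAt, by simp, ?_⟩
      -- Bootstrapping: the derivative of `Φ` is a smooth expression in `w` and `Φ` itself, so class
      -- `C^n` of `Φ` implies class `C^(n+1)`.
      have hev : ContDiffOn ℝ n (fun q => ContinuousLinearMap.apply ℝ E (Φ q)) s :=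
        ContDiffOn.clm_apply (f := fun _ => ContinuousLinearMap.apply ℝ E) contDiffOn_const ih
      have h1 : ContDiffOn ℝ n (fun q => (w q).flip (Φ q)) s :=
        hev.clm_comp (hws.of_le (by exact_mod_cast le_top))
      exact h1.congr fun x hx => (hs x hx).2.fderiv
  filter_upwards [hso.mem_nhds hps] with q hq
  exact (contDiffOn_infty.2 key).contDiffAt (hso.mem_nhds hq)

theorem contDiffAt_sum_smul {ι : Type*} [Fintype ι] {m : ι → P → ℝ} {q : P}
    (hm : ∀ i, ContDiffAt ℝ ∞ (m i) q) (c : ι → E) :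
    ContDiffAt ℝ ∞ (fun x => ∑ i, m i x • c i) q :=
  ContDiffAt.sum fun i _ => (hm i).smul contDiffAt_const

theorem fderiv_sum_smul {ι : Type*} [Fintype ι] {m : ι → P → ℝ} {q : P}
    (hm : ∀ i, ContDiffAt ℝ ∞ (m i) q) (c : ι → E) (h : P) :
    fderiv ℝ (fun x => ∑ i, m i x • c i) q h = ∑ i, fderiv ℝ (m i) q h • c i := by
  have h1 : HasFDerivAt (fun x => ∑ i, m i x • c i)
      (∑ i, (fderiv ℝ (m i) q).smulRight (c i)) q :=
    HasFDerivAt.fun_sum fun i _ => ((hm i).differentiableAt (by simp)).hasFDerivAt.smul_const _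
  rw [h1.fderiv]
  simp

/-- Local solutions of a flat equation `dΦ = ∑ m_i c_i Φ`, with functions `m_i` and constant
1-forms `c_i` with values in the operators of `E`. -/
theorem exists_solution_of_flat [CompleteSpace E] {ι : Type*} [Fintype ι] {p₀ : P} {m : ι → P → ℝ}
    {c : ι → P →L[ℝ] E →L[ℝ] E} (hm : ∀ᶠ q in 𝓝 p₀, ∀ i, ContDiffAt ℝ ∞ (m i) q)
    (hflat : ∀ᶠ q in 𝓝 p₀, ∀ (h k : P) (v : E),
      ∑ i, fderiv ℝ (m i) q h • c i k v + ∑ i, m i q • c i k (∑ j, m j q • c j h v) =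
      ∑ i, fderiv ℝ (m i) q k • c i h v + ∑ i, m i q • c i h (∑ j, m j q • c j k v)) (v : E) :
    ∃ Φ : P → E, Φ p₀ = v ∧ (∀ᶠ q in 𝓝 p₀, ContDiffAt ℝ ∞ Φ q) ∧
      ∀ᶠ q in 𝓝 p₀, ∀ h, fderiv ℝ Φ q h = ∑ i, m i q • c i h (Φ q) := by
  have hw : ∀ᶠ q in 𝓝 p₀, ContDiffAt ℝ ∞ (fun x => ∑ i, m i x • c i) q := by
    filter_upwards [hm] with q hq using contDiffAt_sum_smul (E := P →L[ℝ] E →L[ℝ] E) hq c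
  obtain ⟨Φ, h₀, hΦ⟩ := exists_hasFDerivAt_of_flat hw (by
    filter_upwards [hm, hflat] with q hq hf h k
    have hd := fderiv_sum_smul (E := P →L[ℝ] E →L[ℝ] E) hq c
    ext1 v
    rw [hd, hd]
    simpa only [add_apply, sum_apply, smul_apply, ContinuousLinearMap.comp_apply] using hf h k v) v
  refine ⟨Φ, h₀, contDiffAt_of_hasFDerivAt hw hΦ, ?_⟩
  filter_upwards [hΦ] with q hq h
  rw [hq.fderiv]
  simp [sum_apply]

end Frobenius

end

noncomputable section

namespace CubicODE

/-! ### Calculus of partial derivatives -/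

section Calculus

variable {F G : Type} [NormedAddCommGroup F] [NormedSpace ℝ F] [NormedAddCommGroup G]
  [NormedSpace ℝ G] {p : Plane} {j : Fin 2}

theorem differentiableAt_of_mem {f : Plane → F} (hf : f ∈ SmoothNear F p) :
    DifferentiableAt ℝ f p :=
  (contDiffAt_of_smoothNear ⟨f, hf⟩).differentiableAt (by simp)

theorem eventually_mem {f : Plane → F} (hf : f ∈ SmoothNear F p) :
    ∀ᶠ q in 𝓝 p, f ∈ SmoothNear F q :=
  eventually_eventually_nhds.2 hf

theorem mem_of_eventuallyEq {f g : Plane → F} (hf : f ∈ SmoothNear F p) (h : g =ᶠ[𝓝 p] f) :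
    g ∈ SmoothNear F p := by
  change ∀ᶠ q in 𝓝 p, ContDiffAt ℝ ∞ g q
  filter_upwards [show ∀ᶠ q in 𝓝 p, ContDiffAt ℝ ∞ f q from hf, h.eventuallyEq_nhds] with q h1 h2
  exact h1.congr_of_eventuallyEq h2

theorem const_mem (c : F) : (fun _ => c) ∈ SmoothNear F p :=
  Filter.Eventually.of_forall fun _ => contDiffAt_const

theorem add_mem' {f g : Plane → F} (hf : f ∈ SmoothNear F p) (hg : g ∈ SmoothNear F p) :
    (fun x => f x + g x) ∈ SmoothNear F p :=
  add_mem hf hg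

theorem sub_mem' {f g : Plane → F} (hf : f ∈ SmoothNear F p) (hg : g ∈ SmoothNear F p) :
    (fun x => f x - g x) ∈ SmoothNear F p :=
  sub_mem hf hg

theorem mul_mem' {f g : Plane → ℝ} (hf : f ∈ SmoothNear ℝ p) (hg : g ∈ SmoothNear ℝ p) :
    (fun x => f x * g x) ∈ SmoothNear ℝ p := by
  change ∀ᶠ q in 𝓝 p, ContDiffAt ℝ ∞ _ q
  filter_upwards [show ∀ᶠ q in 𝓝 p, ContDiffAt ℝ ∞ f q from hf,
    show ∀ᶠ q in 𝓝 p, ContDiffAt ℝ ∞ g q from hg] with q h1 h2 using h1.mul h2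

theorem const_mul_mem {f : Plane → ℝ} (c : ℝ) (hf : f ∈ SmoothNear ℝ p) :
    (fun x => c * f x) ∈ SmoothNear ℝ p :=
  mul_mem' (const_mem c) hf

theorem div_mem' {f g : Plane → ℝ} (hf : f ∈ SmoothNear ℝ p) (hg : g ∈ SmoothNear ℝ p)
    (h0 : g p ≠ 0) : (fun x => f x / g x) ∈ SmoothNear ℝ p := by
  change ∀ᶠ q in 𝓝 p, ContDiffAt ℝ ∞ _ q
  filter_upwards [show ∀ᶠ q in 𝓝 p, ContDiffAt ℝ ∞ f q from hf,
    show ∀ᶠ q in 𝓝 p, ContDiffAt ℝ ∞ g q from hg,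
    (differentiableAt_of_mem hg).continuousAt.eventually_ne h0] with q h1 h2 h3
  exact h1.div h2 h3

theorem pi_mem {n : ℕ} {f : Plane → Fin n → ℝ} (h : ∀ i, (fun x => f x i) ∈ SmoothNear ℝ p) :
    f ∈ SmoothNear (Fin n → ℝ) p := by
  have h' : ∀ i, ∀ᶠ q in 𝓝 p, ContDiffAt ℝ ∞ (fun x => f x i) q := h
  rw [← Filter.eventually_all] at h'
  change ∀ᶠ q in 𝓝 p, ContDiffAt ℝ ∞ f q
  filter_upwards [h'] with q hq using contDiffAt_pi.2 hq

theorem apply_mem {n : ℕ} {f : Plane → Fin n → ℝ} (hf : f ∈ SmoothNear (Fin n → ℝ) p) (i : Fin n) :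
    (fun x => f x i) ∈ SmoothNear ℝ p :=
  comp_mem hf i

theorem comp_mem' {f : Plane → Plane} {g : Plane → F} (hf : f ∈ SmoothNear Plane p)
    (hg : g ∈ SmoothNear F (f p)) : (fun x => g (f x)) ∈ SmoothNear F p := by
  change ∀ᶠ q in 𝓝 p, ContDiffAt ℝ ∞ _ q
  have hg' : ∀ᶠ q in 𝓝 (f p), ContDiffAt ℝ ∞ g q := hg
  filter_upwards [show ∀ᶠ q in 𝓝 p, ContDiffAt ℝ ∞ f q from hf,
    (differentiableAt_of_mem hf).continuousAt.eventually hg'] with q h1 h2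
  exact h2.comp q h1

theorem pd_congr {f g : Plane → F} (h : f =ᶠ[𝓝 p] g) : pd j f p = pd j g p := by
  rw [pd, pd, h.fderiv_eq]

theorem pd_congr' {f g : Plane → F} (h : f =ᶠ[𝓝 p] g) : pd j f =ᶠ[𝓝 p] pd j g := by
  filter_upwards [h.eventuallyEq_nhds] with q hq using pd_congr hq

theorem pd_const (c : F) : pd j (fun _ => c) p = 0 := by
  simp [pd]

theorem pd_add {f g : Plane → F} (hf : DifferentiableAt ℝ f p) (hg : DifferentiableAt ℝ g p) :
    pd j (fun x => f x + g x) p = pd j f p + pd j g p := by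
  simp only [pd]
  rw [fderiv_fun_add hf hg, add_apply]

theorem pd_sub {f g : Plane → F} (hf : DifferentiableAt ℝ f p) (hg : DifferentiableAt ℝ g p) :
    pd j (fun x => f x - g x) p = pd j f p - pd j g p := by
  simp only [pd]
  rw [fderiv_fun_sub hf hg, sub_apply]

theorem pd_neg {f : Plane → F} : pd j (fun x => -f x) p = -pd j f p := by
  simp only [pd]
  rw [fderiv_fun_neg, neg_apply]

theorem pd_mul {f g : Plane → ℝ} (hf : DifferentiableAt ℝ f p) (hg : DifferentiableAt ℝ g p) :
    pd j (fun x => f x * g x) p = pd j f p * g p + f p * pd j g p := by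
  simp only [pd]
  rw [fderiv_fun_mul hf hg]
  simp
  ring

theorem pd_const_mul {f : Plane → ℝ} (c : ℝ) (hf : DifferentiableAt ℝ f p) :
    pd j (fun x => c * f x) p = c * pd j f p := by
  rw [pd_mul (differentiableAt_const c) hf, pd_const, zero_mul, zero_add]

theorem pd_apply {n : ℕ} {f : Plane → Fin n → ℝ} (hf : DifferentiableAt ℝ f p) (i : Fin n) :
    pd j (fun x => f x i) p = pd j f p i := by
  simp only [pd]
  rw [fderiv_pi (fun i => differentiableAt_pi.1 hf i)]
  simp

theorem pd_apply' {n : ℕ} {f : Plane → Fin n → ℝ} (hf : f ∈ SmoothNear (Fin n → ℝ) p) (i : Fin n) :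
    pd j (fun x => f x i) =ᶠ[𝓝 p] fun x => pd j f x i := by
  filter_upwards [eventually_mem hf] with q hq using pd_apply (differentiableAt_of_mem hq) i

theorem pd_pd_apply {n : ℕ} {f : Plane → Fin n → ℝ} (hf : f ∈ SmoothNear (Fin n → ℝ) p)
    (k : Fin 2) (i : Fin n) : pd j (pd k (fun x => f x i)) p = pd j (pd k f) p i := by
  rw [pd_congr (pd_apply' hf i), pd_apply (differentiableAt_of_mem (pd_mem k hf))]

theorem fderiv_eq_pd {f : Plane → F} (q k : Plane) :
    fderiv ℝ f q k = k 0 • pd 0 f q + k 1 • pd 1 f q := by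
  have hk : k = k 0 • Pi.single 0 1 + k 1 • Pi.single 1 1 := by
    ext i; fin_cases i <;> simp
  conv_lhs => rw [hk]
  simp [pd]

theorem pd_comm {f : Plane → F} (hf : f ∈ SmoothNear F p) :
    pd 1 (pd 0 f) p = pd 0 (pd 1 f) p := by
  have h := contDiffAt_of_smoothNear ⟨f, hf⟩
  have hn : ∀ n : ℕ, (n : WithTop ℕ∞) ≤ ∞ := fun n => by exact_mod_cast le_top
  have hs : IsSymmSndFDerivAt ℝ f p := h.isSymmSndFDerivAt (by simpa using hn 2)
  have hd : DifferentiableAt ℝ (fderiv ℝ f) p :=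
    (h.fderiv_right (m := ∞) (by simp)).differentiableAt (by simp)
  have e : ∀ j k : Fin 2, pd j (pd k f) p =
      fderiv ℝ (fderiv ℝ f) p (Pi.single j 1) (Pi.single k 1) := by
    intro j k
    change fderiv ℝ (fun q => fderiv ℝ f q (Pi.single k 1)) p (Pi.single j 1) = _
    rw [fderiv_clm_apply hd (differentiableAt_const _)]
    simp
  rw [e, e]
  exact hs _ _

theorem pd_comm' {f : Plane → F} (hf : f ∈ SmoothNear F p) :
    pd 1 (pd 0 f) =ᶠ[𝓝 p] pd 0 (pd 1 f) := by
  filter_upwards [eventually_mem hf] with q hq using pd_comm hq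

/-- The chain rule. -/
theorem pd_comp {f : Plane → Plane} {g : Plane → F} (hf : DifferentiableAt ℝ f p)
    (hg : DifferentiableAt ℝ g (f p)) :
    pd j (fun x => g (f x)) p = pd j f p 0 • pd 0 g (f p) + pd j f p 1 • pd 1 g (f p) := by
  rw [← fderiv_eq_pd]
  simp only [pd]
  rw [show (fun x => g (f x)) = g ∘ f from rfl, fderiv_comp p hg hf]
  rfl

theorem hasFDerivAt_of_pd {f : Plane → F} {L : Plane →L[ℝ] F} (h : HasFDerivAt f L p) :
    pd j f p = L (Pi.single j 1) := by
  rw [pd, h.fderiv]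

/-- A map vanishes to order `k + 1` if it and its partial derivatives vanish to order `k`. -/
theorem mem_vanishing_succ {k : ℕ} (f : SmoothNear F p) :
    f ∈ vanishing F p (k + 1) ↔ f.1 p = 0 ∧
      ∀ j, (⟨pd j f.1, pd_mem j f.2⟩ : SmoothNear F p) ∈ vanishing F p k := by
  have hd : ContDiffAt ℝ ∞ (fderiv ℝ f.1) p := (fderiv_smooth f).self_of_nhds
  have h0 : iteratedFDeriv ℝ 0 f.1 p = 0 ↔ f.1 p = 0 := by
    rw [← norm_eq_zero, norm_iteratedFDeriv_zero, norm_eq_zero]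
  constructor
  · intro h
    refine ⟨h0.1 (h 0 (Nat.zero_le _)), fun j n hn => ?_⟩
    have e : pd j f.1 = (ContinuousLinearMap.apply ℝ F (Pi.single j 1 : Plane)) ∘ fderiv ℝ f.1 :=
      rfl
    change iteratedFDeriv ℝ n (pd j f.1) p = 0
    rw [e, ContinuousLinearMap.iteratedFDeriv_comp_left _ hd (by exact_mod_cast le_top),
      fderiv_vanish h hn]
    ext; simp
  · rintro ⟨h, hj⟩ n hn
    rcases n with _ | n
    · exact h0.2 h
    rw [← norm_eq_zero, ← norm_iteratedFDeriv_fderiv, norm_eq_zero]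
    -- `df = dx ⊗ ∂_x f + dy ⊗ ∂_y f`, with each summand a fixed continuous linear image of a
    -- partial derivative, so the higher derivatives of `df` are controlled by those of the partial
    -- derivatives.
    have e : fderiv ℝ f.1 = fun q =>
        ContinuousLinearMap.smulRightL ℝ Plane F (ContinuousLinearMap.proj 0) (pd 0 f.1 q) +
        ContinuousLinearMap.smulRightL ℝ Plane F (ContinuousLinearMap.proj 1) (pd 1 f.1 q) := by
      funext q
      ext k
      exact fderiv_eq_pd q k
    have hc : ∀ j : Fin 2, ContDiffAt ℝ ∞ (fun q => ContinuousLinearMap.smulRightL ℝ Plane F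
        (ContinuousLinearMap.proj j) (pd j f.1 q)) p := fun j =>
      (ContinuousLinearMap.contDiff _).contDiffAt.comp p
        (contDiffAt_of_smoothNear ⟨pd j f.1, pd_mem j f.2⟩)
    have hz : ∀ j : Fin 2, iteratedFDeriv ℝ n (fun q => ContinuousLinearMap.smulRightL ℝ Plane F
        (ContinuousLinearMap.proj j) (pd j f.1 q)) p = 0 := by
      intro j
      have := ContinuousLinearMap.iteratedFDeriv_comp_left
        (ContinuousLinearMap.smulRightL ℝ Plane F (ContinuousLinearMap.proj j))
        (contDiffAt_of_smoothNear ⟨pd j f.1, pd_mem j f.2⟩) (i := n) (by exact_mod_cast le_top)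
      have hjn : iteratedFDeriv ℝ n (pd j f.1) p = 0 := hj j n (by omega)
      dsimp only at this
      rw [hjn] at this
      refine Eq.trans this ?_
      ext; simp
    rw [e]
    have hs := iteratedFDeriv_add_apply ((hc 0).of_le (by exact_mod_cast le_top : (n : WithTop ℕ∞)
        ≤ ∞))
      ((hc 1).of_le (by exact_mod_cast le_top))
    rw [hz, hz, add_zero] at hs
    exact hs

theorem mem_vanishing_zero (f : SmoothNear F p) : f ∈ vanishing F p 0 ↔ f.1 p = 0 := by
  have h0 : iteratedFDeriv ℝ 0 f.1 p = 0 ↔ f.1 p = 0 := by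
    rw [← norm_eq_zero, norm_iteratedFDeriv_zero, norm_eq_zero]
  refine ⟨fun h => h0.1 (h 0 le_rfl), fun h n hn => ?_⟩
  obtain rfl : n = 0 := by omega
  exact h0.2 h

end Calculus

end CubicODE

end

noncomputable section

namespace CubicODE

/-! ### Linear systems for the second derivatives of a function -/

/-- The function `s` satisfies the linear system
`s_xx = A₀ s_x + B₀ s_y + C₀ s`, `s_xy = A₁ s_x + B₁ s_y + C₁ s`, `s_yy = A₂ s_x + B₂ s_y + C₂ s`
at the point `q`. -/
def SolvesAt (A B C : Fin 3 → Plane → ℝ) (s : Plane → ℝ) (q : Plane) : Prop :=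
  pd 0 (pd 0 s) q = A 0 q * pd 0 s q + B 0 q * pd 1 s q + C 0 q * s q ∧
  pd 0 (pd 1 s) q = A 1 q * pd 0 s q + B 1 q * pd 1 s q + C 1 q * s q ∧
  pd 1 (pd 1 s) q = A 2 q * pd 0 s q + B 2 q * pd 1 s q + C 2 q * s q

/-- The integrability conditions of the system `SolvesAt` hold at the point `q`. -/
structure IsFlatAt (A B C : Fin 3 → Plane → ℝ) (q : Plane) : Prop where
  c₁ : pd 1 (C 0) q + A 0 q * C 1 q + B 0 q * C 2 q = pd 0 (C 1) q + A 1 q * C 0 q + B 1 q * C 1 q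
  a₁ : pd 1 (A 0) q + A 0 q * A 1 q + B 0 q * A 2 q =
    pd 0 (A 1) q + A 1 q * A 0 q + B 1 q * A 1 q + C 1 q
  b₁ : pd 1 (B 0) q + A 0 q * B 1 q + B 0 q * B 2 q + C 0 q =
    pd 0 (B 1) q + A 1 q * B 0 q + B 1 q * B 1 q
  c₂ : pd 1 (C 1) q + A 1 q * C 1 q + B 1 q * C 2 q = pd 0 (C 2) q + A 2 q * C 0 q + B 2 q * C 1 q
  a₂ : pd 1 (A 1) q + A 1 q * A 1 q + B 1 q * A 2 q =
    pd 0 (A 2) q + A 2 q * A 0 q + B 2 q * A 1 q + C 2 q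
  b₂ : pd 1 (B 1) q + A 1 q * B 1 q + B 1 q * B 2 q + C 1 q =
    pd 0 (B 2) q + A 2 q * B 0 q + B 2 q * B 1 q

theorem pd_comb {p : Plane} {j : Fin 2} {a b c f g h : Plane → ℝ} (ha : a ∈ SmoothNear ℝ p)
    (hb : b ∈ SmoothNear ℝ p) (hc : c ∈ SmoothNear ℝ p) (hf : f ∈ SmoothNear ℝ p)
    (hg : g ∈ SmoothNear ℝ p) (hh : h ∈ SmoothNear ℝ p) :
    pd j (fun q => a q * f q + b q * g q + c q * h q) p =
      pd j a p * f p + a p * pd j f p + (pd j b p * g p + b p * pd j g p)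
        + (pd j c p * h p + c p * pd j h p) := by
  rw [pd_add (differentiableAt_of_mem (add_mem' (mul_mem' ha hf) (mul_mem' hb hg)))
    (differentiableAt_of_mem (mul_mem' hc hh)),
    pd_add (differentiableAt_of_mem (mul_mem' ha hf)) (differentiableAt_of_mem (mul_mem' hb hg)),
    pd_mul (differentiableAt_of_mem ha) (differentiableAt_of_mem hf),
    pd_mul (differentiableAt_of_mem hb) (differentiableAt_of_mem hg),
    pd_mul (differentiableAt_of_mem hc) (differentiableAt_of_mem hh)]

/-- The equalities `(s_xx)_y = (s_xy)_x` and `(s_xy)_y = (s_yy)_x`, with second derivatives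
eliminated through the system, leave linear relations between `s`, `s_x`, `s_y`. Their coefficients
are the defects of the six conditions in `IsFlatAt`. -/
theorem compatibility_of_solves {p : Plane} {A B C : Fin 3 → Plane → ℝ}
    (hA : ∀ i, A i ∈ SmoothNear ℝ p)
    (hB : ∀ i, B i ∈ SmoothNear ℝ p) (hC : ∀ i, C i ∈ SmoothNear ℝ p)
    {s : Plane → ℝ} (hs : s ∈ SmoothNear ℝ p)
    (h : ∀ᶠ q in 𝓝 p, SolvesAt A B C s q) :
    (pd 1 (C 0) p + A 0 p * C 1 p + B 0 p * C 2 p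
        - (pd 0 (C 1) p + A 1 p * C 0 p + B 1 p * C 1 p)) * s p
      + (pd 1 (A 0) p + A 0 p * A 1 p + B 0 p * A 2 p
        - (pd 0 (A 1) p + A 1 p * A 0 p + B 1 p * A 1 p + C 1 p)) * pd 0 s p
      + (pd 1 (B 0) p + A 0 p * B 1 p + B 0 p * B 2 p + C 0 p
        - (pd 0 (B 1) p + A 1 p * B 0 p + B 1 p * B 1 p)) * pd 1 s p = 0 ∧
    (pd 1 (C 1) p + A 1 p * C 1 p + B 1 p * C 2 p
        - (pd 0 (C 2) p + A 2 p * C 0 p + B 2 p * C 1 p)) * s p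
      + (pd 1 (A 1) p + A 1 p * A 1 p + B 1 p * A 2 p
        - (pd 0 (A 2) p + A 2 p * A 0 p + B 2 p * A 1 p + C 2 p)) * pd 0 s p
      + (pd 1 (B 1) p + A 1 p * B 1 p + B 1 p * B 2 p + C 1 p
        - (pd 0 (B 2) p + A 2 p * B 0 p + B 2 p * B 1 p)) * pd 1 s p = 0 := by
  have hx := pd_mem 0 hs
  have hy := pd_mem 1 hs
  obtain ⟨e₀, e₁, e₂⟩ := h.self_of_nhds
  have E := fun j i => pd_comb (j := j) (hA i) (hB i) (hC i) hx hy hs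
  have d₀ : pd 0 (pd 0 s) =ᶠ[𝓝 p] _ := h.mono fun q hq => hq.1
  have d₁ : pd 0 (pd 1 s) =ᶠ[𝓝 p] _ := h.mono fun q hq => hq.2.1
  have d₂ : pd 1 (pd 1 s) =ᶠ[𝓝 p] _ := h.mono fun q hq => hq.2.2
  have c₁ : pd 1 (pd 0 (pd 0 s)) p = pd 0 (pd 0 (pd 1 s)) p := by
    rw [pd_comm hx, pd_congr (pd_comm' hs)]
  have c₂ : pd 1 (pd 0 (pd 1 s)) p = pd 0 (pd 1 (pd 1 s)) p := pd_comm hy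
  rw [pd_congr d₀, pd_congr d₁, E, E, pd_comm hs] at c₁
  rw [pd_congr d₁, pd_congr d₂, E, E, pd_comm hs] at c₂
  rw [e₀, e₁, e₂] at c₁ c₂
  constructor
  · linear_combination c₁
  · linear_combination c₂

/-- The determinant of three vectors of `ℝ³`. -/
def det3 (u v w : Fin 3 → ℝ) : ℝ :=
  u 0 * (v 1 * w 2 - v 2 * w 1) - u 1 * (v 0 * w 2 - v 2 * w 0) + u 2 * (v 0 * w 1 - v 1 * w 0)

theorem eq_zero_of_det3_ne_zero {u v w : Fin 3 → ℝ} (h : det3 u v w ≠ 0) {x y z : ℝ}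
    (e : ∀ i, x * u i + y * v i + z * w i = 0) : x = 0 ∧ y = 0 ∧ z = 0 := by
  refine ⟨(mul_eq_zero.1 ?_).resolve_right h, (mul_eq_zero.1 ?_).resolve_right h,
    (mul_eq_zero.1 ?_).resolve_right h⟩ <;> rw [det3]
  · linear_combination e 0 * (v 1 * w 2 - v 2 * w 1) - e 1 * (v 0 * w 2 - v 2 * w 0)
      + e 2 * (v 0 * w 1 - v 1 * w 0)
  · linear_combination e 0 * (w 1 * u 2 - w 2 * u 1) - e 1 * (w 0 * u 2 - w 2 * u 0)
      + e 2 * (w 0 * u 1 - w 1 * u 0)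
  · linear_combination e 0 * (u 1 * v 2 - u 2 * v 1) - e 1 * (u 0 * v 2 - u 2 * v 0)
      + e 2 * (u 0 * v 1 - u 1 * v 0)

/-- The system `SolvesAt` is compatible if it has three independent solutions. -/
theorem isFlatAt_of_solves {p : Plane} {A B C : Fin 3 → Plane → ℝ} (hA : ∀ i, A i ∈ SmoothNear ℝ p)
    (hB : ∀ i, B i ∈ SmoothNear ℝ p) (hC : ∀ i, C i ∈ SmoothNear ℝ p)
    {s : Plane → Fin 3 → ℝ} (hs : s ∈ SmoothNear (Fin 3 → ℝ) p)
    (h : ∀ i, ∀ᶠ q in 𝓝 p, SolvesAt A B C (fun x => s x i) q)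
    (hdet : det3 (s p) (pd 0 s p) (pd 1 s p) ≠ 0) : IsFlatAt A B C p := by
  have key := fun i => compatibility_of_solves hA hB hC (apply_mem hs i) (h i)
  simp only [pd_apply (differentiableAt_of_mem hs)] at key
  obtain ⟨k₁, k₂, k₃⟩ := eq_zero_of_det3_ne_zero hdet fun i => (key i).1
  obtain ⟨k₄, k₅, k₆⟩ := eq_zero_of_det3_ne_zero hdet fun i => (key i).2
  exact ⟨sub_eq_zero.1 k₁, sub_eq_zero.1 k₂, sub_eq_zero.1 k₃, sub_eq_zero.1 k₄,
    sub_eq_zero.1 k₅, sub_eq_zero.1 k₆⟩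

/-- The matrices of the first order system that `(s, s_x, s_y)` satisfies. -/
def sysMatrix (A B C : Fin 3 → Plane → ℝ) : Fin 2 → Fin 3 → Fin 3 → Plane → ℝ :=
  ![![![fun _ => 0, fun _ => 1, fun _ => 0], ![C 0, A 0, B 0], ![C 1, A 1, B 1]],
    ![![fun _ => 0, fun _ => 0, fun _ => 1], ![C 1, A 1, B 1], ![C 2, A 2, B 2]]]

/-- The elementary operators of `ℝ³`. -/
def elemOp (i k : Fin 3) : (Fin 3 → ℝ) →L[ℝ] (Fin 3 → ℝ) :=
  (ContinuousLinearMap.proj k).smulRight (Pi.single i 1)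

/-- The elementary 1-forms on the plane with values in the operators of `ℝ³`. -/
def elemForm (l : Fin 2 × Fin 3 × Fin 3) : Plane →L[ℝ] (Fin 3 → ℝ) →L[ℝ] (Fin 3 → ℝ) :=
  (ContinuousLinearMap.proj l.1 : Plane →L[ℝ] ℝ).smulRight (elemOp l.2.1 l.2.2)

theorem elemForm_apply (l : Fin 2 × Fin 3 × Fin 3) (h : Plane) (v : Fin 3 → ℝ) (i : Fin 3) :
    elemForm l h v i = if i = l.2.1 then h l.1 * v l.2.2 else 0 := by
  simp [elemForm, elemOp, Pi.single_apply]

theorem sum_elemForm_apply (m : Fin 2 → Fin 3 → Fin 3 → ℝ) (h : Plane) (v : Fin 3 → ℝ)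
    (i : Fin 3) : (∑ l : Fin 2 × Fin 3 × Fin 3, m l.1 l.2.1 l.2.2 • elemForm l h v) i =
      ∑ j, ∑ k, m j i k * h j * v k := by
  simp only [Fintype.sum_prod_type, Finset.sum_apply, Pi.smul_apply, smul_eq_mul, elemForm_apply]
  refine Finset.sum_congr rfl fun j _ => ?_
  fin_cases i <;> simp [Fin.sum_univ_three] <;> ring

/-- The unknown of the first order system is `Φ = (s, s_x, s_y)`. The first rows of `sysMatrix` say
that the last two components are the derivatives of the first one, and the remaining rows are then
the second order system for it. -/
theorem exists_solvesAt {p : Plane} {A B C : Fin 3 → Plane → ℝ} (hA : ∀ i, A i ∈ SmoothNear ℝ p)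
    (hB : ∀ i, B i ∈ SmoothNear ℝ p) (hC : ∀ i, C i ∈ SmoothNear ℝ p)
    (hflat : ∀ᶠ q in 𝓝 p, IsFlatAt A B C q) (v : Fin 3 → ℝ) :
    ∃ s ∈ SmoothNear ℝ p, (∀ᶠ q in 𝓝 p, SolvesAt A B C s q) ∧
      s p = v 0 ∧ pd 0 s p = v 1 ∧ pd 1 s p = v 2 := by
  set m := sysMatrix A B C with hm_def
  have hm : ∀ j i k, m j i k ∈ SmoothNear ℝ p := by
    intro j i k
    fin_cases j <;> fin_cases i <;> fin_cases k <;>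
      first | exact const_mem _ | exact hA _ | exact hB _ | exact hC _
  have hmq : ∀ᶠ q in 𝓝 p, ∀ l : Fin 2 × Fin 3 × Fin 3, ContDiffAt ℝ ∞ (m l.1 l.2.1 l.2.2) q := by
    simp only [Filter.eventually_all]
    exact fun l => hm _ _ _
  obtain ⟨Φ, hΦp, hΦs, hΦ⟩ := exists_solution_of_flat (c := elemForm) hmq (by
    filter_upwards [hflat] with q hf h k v
    -- Zero curvature of the connection matrices, entry by entry. The row `i = 0` holds identically,
    -- and the rows `i = 1, 2` are the six conditions of `IsFlatAt`.
    have e : ∀ i l, pd 1 (m 0 i l) q + ∑ r, m 0 i r q * m 1 r l q =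
        pd 0 (m 1 i l) q + ∑ r, m 1 i r q * m 0 r l q := by
      obtain ⟨h₁, h₂, h₃, h₄, h₅, h₆⟩ := hf
      intro i l
      fin_cases i <;> fin_cases l <;> simp [hm_def, sysMatrix, Fin.sum_univ_three, pd_const] <;>
        linarith
    have E := fun h => sum_elemForm_apply fun j i k => fderiv ℝ (m j i k) q h
    have E' := sum_elemForm_apply fun j i k => m j i k q
    funext i
    simp only [Pi.add_apply, E, E']
    simp only [fderiv_eq_pd, Fin.sum_univ_two, Fin.sum_univ_three, smul_eq_mul]
    simp only [Fin.sum_univ_three] at e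
    have e0 := e i 0
    have e1 := e i 1
    have e2 := e i 2
    -- Curvature is alternating in `h` and `k`, so on the plane a single component, with factor `h 1
    -- * k 0 - h 0 * k 1`, accounts for the whole identity.
    linear_combination (h 1 * k 0 - h 0 * k 1) * (v 0 * e0 + v 1 * e1 + v 2 * e2)) v
  have hΦs : Φ ∈ SmoothNear (Fin 3 → ℝ) p := hΦs
  have hpd : ∀ᶠ q in 𝓝 p, ∀ j i, pd j (fun x => Φ x i) q = ∑ k, m j i k q * Φ q k := by
    filter_upwards [hΦ, eventually_mem hΦs] with q hq hs j i
    rw [pd_apply (differentiableAt_of_mem hs), pd, hq]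
    refine (sum_elemForm_apply (fun j i k => m j i k q) _ _ _).trans ?_
    fin_cases j <;> simp
  have h01 : pd 0 (fun x => Φ x 0) =ᶠ[𝓝 p] fun x => Φ x 1 := by
    filter_upwards [hpd] with q hq
    rw [hq]
    simp [hm_def, sysMatrix, Fin.sum_univ_three]
  have h02 : pd 1 (fun x => Φ x 0) =ᶠ[𝓝 p] fun x => Φ x 2 := by
    filter_upwards [hpd] with q hq
    rw [hq]
    simp [hm_def, sysMatrix, Fin.sum_univ_three]
  refine ⟨fun x => Φ x 0, apply_mem hΦs 0, ?_, congrFun hΦp 0, ?_, ?_⟩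
  · filter_upwards [hpd, h01.eventuallyEq_nhds, h02.eventuallyEq_nhds] with q hq h1 h2
    refine ⟨?_, ?_, ?_⟩
    · rw [pd_congr h1, h1.self_of_nhds, h2.self_of_nhds, hq]
      simp [hm_def, sysMatrix, Fin.sum_univ_three]
      ring
    · rw [pd_congr h2, h1.self_of_nhds, h2.self_of_nhds, hq]
      simp [hm_def, sysMatrix, Fin.sum_univ_three]
      ring
    · rw [pd_congr h2, h1.self_of_nhds, h2.self_of_nhds, hq]
      simp [hm_def, sysMatrix, Fin.sum_univ_three]
      ring
  · exact h01.self_of_nhds.trans (congrFun hΦp 1)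
  · exact h02.self_of_nhds.trans (congrFun hΦp 2)

end CubicODE

end

noncomputable section

namespace CubicODE

/-! ### The linear system associated with an equation -/

/-- The coefficients of `s_x` in the system of the equation `a`. -/
def coeffA (a : Plane → Fibre) : Fin 3 → Plane → ℝ :=
  ![fun q => (1 / 3) * a q 1, fun q => (1 / 3) * a q 2, fun q => a q 3]

/-- The coefficients of `s_y` in the system of the equation `a`. -/
def coeffB (a : Plane → Fibre) : Fin 3 → Plane → ℝ :=
  ![fun q => (-1) * a q 0, fun q => (-1 / 3) * a q 1, fun q => (-1 / 3) * a q 2]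

/-- The coefficients of `s` that the integrability conditions impose on the system of the
equation `a`. -/
def coeffC (a : Plane → Fibre) : Fin 3 → Plane → ℝ :=
  ![fun q => pd 1 a q 0 - (1 / 3) * pd 0 a q 1
      + ((2 / 9) * (a q 1 * a q 1) - (2 / 3) * (a q 0 * a q 2)),
    fun q => (1 / 3) * pd 1 a q 1 - (1 / 3) * pd 0 a q 2
      + ((1 / 9) * (a q 1 * a q 2) - a q 0 * a q 3),
    fun q => (1 / 3) * pd 1 a q 2 - pd 0 a q 3
      + ((2 / 9) * (a q 2 * a q 2) - (2 / 3) * (a q 1 * a q 3))]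

section

variable {p : Plane} {a : Plane → Fibre}

theorem coeffA_mem (ha : a ∈ SmoothNear Fibre p) (i : Fin 3) : coeffA a i ∈ SmoothNear ℝ p := by
  have h := apply_mem ha
  fin_cases i
  · exact const_mul_mem _ (h 1)
  · exact const_mul_mem _ (h 2)
  · exact h 3

theorem coeffB_mem (ha : a ∈ SmoothNear Fibre p) (i : Fin 3) : coeffB a i ∈ SmoothNear ℝ p := by
  have h := apply_mem ha
  fin_cases i
  · exact const_mul_mem _ (h 0)
  · exact const_mul_mem _ (h 1)
  · exact const_mul_mem _ (h 2)

theorem coeffC_mem (ha : a ∈ SmoothNear Fibre p) (i : Fin 3) : coeffC a i ∈ SmoothNear ℝ p := by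
  have h := apply_mem ha
  have h' := fun j => apply_mem (pd_mem j ha)
  fin_cases i
  · exact add_mem' (sub_mem' (h' 1 0) (const_mul_mem _ (h' 0 1)))
      (sub_mem' (const_mul_mem _ (mul_mem' (h 1) (h 1))) (const_mul_mem _ (mul_mem' (h 0) (h 2))))
  · exact add_mem' (sub_mem' (const_mul_mem _ (h' 1 1)) (const_mul_mem _ (h' 0 2)))
      (sub_mem' (const_mul_mem _ (mul_mem' (h 1) (h 2))) (mul_mem' (h 0) (h 3)))
  · exact add_mem' (sub_mem' (const_mul_mem _ (h' 1 2)) (h' 0 3))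
      (sub_mem' (const_mul_mem _ (mul_mem' (h 2) (h 2))) (const_mul_mem _ (mul_mem' (h 1) (h 3))))

theorem pd_coeffA (ha : a ∈ SmoothNear Fibre p) (j : Fin 2) (i : Fin 3) :
    pd j (coeffA a i) p = ![(1 / 3) * pd j a p 1, (1 / 3) * pd j a p 2, pd j a p 3] i := by
  have h := fun i => differentiableAt_of_mem (apply_mem ha i)
  have e := fun i => pd_apply (j := j) (differentiableAt_of_mem ha) i
  fin_cases i
  · exact (pd_const_mul _ (h 1)).trans (by rw [e]; rfl)
  · exact (pd_const_mul _ (h 2)).trans (by rw [e]; rfl)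
  · exact e 3

theorem pd_coeffB (ha : a ∈ SmoothNear Fibre p) (j : Fin 2) (i : Fin 3) :
    pd j (coeffB a i) p =
      ![(-1) * pd j a p 0, (-1 / 3) * pd j a p 1, (-1 / 3) * pd j a p 2] i := by
  have h := fun i => differentiableAt_of_mem (apply_mem ha i)
  have e := fun i => pd_apply (j := j) (differentiableAt_of_mem ha) i
  fin_cases i
  · exact (pd_const_mul _ (h 0)).trans (by rw [e]; rfl)
  · exact (pd_const_mul _ (h 1)).trans (by rw [e]; rfl)
  · exact (pd_const_mul _ (h 2)).trans (by rw [e]; rfl)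

theorem pd_coeffC (ha : a ∈ SmoothNear Fibre p) (j : Fin 2) (i : Fin 3) :
    pd j (coeffC a i) p =
      ![pd j (pd 1 a) p 0 - (1 / 3) * pd j (pd 0 a) p 1
        + ((2 / 9) * (pd j a p 1 * a p 1 + a p 1 * pd j a p 1)
          - (2 / 3) * (pd j a p 0 * a p 2 + a p 0 * pd j a p 2)),
      (1 / 3) * pd j (pd 1 a) p 1 - (1 / 3) * pd j (pd 0 a) p 2
        + ((1 / 9) * (pd j a p 1 * a p 2 + a p 1 * pd j a p 2)
          - (pd j a p 0 * a p 3 + a p 0 * pd j a p 3)),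
      (1 / 3) * pd j (pd 1 a) p 2 - pd j (pd 0 a) p 3
        + ((2 / 9) * (pd j a p 2 * a p 2 + a p 2 * pd j a p 2)
          - (2 / 3) * (pd j a p 1 * a p 3 + a p 1 * pd j a p 3))] i := by
  have h := fun i => differentiableAt_of_mem (apply_mem ha i)
  have h' := fun k i => differentiableAt_of_mem (apply_mem (pd_mem k ha) i)
  have e := fun i => pd_apply (j := j) (differentiableAt_of_mem ha) i
  have e' := fun k i => pd_apply (j := j) (differentiableAt_of_mem (pd_mem k ha)) i
  have e1 : ∀ {f : Plane → ℝ} (c : ℝ), DifferentiableAt ℝ f p →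
      DifferentiableAt ℝ (fun x => c * f x) p := fun c hf => hf.const_mul c
  have m : ∀ i k, DifferentiableAt ℝ (fun x => a x i * a x k) p := fun i k => (h i).mul (h k)
  fin_cases i <;> simp only [coeffC, Fin.zero_eta, Fin.mk_one, Fin.reduceFinMk, Matrix.cons_val]
  · rw [pd_add (by fun_prop) (by fun_prop), pd_sub (by fun_prop) (by fun_prop),
      pd_sub (by fun_prop) (by fun_prop), pd_const_mul _ (h' 0 1), pd_const_mul _ (m 1 1),
      pd_const_mul _ (m 0 2), pd_mul (h 1) (h 1), pd_mul (h 0) (h 2), e', e', e, e, e]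
  · rw [pd_add (by fun_prop) (by fun_prop), pd_sub (by fun_prop) (by fun_prop),
      pd_sub (by fun_prop) (by fun_prop), pd_const_mul _ (h' 0 2), pd_const_mul _ (h' 1 1),
      pd_const_mul _ (m 1 2), pd_mul (h 1) (h 2), pd_mul (h 0) (h 3), e', e', e, e, e, e]
  · rw [pd_add (by fun_prop) (by fun_prop), pd_sub (by fun_prop) (by fun_prop),
      pd_sub (by fun_prop) (by fun_prop), pd_const_mul _ (h' 1 2), pd_const_mul _ (m 2 2),
      pd_const_mul _ (m 1 3), pd_mul (h 2) (h 2), pd_mul (h 1) (h 3), e', e', e, e, e]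

/-- The integrability conditions of the system of the equation `a` are `F¹ = F² = 0`. -/
theorem isFlatAt_iff (ha : a ∈ SmoothNear Fibre p) :
    IsFlatAt (coeffA a) (coeffB a) (coeffC a) p ↔ F1 a p = 0 ∧ F2 a p = 0 := by
  have c := pd_comm ha
  constructor
  -- Only `c₁` and `c₂` carry information: they say `F¹/3 = 0` and `F²/3 = 0`. The other four
  -- conditions are identities by the choice of `coeffC`.
  · rintro ⟨h₁, -, -, h₂, -, -⟩
    simp only [pd_coeffC ha, c] at h₁ h₂
    simp only [coeffA, coeffB, coeffC, Matrix.cons_val] at h₁ h₂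
    rw [F1, F2]
    constructor
    · linear_combination 3 * h₁
    · linear_combination 3 * h₂
  · rintro ⟨h₁, h₂⟩
    rw [F1] at h₁
    rw [F2] at h₂
    constructor <;> simp only [pd_coeffA ha, pd_coeffB ha, pd_coeffC ha, c] <;>
      simp only [coeffA, coeffB, coeffC, Matrix.cons_val]
    · linear_combination h₁ / 3
    · ring
    · ring
    · linear_combination h₂ / 3
    · ring
    · ring

/-- The integrability conditions determine the coefficients of `s`. -/
theorem F_eq_zero_of_isFlatAt (ha : a ∈ SmoothNear Fibre p) {C : Fin 3 → Plane → ℝ}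
    (h : ∀ᶠ q in 𝓝 p, IsFlatAt (coeffA a) (coeffB a) C q) : F1 a p = 0 ∧ F2 a p = 0 := by
  -- The conditions `b₁`, `a₁`, `a₂` contain `C 0`, `C 1`, `C 2` undifferentiated and can be solved
  -- for them. The equality near `p`, not only at `p`, is what makes the derivatives of `C` agree as
  -- well.
  have hC : ∀ i, C i =ᶠ[𝓝 p] coeffC a i := by
    intro i
    filter_upwards [h, eventually_mem ha] with q ⟨_, h₁, h₂, _, h₃, _⟩ haq
    simp only [pd_coeffA haq, pd_coeffB haq] at h₁ h₂ h₃
    simp only [coeffA, coeffB, Matrix.cons_val] at h₁ h₂ h₃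
    fin_cases i <;> simp only [coeffC, Fin.zero_eta, Fin.mk_one, Fin.reduceFinMk, Matrix.cons_val]
    · linear_combination h₂
    · linear_combination -h₁
    · linear_combination -h₃
  refine (isFlatAt_iff ha).1 ?_
  obtain ⟨h₁, h₂, h₃, h₄, h₅, h₆⟩ := h.self_of_nhds
  have e := fun i => (hC i).self_of_nhds
  have e' := fun j i => pd_congr (j := j) (hC i)
  constructor <;> simp only [← e, ← e'] <;> assumption

end

end CubicODE

end

noncomputable section

namespace CubicODE

/-! ### Derivatives along curves -/

section Curves

variable {F : Type} [NormedAddCommGroup F] [NormedSpace ℝ F]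

/-- The first derivative of `s` along a curve with `y' = z`. -/
def d1 (s : Plane → F) (q : Plane) (z : ℝ) : F := pd 0 s q + z • pd 1 s q

/-- The second derivative of `s` along a curve with `y' = z`, `y'' = w`. -/
def d2 (s : Plane → F) (q : Plane) (z w : ℝ) : F :=
  pd 0 (pd 0 s) q + (2 * z) • pd 0 (pd 1 s) q + z ^ 2 • pd 1 (pd 1 s) q + w • pd 1 s q

variable {p : Plane} {z w : ℝ}

theorem d1_apply {n : ℕ} {s : Plane → Fin n → ℝ} (hs : s ∈ SmoothNear (Fin n → ℝ) p) (i : Fin n) :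
    d1 s p z i = d1 (fun x => s x i) p z := by
  simp [d1, pd_apply (differentiableAt_of_mem hs)]

theorem d2_apply {n : ℕ} {s : Plane → Fin n → ℝ} (hs : s ∈ SmoothNear (Fin n → ℝ) p) (i : Fin n) :
    d2 s p z w i = d2 (fun x => s x i) p z w := by
  simp [d2, pd_apply (differentiableAt_of_mem hs), pd_pd_apply hs]

theorem total1_eq (f : Plane → Plane) (i : Fin 2) : total1 f i p z = d1 f p z i := by
  simp [total1, d1, mul_comm]

theorem total2_eq (f : Plane → Plane) (i : Fin 2) : total2 f i p z w = d2 f p z w i := by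
  simp [total2, d2]
  ring

theorem d1_congr {s t : Plane → F} (h : s =ᶠ[𝓝 p] t) : d1 s p z = d1 t p z := by
  simp [d1, pd_congr h]

theorem d2_congr {s t : Plane → F} (h : s =ᶠ[𝓝 p] t) : d2 s p z w = d2 t p z w := by
  simp [d2, pd_congr h, pd_congr (pd_congr' h)]

theorem d1_const (c : F) : d1 (fun _ => c) p z = 0 := by
  simp [d1, pd_const]

theorem d2_const (c : F) : d2 (fun _ => c) p z w = 0 := by
  have : ∀ j, pd j (fun _ : Plane => c) = fun _ => 0 := fun j => funext fun q => pd_const c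
  simp [d2, pd_const, this]

theorem pd_mul' {f g : Plane → ℝ} (hf : f ∈ SmoothNear ℝ p) (hg : g ∈ SmoothNear ℝ p) (j : Fin 2) :
    pd j (fun x => f x * g x) =ᶠ[𝓝 p] fun x => pd j f x * g x + f x * pd j g x := by
  filter_upwards [eventually_mem hf, eventually_mem hg] with q h1 h2
  exact pd_mul (differentiableAt_of_mem h1) (differentiableAt_of_mem h2)

theorem pd_pd_mul {f g : Plane → ℝ} (hf : f ∈ SmoothNear ℝ p) (hg : g ∈ SmoothNear ℝ p)
    (j k : Fin 2) : pd k (pd j (fun x => f x * g x)) p =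
      pd k (pd j f) p * g p + pd j f p * pd k g p + (pd k f p * pd j g p + f p * pd k (pd j g) p)
          := by
  have hf' := differentiableAt_of_mem hf
  have hg' := differentiableAt_of_mem hg
  have hfj := differentiableAt_of_mem (pd_mem j hf)
  have hgj := differentiableAt_of_mem (pd_mem j hg)
  rw [pd_congr (pd_mul' hf hg j), pd_add (differentiableAt_of_mem (mul_mem' (pd_mem j hf) hg))
    (differentiableAt_of_mem (mul_mem' hf (pd_mem j hg))), pd_mul hfj hg', pd_mul hf' hgj]

theorem d1_mul {f g : Plane → ℝ} (hf : f ∈ SmoothNear ℝ p) (hg : g ∈ SmoothNear ℝ p) :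
    d1 (fun x => f x * g x) p z = d1 f p z * g p + f p * d1 g p z := by
  simp only [d1, pd_mul (differentiableAt_of_mem hf) (differentiableAt_of_mem hg), smul_eq_mul]
  ring

theorem d2_mul {f g : Plane → ℝ} (hf : f ∈ SmoothNear ℝ p) (hg : g ∈ SmoothNear ℝ p) :
    d2 (fun x => f x * g x) p z w =
      d2 f p z w * g p + 2 * d1 f p z * d1 g p z + f p * d2 g p z w := by
  simp only [d1, d2, pd_pd_mul hf hg,
    pd_mul (differentiableAt_of_mem hf) (differentiableAt_of_mem hg), smul_eq_mul]
  ring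

theorem pd_pd_comp {f : Plane → Plane} {g : Plane → ℝ} (hf : f ∈ SmoothNear Plane p)
    (hg : g ∈ SmoothNear ℝ (f p)) (j k : Fin 2) :
    pd k (pd j (fun x => g (f x))) p =
      pd k (pd j f) p 0 * pd 0 g (f p) + pd j f p 0 *
        (pd k f p 0 * pd 0 (pd 0 g) (f p) + pd k f p 1 * pd 0 (pd 1 g) (f p)) +
      (pd k (pd j f) p 1 * pd 1 g (f p) + pd j f p 1 *
        (pd k f p 0 * pd 0 (pd 1 g) (f p) + pd k f p 1 * pd 1 (pd 1 g) (f p))) := by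
  have hc := (differentiableAt_of_mem hf).continuousAt
  have e : pd j (fun x => g (f x)) =ᶠ[𝓝 p]
      fun x => pd j f x 0 * pd 0 g (f x) + pd j f x 1 * pd 1 g (f x) := by
    filter_upwards [eventually_mem hf, hc.eventually (eventually_mem hg)] with q h1 h2
    exact pd_comp (differentiableAt_of_mem h1) (differentiableAt_of_mem h2)
  have hfj := fun i => apply_mem (pd_mem j hf) i
  have hgi := fun i => pd_mem i hg
  have hgf := fun i => comp_mem' hf (hgi i)
  rw [pd_congr e, pd_add (differentiableAt_of_mem (mul_mem' (hfj 0) (hgf 0)))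
    (differentiableAt_of_mem (mul_mem' (hfj 1) (hgf 1))),
    pd_mul (differentiableAt_of_mem (hfj 0)) (differentiableAt_of_mem (hgf 0)),
    pd_mul (differentiableAt_of_mem (hfj 1)) (differentiableAt_of_mem (hgf 1)),
    pd_apply (differentiableAt_of_mem (pd_mem j hf)),
    pd_apply (differentiableAt_of_mem (pd_mem j hf)),
    pd_comp (differentiableAt_of_mem hf) (differentiableAt_of_mem (hgi 0)),
    pd_comp (differentiableAt_of_mem hf) (differentiableAt_of_mem (hgi 1)), pd_comm hg]
  simp only [smul_eq_mul]

theorem d1_comp {f : Plane → Plane} {g : Plane → ℝ} (hf : f ∈ SmoothNear Plane p)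
    (hg : g ∈ SmoothNear ℝ (f p)) : d1 (fun x => g (f x)) p z =
      d1 f p z 0 * pd 0 g (f p) + d1 f p z 1 * pd 1 g (f p) := by
  simp only [d1, pd_comp (differentiableAt_of_mem hf) (differentiableAt_of_mem hg), smul_eq_mul,
    Pi.add_apply, Pi.smul_apply]
  ring

theorem d2_comp {f : Plane → Plane} {g : Plane → ℝ} (hf : f ∈ SmoothNear Plane p)
    (hg : g ∈ SmoothNear ℝ (f p)) : d2 (fun x => g (f x)) p z w =
      d1 f p z 0 ^ 2 * pd 0 (pd 0 g) (f p) + 2 * d1 f p z 0 * d1 f p z 1 * pd 0 (pd 1 g) (f p)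
        + d1 f p z 1 ^ 2 * pd 1 (pd 1 g) (f p)
        + d2 f p z w 0 * pd 0 g (f p) + d2 f p z w 1 * pd 1 g (f p) := by
  simp only [d1, d2, pd_pd_comp hf hg,
    pd_comp (differentiableAt_of_mem hf) (differentiableAt_of_mem hg), smul_eq_mul,
    Pi.add_apply, Pi.smul_apply]
  ring

/-! ### Wronskians of three functions along curves. -/

/-- The Wronskian of three functions along a curve. -/
def wron (s : Plane → Fin 3 → ℝ) (q : Plane) (z w : ℝ) : ℝ := det3 (s q) (d1 s q z) (d2 s q z w)

theorem wron_congr {s t : Plane → Fin 3 → ℝ} (h : s =ᶠ[𝓝 p] t) : wron s p z w = wron t p z w := by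
  rw [wron, wron, d1_congr h, d2_congr h, h.self_of_nhds]

/-- Linear dependence of three functions along a curve is thus a second order equation that is
affine in `w` and cubic in `z`: the kind of equation under study, provided the coefficient of `w` is
nonzero. -/
theorem wron_eq (s : Plane → Fin 3 → ℝ) :
    wron s p z w = det3 (s p) (pd 0 s p) (pd 1 s p) * w
      + (det3 (s p) (pd 0 s p) (pd 0 (pd 0 s) p)
      + (det3 (s p) (pd 1 s p) (pd 0 (pd 0 s) p)
        + 2 * det3 (s p) (pd 0 s p) (pd 0 (pd 1 s) p)) * z
      + (det3 (s p) (pd 0 s p) (pd 1 (pd 1 s) p)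
        + 2 * det3 (s p) (pd 1 s p) (pd 0 (pd 1 s) p)) * z ^ 2
      + det3 (s p) (pd 1 s p) (pd 1 (pd 1 s) p) * z ^ 3) := by
  simp only [wron, det3, d1, d2, Pi.add_apply, Pi.smul_apply, smul_eq_mul]
  ring

/-- By the Leibniz rule each row is multiplied by `l` and changed by multiples of the rows above it,
which do not affect the determinant. -/
theorem wron_mul {l : Plane → ℝ} {t : Plane → Fin 3 → ℝ} (hl : l ∈ SmoothNear ℝ p)
    (ht : t ∈ SmoothNear (Fin 3 → ℝ) p) :
    wron (fun q i => l q * t q i) p z w = l p ^ 3 * wron t p z w := by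
  have ht' := apply_mem ht
  have hs : (fun q i => l q * t q i) ∈ SmoothNear (Fin 3 → ℝ) p :=
    pi_mem fun i => mul_mem' hl (ht' i)
  simp only [wron, det3, d1_apply hs, d2_apply hs, d1_mul hl (ht' _), d2_mul hl (ht' _),
    d1_apply ht, d2_apply ht]
  ring

/-- The Wronskian of `1` and the components of `f`. -/
theorem wron_affine {f : Plane → Plane} (hf : f ∈ SmoothNear Plane p) :
    wron (fun q => ![1, f q 0, f q 1]) p z w =
      total1 f 0 p z * total2 f 1 p z w - total1 f 1 p z * total2 f 0 p z w := by
  have hs : (fun q => ![1, f q 0, f q 1]) ∈ SmoothNear (Fin 3 → ℝ) p := by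
    refine pi_mem fun i => ?_
    fin_cases i
    · exact const_mem 1
    · exact apply_mem hf 0
    · exact apply_mem hf 1
  simp only [wron, det3, d1_apply hs, d2_apply hs, total1_eq, total2_eq, d1_apply hf, d2_apply hf]
  simp [d1_const, d2_const]

/-- The Wronskian of solutions of the system of the equation `b`, composed with `f`. -/
theorem wron_comp {f : Plane → Plane} (hf : f ∈ SmoothNear Plane p) {b : Plane → Fibre}
    {C : Fin 3 → Plane → ℝ} {t : Plane → Fin 3 → ℝ} (ht : t ∈ SmoothNear (Fin 3 → ℝ) (f p))
    (h : ∀ i, SolvesAt (coeffA b) (coeffB b) C (fun x => t x i) (f p)) :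
    wron (fun q => t (f q)) p z w = det3 (t (f p)) (pd 0 t (f p)) (pd 1 t (f p)) *
      (total1 f 0 p z * total2 f 1 p z w - total1 f 1 p z * total2 f 0 p z w
      - (b (f p) 3 * total1 f 1 p z ^ 3 + b (f p) 2 * total1 f 1 p z ^ 2 * total1 f 0 p z
        + b (f p) 1 * total1 f 1 p z * total1 f 0 p z ^ 2 + b (f p) 0 * total1 f 0 p z ^ 3)) := by
  have hs : (fun q => t (f q)) ∈ SmoothNear (Fin 3 → ℝ) p := comp_mem' hf ht
  have ht' := apply_mem ht
  have e0 := fun i => (h i).1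
  have e1 := fun i => (h i).2.1
  have e2 := fun i => (h i).2.2
  simp only [wron, d1_apply hs, d2_apply hs, d1_comp hf (ht' _), d2_comp hf (ht' _), total1_eq,
    total2_eq, e0, e1, e2, det3]
  simp only [coeffA, coeffB, Matrix.cons_val, pd_apply (differentiableAt_of_mem ht)]
  ring

/-- Modulo `s` and `d1 s = s_x + z s_y`, the system reduces `d2 s` to a multiple of `s_y`. The
coefficients `coeffA`, `coeffB` are such that this multiple is exactly `w - cubic (a p) z`. -/
theorem wron_of_solves {a : Plane → Fibre} {C : Fin 3 → Plane → ℝ} {s : Plane → Fin 3 → ℝ}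
    (hs : s ∈ SmoothNear (Fin 3 → ℝ) p)
    (h : ∀ i, SolvesAt (coeffA a) (coeffB a) C (fun x => s x i) p) :
    wron s p z w = det3 (s p) (pd 0 s p) (pd 1 s p) * (w - cubic (a p) z) := by
  have hs' := apply_mem hs
  have e0 := fun i => (h i).1
  have e1 := fun i => (h i).2.1
  have e2 := fun i => (h i).2.2
  simp only [wron, d1_apply hs, d2_apply hs, det3]
  simp only [d1, d2, e0, e1, e2, coeffA, coeffB, Matrix.cons_val, smul_eq_mul, cubic,
    pd_apply (differentiableAt_of_mem hs)]
  ring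

end Curves

/-! ### Equations with `F¹ = F² = 0` -/

/-- The Jacobian determinant of `f`. -/
def jac (f : Plane → Plane) (q : Plane) : ℝ := pd 0 f q 0 * pd 1 f q 1 - pd 1 f q 0 * pd 0 f q 1

theorem exists_equiv_of_jac_ne_zero {f : Plane → Plane} {q : Plane} (hf : DifferentiableAt ℝ f q)
    (h : jac f q ≠ 0) : ∃ f' : Plane ≃L[ℝ] Plane, HasFDerivAt f (f' : Plane →L[ℝ] Plane) q := by
  have hdet : (fderiv ℝ f q).det ≠ 0 := by
    have : (fderiv ℝ f q).det = jac f q := by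
      rw [ContinuousLinearMap.det, ← LinearMap.det_toMatrix', Matrix.det_fin_two]
      simp [LinearMap.toMatrix'_apply, jac, pd]
    rwa [this]
  exact ⟨(fderiv ℝ f q).toContinuousLinearEquivOfDetNeZero hdet, hf.hasFDerivAt⟩

/-- A smooth map with nonzero Jacobian restricts to a point transformation. -/
theorem exists_pointTransformation {f : Plane → Plane} {p : Plane} (hf : f ∈ SmoothNear Plane p)
    (hj : jac f p ≠ 0) {V : Set Plane} (hV : V ∈ 𝓝 p) :
    ∃ e : OpenPartialHomeomorph Plane Plane, IsPointTransformation e ∧ p ∈ e.source ∧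
      e.source ⊆ V ∧ (e : Plane → Plane) = f := by
  have hc := contDiffAt_of_smoothNear ⟨f, hf⟩
  have hne : ∀ᶠ q in 𝓝 p, jac f q ≠ 0 := by
    have h : ∀ j i, ContinuousAt (fun q => pd j f q i) p := fun j i =>
      (differentiableAt_of_mem (apply_mem (pd_mem j hf) i)).continuousAt
    exact (((h 0 0).mul (h 1 1)).sub ((h 1 0).mul (h 0 1))).eventually_ne hj
  obtain ⟨W, hW, hWo, hpW⟩ := eventually_nhds_iff.1
    ((show ∀ᶠ q in 𝓝 p, ContDiffAt ℝ ∞ f q from hf).and (hne.and hV))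
  obtain ⟨f', hf'⟩ := exists_equiv_of_jac_ne_zero (differentiableAt_of_mem hf) hj
  let e := hc.toOpenPartialHomeomorph f hf' (by simp)
  have he : (e : Plane → Plane) = f := hc.toOpenPartialHomeomorph_coe hf' (by simp)
  -- The Jacobian is nonzero on all of `W`, so the inverse is smooth at every point of the target of
  -- the restriction and not only at `f p`.
  refine ⟨e.restrOpen W hWo, ⟨fun q hq => (hW q hq.2).1.contDiffWithinAt, fun y hy => ?_⟩,
    ⟨hc.mem_toOpenPartialHomeomorph_source hf' (by simp), hpW⟩, fun q hq => (hW q hq.2).2.2, he⟩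
  set x := (e.restrOpen W hWo).symm y with hx
  have hxs : x ∈ (e.restrOpen W hWo).source := (e.restrOpen W hWo).map_target hy
  obtain ⟨h1, h2, -⟩ := hW x hxs.2
  obtain ⟨f'', hf''⟩ := exists_equiv_of_jac_ne_zero (h1.differentiableAt (by simp)) h2
  exact ((e.restrOpen W hWo).contDiffAt_symm hy hf'' h1).contDiffWithinAt

/-- Three solutions with initial data `(s, s_x, s_y)` equal to the unit vectors are independent near
`p`. Taking `f = (s₁/s₀, s₂/s₀)`, their Wronskian has two expressions: the determinant times `w -
cubic (a q) z`, and `s₀³` times the numerator of `d²ỹ/dx̃²`. So one vanishes exactly when the other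
does. -/
theorem reducible_of_F_eq_zero {U : Set Plane} (hU : IsOpen U) {a : Plane → Fibre}
    (ha : ContDiffOn ℝ ∞ a U) (hF : ∀ p ∈ U, F1 a p = 0 ∧ F2 a p = 0) : ReducibleToLinear U a := by
  intro p hp
  have hap := section_mem hU ha hp
  have hflat : ∀ᶠ q in 𝓝 p, IsFlatAt (coeffA a) (coeffB a) (coeffC a) q := by
    filter_upwards [hU.mem_nhds hp] with q hq
    exact (isFlatAt_iff (section_mem hU ha hq)).2 (hF q hq)
  choose s hs hsol h₀ h₁ h₂ using fun i : Fin 3 =>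
    exists_solvesAt (coeffA_mem hap) (coeffB_mem hap) (coeffC_mem hap) hflat (Pi.single i 1)
  let S : Plane → Fin 3 → ℝ := fun q i => s i q
  have hS : S ∈ SmoothNear (Fin 3 → ℝ) p := pi_mem hs
  have hS0 : S p = ![1, 0, 0] := by
    funext i; simp only [S, h₀]; fin_cases i <;> simp
  have hSx : pd 0 S p = ![0, 1, 0] := by
    funext i; rw [← pd_apply (differentiableAt_of_mem hS)]; simp only [S, h₁]; fin_cases i <;> simp
  have hSy : pd 1 S p = ![0, 0, 1] := by
    funext i; rw [← pd_apply (differentiableAt_of_mem hS)]; simp only [S, h₂]; fin_cases i <;> simp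
  have hS0p : S p 0 ≠ 0 := by simp [hS0]
  have hdet : ContinuousAt (fun q => det3 (S q) (pd 0 S q) (pd 1 S q)) p := by
    have h : ∀ i, ContinuousAt (fun q => S q i) p := fun i =>
      (differentiableAt_of_mem (apply_mem hS i)).continuousAt
    have h' : ∀ j i, ContinuousAt (fun q => pd j S q i) p := fun j i =>
      (differentiableAt_of_mem (apply_mem (pd_mem j hS) i)).continuousAt
    simp only [det3]
    fun_prop
  have hdetp : det3 (S p) (pd 0 S p) (pd 1 S p) ≠ 0 := by
    rw [hS0, hSx, hSy]; simp [det3]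
  let f : Plane → Plane := fun q => ![S q 1 / S q 0, S q 2 / S q 0]
  have hfs : ∀ q, S ∈ SmoothNear (Fin 3 → ℝ) q → S q 0 ≠ 0 → f ∈ SmoothNear Plane q := by
    intro q h h0
    refine pi_mem fun i => ?_
    fin_cases i
    · exact div_mem' (apply_mem h 1) (apply_mem h 0) h0
    · exact div_mem' (apply_mem h 2) (apply_mem h 0) h0
  have hSf : ∀ q, S ∈ SmoothNear (Fin 3 → ℝ) q → S q 0 ≠ 0 →
      S =ᶠ[𝓝 q] fun x i => S x 0 * ![1, f x 0, f x 1] i := by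
    intro q h h0
    filter_upwards [(differentiableAt_of_mem (apply_mem h 0)).continuousAt.eventually_ne h0]
      with x hx
    funext i
    fin_cases i <;> simp [f] <;> field_simp
  have haff : ∀ q, f ∈ SmoothNear Plane q →
      (fun x => ![1, f x 0, f x 1]) ∈ SmoothNear (Fin 3 → ℝ) q := by
    intro q h
    refine pi_mem fun i => ?_
    fin_cases i
    · exact const_mem 1
    · exact apply_mem h 0
    · exact apply_mem h 1
  have key : ∀ q, S ∈ SmoothNear (Fin 3 → ℝ) q → S q 0 ≠ 0 → ∀ z w, wron S q z w = S q 0 ^ 3 *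
      (total1 f 0 q z * total2 f 1 q z w - total1 f 1 q z * total2 f 0 q z w) := by
    intro q h h0 z w
    have hf := hfs q h h0
    rw [wron_congr (hSf q h h0), wron_mul (apply_mem h 0) (haff q hf), wron_affine hf]
  -- Comparing the coefficients of `w` in the two expressions for the Wronskian, at `z = 0`, gives
  -- `det3 S S_x S_y = S₀³ * jac f`.
  have hjac : jac f p ≠ 0 := by
    intro hj
    have k1 := key p hS hS0p 0 1
    have k0 := key p hS hS0p 0 0
    rw [wron_eq] at k1 k0
    apply hdetp
    simp only [total1, total2] at k1 k0
    rw [jac] at hj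
    linear_combination k1 - k0 + S p 0 ^ 3 * hj
  have hne := (differentiableAt_of_mem (apply_mem hS 0)).continuousAt.eventually_ne hS0p
  have hsol' : ∀ᶠ q in 𝓝 p, ∀ i, SolvesAt (coeffA a) (coeffB a) (coeffC a) (fun x => S x i) q :=
    Filter.eventually_all.2 hsol
  obtain ⟨e, he, hpe, hsub, hef⟩ := exists_pointTransformation (hfs p hS hS0p) hjac
    ((hU.eventually_mem hp).and ((eventually_mem hS).and (hne.and (hsol'.and
      (hdet.eventually_ne hdetp)))))
  -- The transformed equation is `y'' = 0`, the linear form with `A = B = C = 0`.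
  refine ⟨e, he, hpe, fun q hq => (hsub hq).1, fun _ => 0, ⟨fun _ => 0, fun _ => 0, fun _ => 0,
    contDiffOn_const, contDiffOn_const, contDiffOn_const, fun q _ => ?_⟩, fun q hq z w hz => ?_⟩
  · funext i; fin_cases i <;> simp
  obtain ⟨-, h1, h2, h3, h4⟩ := hsub hq
  rw [hef] at hz ⊢
  have k := key q h1 h2 z w
  rw [wron_of_solves h1 h3] at k
  have hc : ∀ x, cubic (0 : Fibre) x = 0 := fun x => by simp [cubic]
  rw [hc, div_eq_zero_iff, or_iff_left (pow_ne_zero 3 hz)]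
  constructor
  · intro hw
    rw [hw, sub_self, mul_zero, ← hw] at k
    exact (mul_eq_zero.1 k.symm).resolve_left (pow_ne_zero 3 h2)
  · intro hN
    rw [hN, mul_zero] at k
    exact sub_eq_zero.1 ((mul_eq_zero.1 k).resolve_left h4)

end CubicODE

end

noncomputable section

namespace CubicODE

/-! ### Equations that can be reduced to linear form -/

section

variable {p : Plane}

/-- A function of `x` alone does not depend on `y`. -/
theorem pd_one_comp_fst {g : ℝ → ℝ} (hg : ContDiffAt ℝ ∞ g (p 0)) :
    pd 1 (fun q : Plane => g (q 0)) p = 0 := by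
  have h1 : HasFDerivAt (fun q : Plane => q 0) (ContinuousLinearMap.proj 0 : Plane →L[ℝ] ℝ) p :=
    (ContinuousLinearMap.proj 0 : Plane →L[ℝ] ℝ).hasFDerivAt
  have h2 := (hg.differentiableAt (by simp)).hasFDerivAt.comp p h1
  exact (hasFDerivAt_of_pd h2).trans (by simp)

theorem comp_fst_mem {g : ℝ → ℝ} {V : Set Plane} (hV : V ∈ 𝓝 p)
    (hg : ∀ q ∈ V, ContDiffAt ℝ ∞ g (q 0)) : (fun q : Plane => g (q 0)) ∈ SmoothNear ℝ p := by
  change ∀ᶠ q in 𝓝 p, ContDiffAt ℝ ∞ _ q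
  filter_upwards [hV] with q hq
  exact ContDiffAt.comp (f := fun q : Plane => q 0) q (hg q hq) (contDiff_apply ℝ ℝ 0).contDiffAt

/-- Here `u³ = u⁴ = 0`, `u²` depends on `x` only and `u¹` is affine in `y`, so every term of `F¹`
and of `F²` has a vanishing factor. -/
theorem F_eq_zero_of_isLinearOn {V : Set Plane} (hV : IsOpen V) {b : Plane → Fibre}
    (hb : IsLinearOn V b) (hp : p ∈ V) : b ∈ SmoothNear Fibre p ∧ F1 b p = 0 ∧ F2 b p = 0 := by
  obtain ⟨A, B, C, hA, hB, hC, h⟩ := hb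
  have hV' : IsOpen ((fun q : Plane => q 0) '' V) := isOpenMap_eval 0 V hV
  have at' : ∀ {g : ℝ → ℝ}, ContDiffOn ℝ ∞ g ((fun q : Plane => q 0) '' V) →
      ∀ q ∈ V, ContDiffAt ℝ ∞ g (q 0) := fun hg q hq =>
    hg.contDiffAt (hV'.mem_nhds ⟨q, hq, rfl⟩)
  have hVn := fun q (hq : q ∈ V) => hV.mem_nhds hq
  have hy : ∀ q : Plane, (fun x : Plane => x 1) ∈ SmoothNear ℝ q := fun q =>
    Filter.Eventually.of_forall fun x => (contDiff_apply ℝ ℝ 1).contDiffAt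
  have pdy : ∀ q : Plane, pd 1 (fun x : Plane => x 1) q = 1 := fun q =>
    (hasFDerivAt_of_pd (ContinuousLinearMap.proj 1 : Plane →L[ℝ] ℝ).hasFDerivAt).trans (by simp)
  have comp : ∀ q ∈ V, ∀ i, (fun x => b x i) =ᶠ[𝓝 q]
      fun x => (![B (x 0) * x 1 + C (x 0), A (x 0), 0, 0] : Fibre) i := fun q hq i => by
    filter_upwards [hVn q hq] with x hx
    rw [h x hx]
  have mA := fun q hq => comp_fst_mem (hVn q hq) (at' hA)
  have mB := fun q hq => comp_fst_mem (hVn q hq) (at' hB)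
  have mC := fun q hq => comp_fst_mem (hVn q hq) (at' hC)
  have mem : ∀ q ∈ V, b ∈ SmoothNear Fibre q := by
    intro q hq
    refine pi_mem fun i => mem_of_eventuallyEq ?_ (comp q hq i)
    fin_cases i
    · exact add_mem' (mul_mem' (mB q hq) (hy q)) (mC q hq)
    · exact mA q hq
    · exact const_mem 0
    · exact const_mem 0
  have z2 : ∀ q ∈ V, ∀ j, pd j b q 2 = 0 := fun q hq j => by
    rw [← pd_apply (differentiableAt_of_mem (mem q hq)), pd_congr (comp q hq 2)]
    exact pd_const 0
  have z3 : ∀ q ∈ V, ∀ j, pd j b q 3 = 0 := fun q hq j => by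
    rw [← pd_apply (differentiableAt_of_mem (mem q hq)), pd_congr (comp q hq 3)]
    exact pd_const 0
  have z1 : ∀ q ∈ V, pd 1 b q 1 = 0 := fun q hq => by
    rw [← pd_apply (differentiableAt_of_mem (mem q hq)), pd_congr (comp q hq 1)]
    exact pd_one_comp_fst (at' hA q hq)
  have z0 : ∀ q ∈ V, pd 1 b q 0 = B (q 0) := fun q hq => by
    rw [← pd_apply (differentiableAt_of_mem (mem q hq)), pd_congr (comp q hq 0)]
    refine (pd_add (differentiableAt_of_mem (mul_mem' (mB q hq) (hy q)))
      (differentiableAt_of_mem (mC q hq))).trans ?_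
    rw [pd_mul (differentiableAt_of_mem (mB q hq)) (differentiableAt_of_mem (hy q)), pdy,
      pd_one_comp_fst (at' hB q hq), pd_one_comp_fst (at' hC q hq)]
    ring
  have zz : ∀ {i j}, (∀ q ∈ V, pd j b q i = 0) → ∀ k, pd k (pd j b) p i = 0 := by
    intro i j hz k
    rw [← pd_apply (differentiableAt_of_mem (pd_mem j (mem p hp)))]
    have : (fun x => pd j b x i) =ᶠ[𝓝 p] fun _ => 0 := by
      filter_upwards [hVn p hp] with q hq using hz q hq
    rw [pd_congr this, pd_const]
  have zB : pd 1 (pd 1 b) p 0 = 0 := by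
    rw [← pd_apply (differentiableAt_of_mem (pd_mem 1 (mem p hp)))]
    have : (fun x => pd 1 b x 0) =ᶠ[𝓝 p] fun x => B (x 0) := by
      filter_upwards [hVn p hp] with q hq using z0 q hq
    rw [pd_congr this, pd_one_comp_fst (at' hB p hp)]
  have b2 : b p 2 = 0 := by rw [h p hp]; rfl
  have b3 : b p 3 = 0 := by rw [h p hp]; rfl
  refine ⟨mem p hp, ?_, ?_⟩
  · rw [F1, zB, zz z1, zz fun q hq => z2 q hq 0, z2 p hp, z2 p hp, z3 p hp, z1 p hp, b2, b3]
    ring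
  · rw [F2, zz z1, zz fun q hq => z2 q hq 1, zz fun q hq => z3 q hq 0, z2 p hp, z3 p hp, z3 p hp,
      z1 p hp, b2, b3]
    ring

/-! ### From three functions with given Wronskian back to the system of the equation. -/

theorem pd_det3 {u v w : Plane → Fin 3 → ℝ} (hu : DifferentiableAt ℝ u p)
    (hv : DifferentiableAt ℝ v p) (hw : DifferentiableAt ℝ w p) (j : Fin 2) :
    pd j (fun q => det3 (u q) (v q) (w q)) p = det3 (pd j u p) (v p) (w p)
      + det3 (u p) (pd j v p) (w p) + det3 (u p) (v p) (pd j w p) := by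
  have hu' := fun i => differentiableAt_pi.1 hu i
  have hv' := fun i => differentiableAt_pi.1 hv i
  have hw' := fun i => differentiableAt_pi.1 hw i
  have e : ∀ {f g : Plane → ℝ}, DifferentiableAt ℝ f p → DifferentiableAt ℝ g p →
      DifferentiableAt ℝ (fun x => f x * g x) p := fun hf hg => hf.mul hg
  have e' : ∀ {f g : Plane → ℝ}, DifferentiableAt ℝ f p → DifferentiableAt ℝ g p →
      DifferentiableAt ℝ (fun x => f x - g x) p := fun hf hg => hf.sub hg
  have e'' : ∀ {f g : Plane → ℝ}, DifferentiableAt ℝ f p → DifferentiableAt ℝ g p →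
      DifferentiableAt ℝ (fun x => f x + g x) p := fun hf hg => hf.add hg
  have m : ∀ i k, DifferentiableAt ℝ (fun x => v x i * w x k - v x k * w x i) p := fun i k =>
    e' (e (hv' i) (hw' k)) (e (hv' k) (hw' i))
  have dm : ∀ i k, pd j (fun x => v x i * w x k - v x k * w x i) p =
      pd j v p i * w p k + v p i * pd j w p k - (pd j v p k * w p i + v p k * pd j w p i) := by
    intro i k
    rw [pd_sub (e (hv' i) (hw' k)) (e (hv' k) (hw' i)), pd_mul (hv' i) (hw' k),
      pd_mul (hv' k) (hw' i), pd_apply hv, pd_apply hv, pd_apply hw, pd_apply hw]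
  simp only [det3]
  rw [pd_add (e' (e (hu' 0) (m 1 2)) (e (hu' 1) (m 0 2))) (e (hu' 2) (m 0 1)),
    pd_sub (e (hu' 0) (m 1 2)) (e (hu' 1) (m 0 2)), pd_mul (hu' 0) (m 1 2), pd_mul (hu' 1) (m 0 2),
    pd_mul (hu' 2) (m 0 1), dm, dm, dm, pd_apply hu, pd_apply hu, pd_apply hu]
  ring

theorem det3_mem {u v w : Plane → Fin 3 → ℝ} (hu : u ∈ SmoothNear (Fin 3 → ℝ) p)
    (hv : v ∈ SmoothNear (Fin 3 → ℝ) p) (hw : w ∈ SmoothNear (Fin 3 → ℝ) p) :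
    (fun q => det3 (u q) (v q) (w q)) ∈ SmoothNear ℝ p := by
  have m : ∀ i k, (fun x => v x i * w x k - v x k * w x i) ∈ SmoothNear ℝ p := fun i k =>
    sub_mem' (mul_mem' (apply_mem hv i) (apply_mem hw k)) (mul_mem' (apply_mem hv k) (apply_mem hw
        i))
  exact add_mem' (sub_mem' (mul_mem' (apply_mem hu 0) (m 1 2)) (mul_mem' (apply_mem hu 1) (m 0 2)))
    (mul_mem' (apply_mem hu 2) (m 0 1))

/-- A cubic polynomial that vanishes wherever a nonzero affine function does not is zero. -/
theorem coeff_eq_zero {c₀ c₁ c₂ c₃ α β : ℝ} (hαβ : α ≠ 0 ∨ β ≠ 0)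
    (h : ∀ z, α + β * z ≠ 0 → c₀ + c₁ * z + c₂ * z ^ 2 + c₃ * z ^ 3 = 0) :
    c₀ = 0 ∧ c₁ = 0 ∧ c₂ = 0 ∧ c₃ = 0 := by
  -- Multiplication by the affine function removes the exception. The resulting quartic vanishes
  -- identically, and its values at `0, ±1, ±2` give its five coefficients.
  have h' : ∀ z, (α + β * z) * (c₀ + c₁ * z + c₂ * z ^ 2 + c₃ * z ^ 3) = 0 := fun z => by
    by_cases hz : α + β * z = 0
    · rw [hz, zero_mul]
    · rw [h z hz, mul_zero]
  have k0 := h' 0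
  have k1 := h' 1
  have k2 := h' (-1)
  have k3 := h' 2
  have k4 := h' (-2)
  have e0 : α * c₀ = 0 := by linear_combination k0
  have e4 : β * c₃ = 0 := by
    linear_combination k0 / 4 - k1 / 6 - k2 / 6 + k3 / 24 + k4 / 24
  have e2 : α * c₂ + β * c₁ = 0 := by linear_combination k1 / 2 + k2 / 2 - e0 - e4
  have e3 : α * c₃ + β * c₂ = 0 := by
    linear_combination k3 / 12 - k4 / 12 - k1 / 6 + k2 / 6
  have e1 : α * c₁ + β * c₀ = 0 := by linear_combination k1 / 2 - k2 / 2 - e3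
  rcases hαβ with hα | hβ
  · obtain rfl : c₀ = 0 := (mul_eq_zero.1 e0).resolve_left hα
    obtain rfl : c₁ = 0 := (mul_eq_zero.1 (by linear_combination e1)).resolve_left hα
    obtain rfl : c₂ = 0 := (mul_eq_zero.1 (by linear_combination e2)).resolve_left hα
    exact ⟨rfl, rfl, rfl, (mul_eq_zero.1 (by linear_combination e3)).resolve_left hα⟩
  · obtain rfl : c₃ = 0 := (mul_eq_zero.1 e4).resolve_left hβ
    obtain rfl : c₂ = 0 := (mul_eq_zero.1 (by linear_combination e3)).resolve_left hβ
    obtain rfl : c₁ = 0 := (mul_eq_zero.1 (by linear_combination e2)).resolve_left hβ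
    exact ⟨(mul_eq_zero.1 (by linear_combination e1)).resolve_left hβ, rfl, rfl, rfl⟩

theorem cramer3 (u v w x : Fin 3 → ℝ) (i : Fin 3) : x i * det3 u v w =
    det3 u x w * v i + det3 u v x * w i + det3 x v w * u i := by
  fin_cases i <;> simp only [det3, Fin.zero_eta, Fin.mk_one, Fin.reduceFinMk] <;> ring

/-- If three functions have locally constant nonzero Wronskian determinant, and the curves along
which they are dependent are the solutions of the equation `a`, then `F¹ = F² = 0`. -/
theorem F_eq_zero_of_wron {a : Plane → Fibre} (ha : a ∈ SmoothNear Fibre p)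
    {s : Plane → Fin 3 → ℝ} (hs : s ∈ SmoothNear (Fin 3 → ℝ) p)
    (hD : ∀ᶠ q in 𝓝 p, det3 (s q) (pd 0 s q) (pd 1 s q) ^ 2 = 1)
    (hw : ∀ᶠ q in 𝓝 p, ∃ α β : ℝ, (α ≠ 0 ∨ β ≠ 0) ∧ ∀ z, α + β * z ≠ 0 →
      wron s q z 0 = det3 (s q) (pd 0 s q) (pd 1 s q) * (0 - cubic (a q) z)) :
    F1 a p = 0 ∧ F2 a p = 0 := by
  let D := fun q => det3 (s q) (pd 0 s q) (pd 1 s q)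
  let S : Fin 3 → Plane → Fin 3 → ℝ := ![pd 0 (pd 0 s), pd 0 (pd 1 s), pd 1 (pd 1 s)]
  -- Since `s`, `s_x`, `s_y` are independent, Cramer's rule expands the second derivatives in them;
  -- this is the coefficient of `s`. What remains is to identify the coefficients of `s_x` and `s_y`
  -- with `coeffA` and `coeffB`.
  let C : Fin 3 → Plane → ℝ := fun i q => det3 (S i q) (pd 0 s q) (pd 1 s q) / D q
  have hDm : D ∈ SmoothNear ℝ p := det3_mem hs (pd_mem 0 hs) (pd_mem 1 hs)
  have hDne : ∀ q, D q ^ 2 = 1 → D q ≠ 0 := fun q h h0 => by simp [h0] at h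
  have hD0 : D p ≠ 0 := hDne p hD.self_of_nhds
  have hSm : ∀ i, S i ∈ SmoothNear (Fin 3 → ℝ) p := by
    intro i
    fin_cases i
    · exact pd_mem 0 (pd_mem 0 hs)
    · exact pd_mem 0 (pd_mem 1 hs)
    · exact pd_mem 1 (pd_mem 1 hs)
  have hC : ∀ i, C i ∈ SmoothNear ℝ p := fun i =>
    div_mem' (det3_mem (hSm i) (pd_mem 0 hs) (pd_mem 1 hs)) hDm hD0
  have hsol : ∀ᶠ q in 𝓝 p, ∀ i, SolvesAt (coeffA a) (coeffB a) C (fun x => s x i) q := by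
    filter_upwards [hD.eventually_nhds, hw, eventually_mem hs] with q hDq ⟨α, β, hαβ, hz⟩ hsq i
    have hDq0 := hDne q hDq.self_of_nhds
    have hds := differentiableAt_of_mem hsq
    have hd := fun j => differentiableAt_of_mem (pd_mem j hsq)
    have hDj : ∀ j, pd j D q = 0 := by
      intro j
      have hm : D ∈ SmoothNear ℝ q := det3_mem hsq (pd_mem 0 hsq) (pd_mem 1 hsq)
      have e : (fun x => D x * D x) =ᶠ[𝓝 q] fun _ => 1 := by
        filter_upwards [hDq] with x hx
        rw [← hx, sq]
      have := pd_congr (j := j) e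
      rw [pd_mul (differentiableAt_of_mem hm) (differentiableAt_of_mem hm), pd_const] at this
      have h2 : 2 * D q * pd j D q = 0 := by linear_combination this
      exact (mul_eq_zero.1 h2).resolve_left (mul_ne_zero two_ne_zero hDq0)
    -- The six unknown coefficients need six equations. Constancy of `D` gives two of them, that the
    -- traces of the system vanish (`A₀ + B₁ = 0` and `A₁ + B₂ = 0`); the four coefficients of the
    -- cubic in `z` give the rest.
    have t0 := (pd_det3 hds (hd 0) (hd 1) 0).symm.trans (hDj 0)
    have t1 := (pd_det3 hds (hd 0) (hd 1) 1).symm.trans (hDj 1)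
    rw [pd_comm hsq] at t1
    obtain ⟨k0, k1, k2, k3⟩ := coeff_eq_zero hαβ fun z hne => by
      have := hz z hne
      rw [wron_eq, cubic] at this
      have e : (det3 (s q) (pd 0 s q) (pd 0 (pd 0 s) q) + D q * a q 0)
        + (det3 (s q) (pd 1 s q) (pd 0 (pd 0 s) q)
          + 2 * det3 (s q) (pd 0 s q) (pd 0 (pd 1 s) q) + D q * a q 1) * z
        + (det3 (s q) (pd 0 s q) (pd 1 (pd 1 s) q)
          + 2 * det3 (s q) (pd 1 s q) (pd 0 (pd 1 s) q) + D q * a q 2) * z ^ 2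
        + (det3 (s q) (pd 1 s q) (pd 1 (pd 1 s) q) + D q * a q 3) * z ^ 3 = 0 := by
        simp only [D]
        linear_combination this
      exact e
    have swap : ∀ u v w, det3 u v w = -det3 u w v := fun u v w => by simp only [det3]; ring
    have same : ∀ u w, det3 u u w = 0 := fun u w => by simp only [det3]; ring
    have same'' : ∀ u w, det3 u w u = 0 := fun u w => by simp only [det3]; ring
    simp only [same, same''] at t0 t1
    simp only [swap _ (pd 1 s q)] at k1 k2 k3
    have cr : ∀ {x : Fin 3 → ℝ} {A B C : ℝ}, det3 (s q) x (pd 1 s q) = A * D q →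
        det3 (s q) (pd 0 s q) x = B * D q → C = det3 x (pd 0 s q) (pd 1 s q) / D q →
        x i = A * pd 0 s q i + B * pd 1 s q i + C * s q i := by
      intro x A B C hA hB hC
      have := cramer3 (s q) (pd 0 s q) (pd 1 s q) x i
      rw [hA, hB, ← div_mul_cancel₀ (det3 x (pd 0 s q) (pd 1 s q)) hDq0, ← hC] at this
      refine mul_right_cancel₀ hDq0 (this.trans ?_)
      ring
    simp only [SolvesAt, pd_apply hds, pd_pd_apply hsq]
    refine ⟨cr ?_ ?_ rfl, cr ?_ ?_ rfl, cr ?_ ?_ rfl⟩ <;>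
      simp only [coeffA, coeffB, Matrix.cons_val]
    · linear_combination -k1 / 3 + 2 / 3 * t0
    · linear_combination k0
    · linear_combination -k2 / 3 + t1 / 3
    · linear_combination k1 / 3 + t0 / 3
    · linear_combination -k3
    · linear_combination k2 / 3 + 2 / 3 * t1
  refine F_eq_zero_of_isFlatAt ha (C := C) ?_
  filter_upwards [eventually_mem ha, eventually_mem hs, hsol.eventually_nhds,
    hD, Filter.eventually_all.2 fun i => eventually_mem (hC i)] with q h1 h2 h3 h4 h5
  exact isFlatAt_of_solves (coeffA_mem h1) (coeffB_mem h1) h5 h2 (fun i => h3.mono fun x hx => hx i)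
    (hDne q h4)

end

end CubicODE

end

/-! ### Reducible equations satisfy `F¹ = F² = 0`. -/

noncomputable section

namespace CubicODE

section

variable {p : Plane}

theorem jac_ne_zero_of_pointTransformation {e : OpenPartialHomeomorph Plane Plane}
    (he : IsPointTransformation e) (hp : p ∈ e.source) :
    (e : Plane → Plane) ∈ SmoothNear Plane p ∧ jac e p ≠ 0 := by
  have hs : (e : Plane → Plane) ∈ SmoothNear Plane p := by
    change ∀ᶠ q in 𝓝 p, ContDiffAt ℝ ∞ e q
    filter_upwards [e.open_source.mem_nhds hp] with q hq
    exact he.1.contDiffAt (e.open_source.mem_nhds hq)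
  have ht : ContDiffAt ℝ ∞ e.symm (e p) :=
    he.2.contDiffAt (e.open_target.mem_nhds (e.map_source hp))
  refine ⟨hs, fun hj => ?_⟩
  have hid : (fun q => e.symm (e q)) =ᶠ[𝓝 p] fun q => q := by
    filter_upwards [e.open_source.mem_nhds hp] with q hq using e.left_inv hq
  -- The chain rule for `e.symm ∘ e = id`: the product of the Jacobian matrices is the identity, so
  -- the product of their determinants is 1.
  have key : ∀ j i, pd j e p 0 * pd 0 e.symm (e p) i + pd j e p 1 * pd 1 e.symm (e p) i =
      (Pi.single j 1 : Plane) i := by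
    intro j i
    have h1 := pd_congr (j := j) hid
    rw [pd_comp (differentiableAt_of_mem hs) (ht.differentiableAt (by simp))] at h1
    have h2 : pd j (fun q : Plane => q) p = Pi.single j 1 := by simp [pd]
    rw [h2] at h1
    exact congrFun h1 i
  have k00 := key 0 0
  have k01 := key 0 1
  have k10 := key 1 0
  have k11 := key 1 1
  simp at k00 k01 k10 k11
  rw [jac] at hj
  have : (1 : ℝ) = 0 := by
    calc (1 : ℝ) = 1 * 1 - 0 * 0 := by ring
      _ = (pd 0 e p 0 * pd 1 e p 1 - pd 1 e p 0 * pd 0 e p 1) *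
        (pd 0 e.symm (e p) 0 * pd 1 e.symm (e p) 1
          - pd 1 e.symm (e p) 0 * pd 0 e.symm (e p) 1) := by
        nth_rewrite 1 [← k00]
        rw [← k11]
        nth_rewrite 1 [← k01]
        rw [← k10]
        ring
      _ = 0 := by rw [hj, zero_mul]
  exact one_ne_zero this

/-- `|G|^{-1/3}` as a smooth function. -/
theorem exists_cube_root_inv {G : Plane → ℝ} (hG : G ∈ SmoothNear ℝ p) (h0 : G p ≠ 0) :
    ∃ l ∈ SmoothNear ℝ p, ∀ᶠ q in 𝓝 p, (l q ^ 3 * G q) ^ 2 = 1 := by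
  have hne := (differentiableAt_of_mem hG).continuousAt.eventually_ne h0
  -- `Real.log x` is `log |x|`, so this is `|G|^(-1/3)` for either sign of `G`, and `l³ G = ±1`.
  refine ⟨fun q => Real.exp (-(1 / 3) * Real.log (G q)), ?_, ?_⟩
  · change ∀ᶠ q in 𝓝 p, ContDiffAt ℝ ∞ _ q
    filter_upwards [show ∀ᶠ q in 𝓝 p, ContDiffAt ℝ ∞ G q from hG, hne] with q h1 h2
    exact (contDiffAt_const.mul (h1.log h2)).exp
  · filter_upwards [hne] with q hq
    have e : Real.exp (-(1 / 3) * Real.log (G q)) ^ 3 = |G q|⁻¹ := by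
      rw [← Real.exp_nat_mul, ← Real.exp_log_eq_abs hq, ← Real.exp_neg]
      congr 1
      push_cast
      ring
    rw [e, mul_pow, inv_pow, sq_abs, inv_mul_cancel₀ (pow_ne_zero 2 hq)]

/-- Solutions `T` of the system of the linear equation, pulled back by `f`, are dependent along the
solution curves of `a`. Their determinant is `E (f q) * jac f q`; a common factor `l` contributes
`l³`, so `l` can be chosen to make it locally `±1`. This normalization is necessary because the
system attached to `a` has zero traces. -/
theorem F_eq_zero_of_reducible {U : Set Plane} (hU : IsOpen U) {a : Plane → Fibre}
    (ha : ContDiffOn ℝ ∞ a U) (hr : ReducibleToLinear U a) (hp : p ∈ U) :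
    F1 a p = 0 ∧ F2 a p = 0 := by
  obtain ⟨f, hf, hpf, hfU, b, hb, hT⟩ := hr p hp
  have hap := section_mem hU ha hp
  obtain ⟨hfp, hjp⟩ := jac_ne_zero_of_pointTransformation hf hpf
  obtain ⟨hbp, -⟩ := F_eq_zero_of_isLinearOn f.open_target hb (f.map_source hpf)
  have hflat : ∀ᶠ q in 𝓝 (f p), IsFlatAt (coeffA b) (coeffB b) (coeffC b) q := by
    filter_upwards [f.open_target.mem_nhds (f.map_source hpf)] with q hq
    obtain ⟨h1, h2⟩ := F_eq_zero_of_isLinearOn f.open_target hb hq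
    exact (isFlatAt_iff h1).2 h2
  choose t ht hsol h₀ h₁ h₂ using fun i : Fin 3 =>
    exists_solvesAt (coeffA_mem hbp) (coeffB_mem hbp) (coeffC_mem hbp) hflat (Pi.single i 1)
  let T : Plane → Fin 3 → ℝ := fun q i => t i q
  have hTm : T ∈ SmoothNear (Fin 3 → ℝ) (f p) := pi_mem ht
  have hT0 : T (f p) = ![1, 0, 0] := by
    funext i; simp only [T, h₀]; fin_cases i <;> simp
  have hTx : pd 0 T (f p) = ![0, 1, 0] := by
    funext i; rw [← pd_apply (differentiableAt_of_mem hTm)]; simp only [T, h₁]; fin_cases i <;> simp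
  have hTy : pd 1 T (f p) = ![0, 0, 1] := by
    funext i; rw [← pd_apply (differentiableAt_of_mem hTm)]; simp only [T, h₂]; fin_cases i <;> simp
  let E : Plane → ℝ := fun q => det3 (T q) (pd 0 T q) (pd 1 T q)
  have hEm : E ∈ SmoothNear ℝ (f p) := det3_mem hTm (pd_mem 0 hTm) (pd_mem 1 hTm)
  have hEp : E (f p) ≠ 0 := by
    simp only [E]
    rw [hT0, hTx, hTy]; simp [det3]
  have hjm : jac f ∈ SmoothNear ℝ p :=
    sub_mem' (mul_mem' (apply_mem (pd_mem 0 hfp) 0) (apply_mem (pd_mem 1 hfp) 1))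
      (mul_mem' (apply_mem (pd_mem 1 hfp) 0) (apply_mem (pd_mem 0 hfp) 1))
  obtain ⟨l, hl, hl1⟩ := exists_cube_root_inv (G := fun q => E (f q) * jac f q)
    (mul_mem' (comp_mem' hfp hEm) hjm) (mul_ne_zero hEp hjp)
  have hTf : (fun q => T (f q)) ∈ SmoothNear (Fin 3 → ℝ) p := comp_mem' hfp hTm
  let s : Plane → Fin 3 → ℝ := fun q i => l q * T (f q) i
  have hs : s ∈ SmoothNear (Fin 3 → ℝ) p := pi_mem fun i => mul_mem' hl (apply_mem hTf i)
  have key : ∀ᶠ q in 𝓝 p, ∀ z w, pd 0 f q 0 + pd 1 f q 0 * z ≠ 0 →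
      wron s q z w = l q ^ 3 * (E (f q) * jac f q) * (w - cubic (a q) z) := by
    have hsol' : ∀ᶠ q in 𝓝 p, ∀ i,
        SolvesAt (coeffA b) (coeffB b) (coeffC b) (fun x => T x i) (f q) :=
      (differentiableAt_of_mem hfp).continuousAt.eventually (Filter.eventually_all.2 hsol)
    have hTm' := (differentiableAt_of_mem hfp).continuousAt.eventually (eventually_mem hTm)
    filter_upwards [eventually_mem hl, eventually_mem hfp, hTm', hsol',
      f.open_source.mem_nhds hpf] with q h1 h2 h3 h4 h5 z w hz
    -- Only `w = cubic (a q) z` has to be tested: the numerator of `d²ỹ/dx̃²` is affine in `w` with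
    -- slope `jac f q`, so its value there determines it for all `w`.
    have e := (hT q h5 z (cubic (a q) z) hz).1 rfl
    have hz' : total1 f 0 q z ≠ 0 := hz
    rw [div_eq_iff (pow_ne_zero 3 hz')] at e
    have e' : total1 f 0 q z * total2 f 1 q z (cubic (a q) z)
        - total1 f 1 q z * total2 f 0 q z (cubic (a q) z) =
        b (f q) 3 * total1 f 1 q z ^ 3 + b (f q) 2 * total1 f 1 q z ^ 2 * total1 f 0 q z
        + b (f q) 1 * total1 f 1 q z * total1 f 0 q z ^ 2 + b (f q) 0 * total1 f 0 q z ^ 3 := by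
      rw [e]
      simp only [cubic]
      field_simp
    rw [wron_mul h1 (comp_mem' h2 h3), wron_comp h2 h3 h4, ← e']
    simp only [E, total1, total2, jac]
    ring
  have hdet : ∀ᶠ q in 𝓝 p, jac f q ≠ 0 ∧
      det3 (s q) (pd 0 s q) (pd 1 s q) = l q ^ 3 * (E (f q) * jac f q) := by
    filter_upwards [key, (differentiableAt_of_mem hjm).continuousAt.eventually_ne hjp] with q hq hj
    refine ⟨hj, ?_⟩
    -- If `dx̃/dx` vanished for every slope, both first derivatives of `x̃` would be zero, and so
    -- would the Jacobian.
    obtain ⟨z, hz⟩ : ∃ z, pd 0 f q 0 + pd 1 f q 0 * z ≠ 0 := by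
      by_contra! h
      have h0 := h 0
      have h1 := h 1
      apply hj
      rw [jac]
      linear_combination (pd 1 f q 1 + pd 0 f q 1) * h0 - pd 0 f q 1 * h1
    have k1 := hq z 1 hz
    have k0 := hq z 0 hz
    rw [wron_eq] at k1 k0
    linear_combination k1 - k0
  refine F_eq_zero_of_wron hap hs ?_ ?_
  · filter_upwards [hdet, hl1] with q h1 h2
    rw [h1.2, h2]
  · filter_upwards [hdet, key] with q h1 h2
    refine ⟨pd 0 f q 0, pd 1 f q 0, ?_, fun z hz => by rw [h1.2, h2 z 0 hz]⟩
    by_contra! h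
    exact h1.1 (by rw [jac, h.1, h.2]; ring)

theorem reducible_iff {U : Set Plane} (hU : IsOpen U) {a : Plane → Fibre}
    (ha : ContDiffOn ℝ ∞ a U) :
    ReducibleToLinear U a ↔ ∀ p ∈ U, F1 a p = 0 ∧ F2 a p = 0 :=
  ⟨fun h _ hp => F_eq_zero_of_reducible hU ha h hp, reducible_of_F_eq_zero hU ha⟩

end

end CubicODE

end

noncomputable section

namespace CubicODE

/-! ### Jets of vector fields and the invariant `ω²` -/

section

variable {p : Plane}

/-- The formula shows that the 1-jet of `ψ_X` at `p` involves only the 3-jet of `X` and the 2-jet of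
`S`, and that it is affine in the third derivatives of `X` with constant coefficients. -/
theorem pd_psi {X : Plane → Plane} {S : Plane → Fibre} (hX : X ∈ SmoothNear Plane p)
    (hS : S ∈ SmoothNear Fibre p) (j : Fin 2) : pd j (psi X S) p =
    ![ -(pd j (pd 0 S) p 0) * X p 0 - pd 0 S p 0 * pd j X p 0
        - (pd j (pd 1 S) p 0 * X p 1 + pd 1 S p 0 * pd j X p 1)
        - 2 * (pd j S p 0 * pd 0 X p 0 + S p 0 * pd j (pd 0 X) p 0)
        + (pd j S p 0 * pd 1 X p 1 + S p 0 * pd j (pd 1 X) p 1)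
        - (pd j S p 1 * pd 0 X p 1 + S p 1 * pd j (pd 0 X) p 1)
        + pd j (pd 0 (pd 0 X)) p 1,
      -(pd j (pd 0 S) p 1) * X p 0 - pd 0 S p 1 * pd j X p 0
        - (pd j (pd 1 S) p 1 * X p 1 + pd 1 S p 1 * pd j X p 1)
        - 3 * (pd j S p 0 * pd 1 X p 0 + S p 0 * pd j (pd 1 X) p 0)
        - (pd j S p 1 * pd 0 X p 0 + S p 1 * pd j (pd 0 X) p 0)
        - 2 * (pd j S p 2 * pd 0 X p 1 + S p 2 * pd j (pd 0 X) p 1)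
        - pd j (pd 0 (pd 0 X)) p 0 + 2 * pd j (pd 0 (pd 1 X)) p 1,
      -(pd j (pd 0 S) p 2) * X p 0 - pd 0 S p 2 * pd j X p 0
        - (pd j (pd 1 S) p 2 * X p 1 + pd 1 S p 2 * pd j X p 1)
        - 2 * (pd j S p 1 * pd 1 X p 0 + S p 1 * pd j (pd 1 X) p 0)
        - (pd j S p 2 * pd 1 X p 1 + S p 2 * pd j (pd 1 X) p 1)
        - 3 * (pd j S p 3 * pd 0 X p 1 + S p 3 * pd j (pd 0 X) p 1)
        - 2 * pd j (pd 0 (pd 1 X)) p 0 + pd j (pd 1 (pd 1 X)) p 1,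
      -(pd j (pd 0 S) p 3) * X p 0 - pd 0 S p 3 * pd j X p 0
        - (pd j (pd 1 S) p 3 * X p 1 + pd 1 S p 3 * pd j X p 1)
        - (pd j S p 2 * pd 1 X p 0 + S p 2 * pd j (pd 1 X) p 0)
        + (pd j S p 3 * pd 0 X p 0 + S p 3 * pd j (pd 0 X) p 0)
        - 2 * (pd j S p 3 * pd 1 X p 1 + S p 3 * pd j (pd 1 X) p 1)
        - pd j (pd 1 (pd 1 X)) p 0 ] := by
  have s0 := fun i => differentiableAt_of_mem (apply_mem hS i)
  have s1 := fun k i => differentiableAt_of_mem (apply_mem (pd_mem k hS) i)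
  have x0 := fun i => differentiableAt_of_mem (apply_mem hX i)
  have x1 := fun k i => differentiableAt_of_mem (apply_mem (pd_mem k hX) i)
  have x2 := fun k l i => differentiableAt_of_mem (apply_mem (pd_mem k (pd_mem l hX)) i)
  have ds0 := fun i => pd_apply (j := j) (differentiableAt_of_mem hS) i
  have ds1 := fun k i => pd_apply (j := j) (differentiableAt_of_mem (pd_mem k hS)) i
  have dx0 := fun i => pd_apply (j := j) (differentiableAt_of_mem hX) i
  have dx1 := fun k i => pd_apply (j := j) (differentiableAt_of_mem (pd_mem k hX)) i
  have dx2 := fun k l i => pd_apply (j := j) (differentiableAt_of_mem (pd_mem k (pd_mem l hX))) i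
  funext i
  rw [← pd_apply (differentiableAt_of_mem (psi_mem hX hS))]
  fin_cases i <;>
    simp only [psi, Fin.zero_eta, Fin.mk_one, Fin.reduceFinMk, Matrix.cons_val] <;>
    simp (disch := fun_prop) only [pd_add, pd_sub, pd_mul, pd_neg, pd_const, ds0, ds1, dx0, dx1,
      dx2] <;>
    ring

theorem lieB_apply (X Y : SmoothNear Plane p) (i : Fin 2) : (fun q => (lieB X Y).1 q i) =
    fun q => X.1 q 0 * pd 0 Y.1 q i + X.1 q 1 * pd 1 Y.1 q i
      - (Y.1 q 0 * pd 0 X.1 q i + Y.1 q 1 * pd 1 X.1 q i) := by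
  funext q
  change (fderiv ℝ Y.1 q (X.1 q) - fderiv ℝ X.1 q (Y.1 q)) i = _
  rw [fderiv_eq_pd, fderiv_eq_pd]
  simp

theorem pd_bracket {f₁ f₂ f₃ f₄ g₁ g₂ g₃ g₄ : Plane → ℝ} (hf₁ : f₁ ∈ SmoothNear ℝ p)
    (hf₂ : f₂ ∈ SmoothNear ℝ p) (hf₃ : f₃ ∈ SmoothNear ℝ p) (hf₄ : f₄ ∈ SmoothNear ℝ p)
    (hg₁ : g₁ ∈ SmoothNear ℝ p) (hg₂ : g₂ ∈ SmoothNear ℝ p) (hg₃ : g₃ ∈ SmoothNear ℝ p)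
    (hg₄ : g₄ ∈ SmoothNear ℝ p) (j : Fin 2) :
    pd j (fun q => f₁ q * g₁ q + f₂ q * g₂ q - (f₃ q * g₃ q + f₄ q * g₄ q)) p =
      pd j (fun q => f₁ q * g₁ q) p + pd j (fun q => f₂ q * g₂ q) p
      - (pd j (fun q => f₃ q * g₃ q) p + pd j (fun q => f₄ q * g₄ q) p) := by
  have h1 := mul_mem' hf₁ hg₁
  have h2 := mul_mem' hf₂ hg₂
  have h3 := mul_mem' hf₃ hg₃
  have h4 := mul_mem' hf₄ hg₄
  rw [pd_sub (differentiableAt_of_mem (add_mem' h1 h2)) (differentiableAt_of_mem (add_mem' h3 h4)),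
    pd_add (differentiableAt_of_mem h1) (differentiableAt_of_mem h2),
    pd_add (differentiableAt_of_mem h3) (differentiableAt_of_mem h4)]

theorem pd_pd_bracket {f₁ f₂ f₃ f₄ g₁ g₂ g₃ g₄ : Plane → ℝ} (hf₁ : f₁ ∈ SmoothNear ℝ p)
    (hf₂ : f₂ ∈ SmoothNear ℝ p) (hf₃ : f₃ ∈ SmoothNear ℝ p) (hf₄ : f₄ ∈ SmoothNear ℝ p)
    (hg₁ : g₁ ∈ SmoothNear ℝ p) (hg₂ : g₂ ∈ SmoothNear ℝ p) (hg₃ : g₃ ∈ SmoothNear ℝ p)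
    (hg₄ : g₄ ∈ SmoothNear ℝ p) (j k : Fin 2) :
    pd k (pd j (fun q => f₁ q * g₁ q + f₂ q * g₂ q - (f₃ q * g₃ q + f₄ q * g₄ q))) p =
      pd k (pd j (fun q => f₁ q * g₁ q)) p + pd k (pd j (fun q => f₂ q * g₂ q)) p
      - (pd k (pd j (fun q => f₃ q * g₃ q)) p + pd k (pd j (fun q => f₄ q * g₄ q)) p) := by
  have e : pd j (fun q => f₁ q * g₁ q + f₂ q * g₂ q - (f₃ q * g₃ q + f₄ q * g₄ q)) =ᶠ[𝓝 p]
      fun q => pd j (fun q => f₁ q * g₁ q) q + pd j (fun q => f₂ q * g₂ q) q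
        - (pd j (fun q => f₃ q * g₃ q) q + pd j (fun q => f₄ q * g₄ q) q) := by
    filter_upwards [eventually_mem hf₁, eventually_mem hf₂, eventually_mem hf₃, eventually_mem hf₄,
      eventually_mem hg₁, eventually_mem hg₂, eventually_mem hg₃, eventually_mem hg₄]
      with q h1 h2 h3 h4 h5 h6 h7 h8 using pd_bracket h1 h2 h3 h4 h5 h6 h7 h8 j
  have h1 := pd_mem j (mul_mem' hf₁ hg₁)
  have h2 := pd_mem j (mul_mem' hf₂ hg₂)
  have h3 := pd_mem j (mul_mem' hf₃ hg₃)
  have h4 := pd_mem j (mul_mem' hf₄ hg₄)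
  rw [pd_congr e, pd_sub (differentiableAt_of_mem (add_mem' h1 h2))
    (differentiableAt_of_mem (add_mem' h3 h4)),
    pd_add (differentiableAt_of_mem h1) (differentiableAt_of_mem h2),
    pd_add (differentiableAt_of_mem h3) (differentiableAt_of_mem h4)]

theorem lieB_apply_self (X Y : SmoothNear Plane p) (i : Fin 2) : (lieB X Y).1 p i =
    X.1 p 0 * pd 0 Y.1 p i + X.1 p 1 * pd 1 Y.1 p i
      - (Y.1 p 0 * pd 0 X.1 p i + Y.1 p 1 * pd 1 X.1 p i) :=
  congrFun (lieB_apply X Y i) p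

theorem pd_lieB (X Y : SmoothNear Plane p) (i j : Fin 2) : pd j (lieB X Y).1 p i =
    pd j X.1 p 0 * pd 0 Y.1 p i + X.1 p 0 * pd j (pd 0 Y.1) p i
      + (pd j X.1 p 1 * pd 1 Y.1 p i + X.1 p 1 * pd j (pd 1 Y.1) p i)
      - (pd j Y.1 p 0 * pd 0 X.1 p i + Y.1 p 0 * pd j (pd 0 X.1) p i
      + (pd j Y.1 p 1 * pd 1 X.1 p i + Y.1 p 1 * pd j (pd 1 X.1) p i)) := by
  have hX := apply_mem X.2
  have hY := apply_mem Y.2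
  have hX1 := fun k i => apply_mem (pd_mem k X.2) i
  have hY1 := fun k i => apply_mem (pd_mem k Y.2) i
  have dX := differentiableAt_of_mem X.2
  have dY := differentiableAt_of_mem Y.2
  have dX1 := fun k => differentiableAt_of_mem (pd_mem k X.2)
  have dY1 := fun k => differentiableAt_of_mem (pd_mem k Y.2)
  rw [← pd_apply (differentiableAt_of_mem (lieB X Y).2), lieB_apply,
    pd_bracket (hX 0) (hX 1) (hY 0) (hY 1) (hY1 0 i) (hY1 1 i) (hX1 0 i) (hX1 1 i),
    pd_mul (differentiableAt_of_mem (hX 0)) (differentiableAt_of_mem (hY1 0 i)),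
    pd_mul (differentiableAt_of_mem (hX 1)) (differentiableAt_of_mem (hY1 1 i)),
    pd_mul (differentiableAt_of_mem (hY 0)) (differentiableAt_of_mem (hX1 0 i)),
    pd_mul (differentiableAt_of_mem (hY 1)) (differentiableAt_of_mem (hX1 1 i)),
    pd_apply dX, pd_apply dX, pd_apply dY, pd_apply dY, pd_apply (dX1 0), pd_apply (dX1 1),
    pd_apply (dY1 0), pd_apply (dY1 1)]

theorem pd_pd_lieB (X Y : SmoothNear Plane p) (i j k : Fin 2) : pd k (pd j (lieB X Y).1) p i =
    pd k (pd j X.1) p 0 * pd 0 Y.1 p i + pd j X.1 p 0 * pd k (pd 0 Y.1) p i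
      + (pd k X.1 p 0 * pd j (pd 0 Y.1) p i + X.1 p 0 * pd k (pd j (pd 0 Y.1)) p i)
      + (pd k (pd j X.1) p 1 * pd 1 Y.1 p i + pd j X.1 p 1 * pd k (pd 1 Y.1) p i
      + (pd k X.1 p 1 * pd j (pd 1 Y.1) p i + X.1 p 1 * pd k (pd j (pd 1 Y.1)) p i))
      - (pd k (pd j Y.1) p 0 * pd 0 X.1 p i + pd j Y.1 p 0 * pd k (pd 0 X.1) p i
      + (pd k Y.1 p 0 * pd j (pd 0 X.1) p i + Y.1 p 0 * pd k (pd j (pd 0 X.1)) p i)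
      + (pd k (pd j Y.1) p 1 * pd 1 X.1 p i + pd j Y.1 p 1 * pd k (pd 1 X.1) p i
      + (pd k Y.1 p 1 * pd j (pd 1 X.1) p i + Y.1 p 1 * pd k (pd j (pd 1 X.1)) p i))) := by
  have hX := apply_mem X.2
  have hY := apply_mem Y.2
  have hX1 := fun k i => apply_mem (pd_mem k X.2) i
  have hY1 := fun k i => apply_mem (pd_mem k Y.2) i
  have dX := differentiableAt_of_mem X.2
  have dY := differentiableAt_of_mem Y.2
  have dX1 := fun k => differentiableAt_of_mem (pd_mem k X.2)
  have dY1 := fun k => differentiableAt_of_mem (pd_mem k Y.2)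
  rw [← pd_pd_apply (lieB X Y).2, lieB_apply,
    pd_pd_bracket (hX 0) (hX 1) (hY 0) (hY 1) (hY1 0 i) (hY1 1 i) (hX1 0 i) (hX1 1 i),
    pd_pd_mul (hX 0) (hY1 0 i), pd_pd_mul (hX 1) (hY1 1 i), pd_pd_mul (hY 0) (hX1 0 i),
    pd_pd_mul (hY 1) (hX1 1 i)]
  simp only [pd_apply dX, pd_apply dY, pd_apply (dX1 _), pd_apply (dY1 _), pd_pd_apply X.2,
    pd_pd_apply Y.2, pd_pd_apply (pd_mem _ X.2), pd_pd_apply (pd_mem _ Y.2)]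

/-- The second derivatives of the bracket of two symmetry jets. -/
theorem pd_pd_lieB_eq {X Y : SmoothNear Plane p} {S : Plane → Fibre} (hS : S ∈ SmoothNear Fibre p)
    (hXp : X.1 p = ![1, 0]) (hYp : Y.1 p = ![0, 1])
    (hX : ∀ i, psi X.1 S p i = 0) (hX' : ∀ j i, pd j (psi X.1 S) p i = 0)
    (hY : ∀ i, psi Y.1 S p i = 0) (hY' : ∀ j i, pd j (psi Y.1 S) p i = 0)
    (hW : ∀ i, (lieB X Y).1 p i = 0) (hW' : ∀ j i, pd j (lieB X Y).1 p i = 0) :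
    pd 0 (pd 0 (lieB X Y).1) p = ![2 / 3 * F1 S p, 0] ∧
    pd 0 (pd 1 (lieB X Y).1) p = ![1 / 3 * F2 S p, 1 / 3 * F1 S p] ∧
    pd 1 (pd 1 (lieB X Y).1) p = ![0, 2 / 3 * F2 S p] := by
  have hX0 := hX 0
  have hX1 := hX 1
  have hX2 := hX 2
  have hX3 := hX 3
  have hX00 := hX' 0 0
  have hX01 := hX' 0 1
  have hX02 := hX' 0 2
  have hX03 := hX' 0 3
  have hX10 := hX' 1 0
  have hX11 := hX' 1 1
  have hX12 := hX' 1 2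
  have hX13 := hX' 1 3
  have hY0 := hY 0
  have hY1 := hY 1
  have hY2 := hY 2
  have hY3 := hY 3
  have hY00 := hY' 0 0
  have hY01 := hY' 0 1
  have hY02 := hY' 0 2
  have hY03 := hY' 0 3
  have hY10 := hY' 1 0
  have hY11 := hY' 1 1
  have hY12 := hY' 1 2
  have hY13 := hY' 1 3
  have hW0 := hW 0
  have hW1 := hW 1
  have hW00 := hW' 0 0
  have hW01 := hW' 0 1
  have hW10 := hW' 1 0
  have hW11 := hW' 1 1
  have cS := pd_comm hS
  have cX := pd_comm X.2
  have cY := pd_comm Y.2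
  have cX1 := fun k => pd_comm (pd_mem k X.2)
  have cY1 := fun k => pd_comm (pd_mem k Y.2)
  have cX2 := fun k => pd_congr (j := k) (pd_comm' X.2)
  have cY2 := fun k => pd_congr (j := k) (pd_comm' Y.2)
  have x0 : X.1 p 0 = 1 := by rw [hXp]; rfl
  have x1 : X.1 p 1 = 0 := by rw [hXp]; rfl
  have y0 : Y.1 p 0 = 0 := by rw [hYp]; rfl
  have y1 : Y.1 p 1 = 1 := by rw [hYp]; rfl
  simp only [pd_psi X.2 hS] at hX00 hX01 hX02 hX03 hX10 hX11 hX12 hX13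
  simp only [pd_psi Y.2 hS] at hY00 hY01 hY02 hY03 hY10 hY11 hY12 hY13
  simp only [psi, Matrix.cons_val, x0, x1] at hX0 hX1 hX2 hX3
  simp only [psi, Matrix.cons_val, y0, y1] at hY0 hY1 hY2 hY3
  simp only [Matrix.cons_val, cX2, cX1, cX, cS, x0, x1] at hX00 hX01 hX02 hX03 hX10 hX11 hX12 hX13
  simp only [Matrix.cons_val, cY2, cY1, cY, cS, y0, y1] at hY00 hY01 hY02 hY03 hY10 hY11 hY12 hY13
  simp only [pd_lieB, lieB_apply_self, cX, cY, x0, x1, y0, y1] at hW0 hW1 hW00 hW01 hW10 hW11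
  clear hX hX' hY hY' hW hW'
  have W : ∀ k j i, pd k (pd j (lieB X Y).1) p i = _ := fun k j i => pd_pd_lieB X Y i j k
  -- With `W = [X, Y]`, the shape of the answer reflects `ψ_W = 0` at `p`: as the 1-jet of `W`
  -- vanishes, this reads `W¹_xx = 0`, `W⁰_xx = 2 W¹_xy`, `W¹_yy = 2 W⁰_xy`, `W⁰_yy = 0`, where
  -- `W⁰`, `W¹` are the components. The combinations below eliminate third derivatives of `X`, `Y`
  -- by the derivatives of `ψ_X`, `ψ_Y`, and the lower ones by `ψ_X`, `ψ_Y` and the 1-jet of `W`.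
  refine ⟨funext fun i => ?_, funext fun i => ?_, funext fun i => ?_⟩ <;> rw [W] <;> clear W <;>
    fin_cases i <;>
    simp only [Fin.zero_eta, Fin.mk_one, Matrix.cons_val, F1, F2, cX2, cX1, cX, cY2, cY1, cY, x0,
      x1, y0, y1]
  · linear_combination (-1/3) * hX11 + (2/3) * hX02 - hY01 + 2 * hY10 + (4/3 * pd 0 X.1 p 0 + 1/3
      * S p 1 - 2/3 * pd 0 Y.1 p 1) * hW00 + (2 * pd 0 X.1 p 1 - 3 * S p 0) * hW10 + (2 *
      pd 0 Y.1 p 0) * hW01 + (-2/3 * S p 1 + 4/3 * pd 0 Y.1 p 1 - 2/3 * pd 0 X.1 p 0) * hW11 + (-2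
      * S p 0) * hY2 + (pd 1 Y.1 p 0 + 2 * S p 3) * hX0 + (pd 0 Y.1 p 0) * hX1 + (-2 *
      pd 0 X.1 p 1 + 4 * S p 0) * hX3 + (-2/3 * S p 1 + 4/3 * pd 0 Y.1 p 1 - 2/3 * pd 0 X.1 p 0) *
      hX2 + (-pd 1 X.1 p 0 - 2 * S p 2 - 2 * pd 0 Y.1 p 0) * hY0 + (-2/3 * pd 0 Y.1 p 1 + 1/3 *
      pd 0 X.1 p 0 + 4/3 * S p 1) * hY1 + (-pd 0 S p 1 + 2 * pd 1 S p 0 + 4/3 * S p 1 *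
      pd 0 X.1 p 0 - 4 * S p 0 * S p 2 + 2 * S p 2 * pd 0 X.1 p 1 - 4 * S p 0 * pd 0 Y.1 p 0 + 2 *
      S p 0 * pd 1 Y.1 p 1 - 8/3 * S p 1 * pd 0 Y.1 p 1 - 2 * pd 0 X.1 p 0 * pd 0 Y.1 p 1 - 2 *
      pd 0 X.1 p 1 * pd 1 Y.1 p 1 + 2 * pd 0 X.1 p 1 * pd 0 Y.1 p 0 + 2 * pd 0 Y.1 p 1 *
      pd 1 X.1 p 1 + 4/3 * S p 1 * S p 1) * hW0 + (1/3 * pd 1 S p 1 - 2/3 * pd 0 S p 2 - 6 * S p 0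
      * S p 3 + 2/3 * S p 1 * S p 2 - 2 * S p 0 * pd 1 Y.1 p 0 - 4/3 * S p 2 * pd 0 Y.1 p 1 + 2 *
      pd 0 X.1 p 1 * pd 1 Y.1 p 0 - 2 * pd 0 Y.1 p 1 * pd 1 X.1 p 0 + 4 * S p 3 * pd 0 X.1 p 1 +
      2/3 * S p 2 * pd 0 X.1 p 0) * hW1
  · linear_combination -hX10 + hY00 + (2 * S p 0) * hW00 + (S p 1) * hW01 + (-S p 0) * hW11 +
      (pd 1 Y.1 p 1 - 2 * pd 0 Y.1 p 0) * hX0 + (-pd 0 Y.1 p 1) * hX1 + (2 * pd 0 X.1 p 0 -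
      pd 1 X.1 p 1) * hY0 + (pd 0 X.1 p 1) * hY1 + (pd 0 S p 0) * hW0 + (pd 1 S p 0) * hW1
  · linear_combination hX03 + (1/3) * hY11 + (-2/3) * hY02 + (2/3 * pd 1 X.1 p 0 - 1/3 *
      pd 1 Y.1 p 1 + 1/3 * S p 2) * hW00 + (pd 1 X.1 p 1 - S p 1) * hW10 + (pd 1 Y.1 p 0) * hW01 +
      (-1/3 * pd 1 X.1 p 0 + 2/3 * pd 1 Y.1 p 1 - 2/3 * S p 2) * hW11 + (-pd 0 X.1 p 1 - S p 0) *
      hY3 + (pd 1 Y.1 p 0 + S p 3) * hX1 + (pd 0 Y.1 p 1 - pd 1 X.1 p 1 + S p 1) * hX3 + (-1/3 *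
      pd 1 X.1 p 0 + 2/3 * pd 1 Y.1 p 1 - 2/3 * S p 2) * hX2 + (-pd 1 Y.1 p 0 - 2 * S p 3) * hY0 +
      (-1/3 * pd 1 Y.1 p 1 + 1/3 * S p 2 - 1/3 * pd 1 X.1 p 0) * hY1 + (1/3 * pd 1 S p 1 - 2/3 *
      pd 0 S p 2 - pd 1 X.1 p 0 * pd 1 X.1 p 1 + 2/3 * S p 1 * pd 1 X.1 p 0 + S p 3 * pd 0 X.1 p 1
      - 3 * S p 0 * S p 3 - 2 * S p 0 * pd 1 Y.1 p 0 + pd 0 X.1 p 1 * pd 1 Y.1 p 0 - 1/3 * S p 1 *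
      pd 1 Y.1 p 1 + 1/3 * S p 1 * S p 2) * hW0 + (-pd 0 S p 3 + pd 1 X.1 p 0 * pd 1 X.1 p 0 -
      S p 3 * pd 0 X.1 p 0 + 4/3 * S p 2 * pd 1 X.1 p 0 - S p 1 * pd 1 Y.1 p 0 - pd 0 X.1 p 0 *
      pd 1 Y.1 p 0 + pd 1 X.1 p 1 * pd 1 Y.1 p 0 - 2 * S p 1 * S p 3 + 2 * S p 3 * pd 1 X.1 p 1 -
      2/3 * S p 2 * pd 1 Y.1 p 1 - pd 1 X.1 p 0 * pd 1 Y.1 p 1 + 2/3 * S p 2 * S p 2) * hW1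
  · linear_combination (-2/3) * hX11 + (1/3) * hX02 + hY10 + (pd 0 X.1 p 1) * hW10 + (pd 0 Y.1 p 0
      + S p 2) * hW01 + (-1/3 * pd 0 X.1 p 0 - 1/3 * S p 1 + 2/3 * pd 0 Y.1 p 1) * hW11 +
      (pd 0 X.1 p 1 - S p 0) * hY2 + (-pd 1 Y.1 p 0 + S p 3) * hX0 + (-pd 0 X.1 p 1 + 2 * S p 0) *
      hX3 + (-1/3 * pd 0 Y.1 p 1 - 1/3 * pd 0 X.1 p 0 - 1/3 * S p 1) * hX2 + (-pd 0 Y.1 p 0 -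
      S p 2 + pd 1 X.1 p 0) * hY0 + (-1/3 * pd 0 Y.1 p 1 + 2/3 * pd 0 X.1 p 0 + 2/3 * S p 1) * hY1
      + (-1/3 * pd 0 Y.1 p 1 + 2/3 * pd 0 X.1 p 0 + 2/3 * S p 1) * hW00 + (pd 1 S p 0 - 2 * S p 0
      * pd 0 Y.1 p 0 + S p 0 * pd 1 Y.1 p 1 - 4/3 * S p 1 * pd 0 Y.1 p 1 - pd 0 X.1 p 0 *
      pd 0 Y.1 p 1 - pd 0 X.1 p 1 * pd 1 Y.1 p 1 + pd 0 X.1 p 1 * pd 0 Y.1 p 0 + pd 0 Y.1 p 1 *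
      pd 1 X.1 p 1 - 2 * S p 0 * S p 2 + S p 2 * pd 0 X.1 p 1 + 2/3 * S p 1 * pd 0 X.1 p 0 + 2/3 *
      S p 1 * S p 1) * hW0 + (2/3 * pd 1 S p 1 - 3 * S p 0 * S p 3 - 1/3 * pd 0 S p 2 + 1/3 *
      S p 1 * S p 2 + 1/3 * S p 2 * pd 0 X.1 p 0 - S p 0 * pd 1 Y.1 p 0 - 2/3 * S p 2 *
      pd 0 Y.1 p 1 + pd 0 X.1 p 1 * pd 1 Y.1 p 0 - pd 0 Y.1 p 1 * pd 1 X.1 p 0 + 2 * S p 3 *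
      pd 0 X.1 p 1) * hW1
  · linear_combination hX13 - hY03 + (S p 3) * hW00 + (-S p 2) * hW10 + (-2 * S p 3) * hW11 +
      (-pd 1 X.1 p 0) * hY2 + (-2 * pd 1 X.1 p 1 + pd 0 X.1 p 0) * hY3 + (-pd 0 Y.1 p 0 + 2 *
      pd 1 Y.1 p 1) * hX3 + (pd 1 Y.1 p 0) * hX2 + (-pd 0 S p 3) * hW0 + (-pd 1 S p 3) * hW1
  · linear_combination -hX12 + (2/3) * hY11 + (-1/3) * hY02 + (3 * S p 3 + 2 * pd 1 Y.1 p 0) *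
      hW01 + (-2/3 * pd 1 X.1 p 0 - 1/3 * S p 2 + 4/3 * pd 1 Y.1 p 1) * hW11 + (pd 1 X.1 p 1) *
      hY2 + (pd 0 X.1 p 1 - 2 * S p 0) * hY3 + (-pd 0 Y.1 p 1 + 2 * S p 1 - 2 * pd 1 X.1 p 1) *
      hX3 + (1/3 * pd 1 Y.1 p 1 - 2/3 * pd 1 X.1 p 0 - 4/3 * S p 2) * hX2 + (-2 * pd 1 Y.1 p 0 - 4
      * S p 3) * hY0 + (-2/3 * pd 1 Y.1 p 1 + 4/3 * pd 1 X.1 p 0 + 2/3 * S p 2) * hY1 + (-2/3 *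
      pd 1 Y.1 p 1 + 4/3 * pd 1 X.1 p 0 + 2/3 * S p 2) * hW00 + (2/3 * pd 1 S p 1 - 1/3 *
      pd 0 S p 2 + 2 * S p 3 * pd 0 X.1 p 1 - 6 * S p 0 * S p 3 - 4 * S p 0 * pd 1 Y.1 p 0 + 2 *
      pd 0 X.1 p 1 * pd 1 Y.1 p 0 - 2/3 * S p 1 * pd 1 Y.1 p 1 + 4/3 * S p 1 * pd 1 X.1 p 0 - 2 *
      pd 1 X.1 p 0 * pd 1 X.1 p 1 + 2/3 * S p 1 * S p 2) * hW0 + (pd 1 S p 2 - 2 * pd 0 S p 3 - 2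
      * S p 3 * pd 0 X.1 p 0 + 2 * pd 1 X.1 p 0 * pd 1 X.1 p 0 + 8/3 * S p 2 * pd 1 X.1 p 0 - 2 *
      S p 1 * pd 1 Y.1 p 0 - 2 * pd 0 X.1 p 0 * pd 1 Y.1 p 0 + 2 * pd 1 X.1 p 1 * pd 1 Y.1 p 0 - 4
      * S p 1 * S p 3 + 4 * S p 3 * pd 1 X.1 p 1 - 4/3 * S p 2 * pd 1 Y.1 p 1 - 2 * pd 1 X.1 p 0 *
      pd 1 Y.1 p 1 + 4/3 * S p 2 * S p 2) * hW1 + 2 * hX03 + (2 * pd 1 X.1 p 1) * hW10 + (2 *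
      S p 3) * hX1

end

end CubicODE

end

/-! ### Jets in terms of partial derivatives, and construction of symmetry jets. -/

noncomputable section

namespace CubicODE

section

variable {p : Plane}

theorem jet_eq_zero_iff {F : Type} [NormedAddCommGroup F] [NormedSpace ℝ F] {k : ℕ}
    (f : SmoothNear F p) : jet k f = 0 ↔ f ∈ vanishing F p k :=
  Submodule.Quotient.mk_eq_zero _

theorem jet_one_eq_zero_iff {F : Type} [NormedAddCommGroup F] [NormedSpace ℝ F]
    (f : SmoothNear F p) : jet 1 f = 0 ↔ f.1 p = 0 ∧ ∀ j, pd j f.1 p = 0 := by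
  rw [jet_eq_zero_iff, mem_vanishing_succ]
  simp only [mem_vanishing_zero]

theorem jet_two_eq_zero_iff {F : Type} [NormedAddCommGroup F] [NormedSpace ℝ F]
    (f : SmoothNear F p) : jet 2 f = 0 ↔
      f.1 p = 0 ∧ ∀ j, pd j f.1 p = 0 ∧ ∀ k, pd k (pd j f.1) p = 0 := by
  rw [jet_eq_zero_iff, mem_vanishing_succ]
  simp only [mem_vanishing_succ, mem_vanishing_zero]

theorem eq_of_jet_two_eq {F : Type} [NormedAddCommGroup F] [NormedSpace ℝ F]
    {f g : SmoothNear F p} (h : jet 2 f = jet 2 g) :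
    f.1 p = g.1 p ∧ ∀ j, pd j f.1 p = pd j g.1 p ∧ ∀ k, pd k (pd j f.1) p = pd k (pd j g.1) p := by
  have h' : jet 2 (f - g) = 0 := sub_eq_zero.2 h
  obtain ⟨h0, h1⟩ := (jet_two_eq_zero_iff _).1 h'
  have e1 : ∀ j, pd j (f - g).1 =ᶠ[𝓝 p] fun q => pd j f.1 q - pd j g.1 q := fun j => by
    filter_upwards [eventually_mem f.2, eventually_mem g.2] with q hf hg
    exact pd_sub (differentiableAt_of_mem hf) (differentiableAt_of_mem hg)
  refine ⟨sub_eq_zero.1 h0, fun j => ⟨?_, fun k => ?_⟩⟩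
  · have := (h1 j).1
    rw [(e1 j).self_of_nhds] at this
    exact sub_eq_zero.1 this
  · have := (h1 j).2 k
    rw [pd_congr (e1 j), pd_sub (differentiableAt_of_mem (pd_mem j f.2))
      (differentiableAt_of_mem (pd_mem j g.2))] at this
    exact sub_eq_zero.1 this

/-- The vector fields with `X^{(k)}` tangent to the image of `j_k S` are those with
`j_p^k ψ_X = 0`. -/
theorem liftVF_mem_tangentK_iff {k : ℕ} (X : SmoothNear Plane p) (S : SmoothNear Fibre p) :
    liftVF k X S ∈ tangentK k S ↔ jet k (psiGerm X S) = 0 := by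
  have h0 : X.1 p 0 • totalD k S 0 + X.1 p 1 • totalD k S 1 ∈ tangentK k S :=
    add_mem (Submodule.smul_mem _ _ (Submodule.subset_span (by simp)))
      (Submodule.smul_mem _ _ (Submodule.subset_span (by simp)))
  rw [liftVF, Submodule.add_mem_iff_right _ h0, tangentK, Submodule.mem_span_pair]
  constructor
  · rintro ⟨c, d, h⟩
    have h1 := congrArg Prod.fst h
    have h2 := congrArg Prod.snd h
    have hc : c = 0 := by simpa [totalD] using congrFun h1 0
    have hd : d = 0 := by simpa [totalD] using congrFun h1 1
    rw [← show _ = jet k (psiGerm X S) from h2, hc, hd]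
    simp
  · intro h
    exact ⟨0, 0, by rw [h, zero_smul, zero_smul, add_zero]; rfl⟩

/-- `spaceA` provides some section with the given 2-jet. The 1-jet of `ψ_X` sees only this 2-jet, so
the section may be replaced by the given `S`. -/
theorem exists_of_mem_spaceA {S : SmoothNear Fibre p} {ξ : Jet Plane p 3}
    (h : ξ ∈ spaceA 1 (jet 2 S)) : ∃ X : SmoothNear Plane p, jet 3 X = ξ ∧
      (∀ i, psi X.1 S.1 p i = 0) ∧ ∀ j i, pd j (psi X.1 S.1) p i = 0 := by
  obtain ⟨X, S', hX, hS, hl⟩ := h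
  obtain ⟨e0, e⟩ := eq_of_jet_two_eq hS
  have e1 := fun j => (e j).1
  have e2 := fun j => (e j).2
  rw [liftVF_mem_tangentK_iff, jet_one_eq_zero_iff] at hl
  obtain ⟨h0, h1⟩ := hl
  change psi X.1 S'.1 p = 0 at h0
  change ∀ j, pd j (psi X.1 S'.1) p = 0 at h1
  have E0 : psi X.1 S'.1 p = psi X.1 S.1 p := by
    simp only [psi, e0, e1]
  have E1 : ∀ j, pd j (psi X.1 S'.1) p = pd j (psi X.1 S.1) p := fun j => by
    simp only [pd_psi X.2 S'.2, pd_psi X.2 S.2, e0, e1, e2]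
  exact ⟨X, hX, fun i => by rw [← E0, h0]; rfl, fun j i => by rw [← E1, h1]; rfl⟩

/-- `ψ_X` is linear in `X`. Hence the span of two jets whose deformation velocities have zero 1-jet
lies in `spaceA`, which is defined only as a set. -/
theorem jet_psiGerm_add_smul (c d : ℝ) (k : ℕ) (X Y : SmoothNear Plane p) (S : SmoothNear Fibre p) :
    jet k (psiGerm (c • X + d • Y) S) = c • jet k (psiGerm X S) + d • jet k (psiGerm Y S) := by
  refine jet_eq_of_eventuallyEq (g := c • psiGerm X S + d • psiGerm Y S) ?_ k
  have e1 : ∀ {f g : Plane → Plane} {q : Plane} (j : Fin 2), f ∈ SmoothNear Plane q →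
      g ∈ SmoothNear Plane q → pd j (c • f + d • g) q = c • pd j f q + d • pd j g q := by
    intro f g q j hf hg
    have hf' := differentiableAt_of_mem hf
    have hg' := differentiableAt_of_mem hg
    simp only [pd]
    rw [fderiv_add (hf'.const_smul c) (hg'.const_smul d), fderiv_const_smul hf', fderiv_const_smul
        hg']
    rfl
  filter_upwards [eventually_mem X.2, eventually_mem Y.2] with q hX hY
  have e1' : ∀ j, pd j (c • X.1 + d • Y.1) =ᶠ[𝓝 q] c • pd j X.1 + d • pd j Y.1 := fun j => by
    filter_upwards [eventually_mem hX, eventually_mem hY] with r h1 h2 using e1 j h1 h2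
  have e2 : ∀ j l, pd l (pd j (c • X.1 + d • Y.1)) q =
      c • pd l (pd j X.1) q + d • pd l (pd j Y.1) q := fun j l => by
    rw [pd_congr (e1' j), e1 l (pd_mem j hX) (pd_mem j hY)]
  change psi (c • X.1 + d • Y.1) S.1 q = c • psi X.1 S.1 q + d • psi Y.1 S.1 q
  funext i
  fin_cases i <;>
    simp only [psi, e2, e1 _ hX hY, Pi.add_apply, Pi.smul_apply, smul_eq_mul, Fin.zero_eta,
      Fin.mk_one, Fin.reduceFinMk, Matrix.cons_val] <;>
    ring

/-! ### Vector fields with prescribed jets -/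

/-- The cubic polynomial with prescribed 3-jet at `p`. -/
def taylorCubic (p : Plane) (c cx cy cxx cxy cyy cxxx cxxy cxyy cyyy : ℝ) : Plane → ℝ := fun q =>
  c + (cx * (q 0 - p 0) + cy * (q 1 - p 1)
    + (cxx / 2 * ((q 0 - p 0) * (q 0 - p 0)) + cxy * ((q 0 - p 0) * (q 1 - p 1))
      + cyy / 2 * ((q 1 - p 1) * (q 1 - p 1)))
    + (cxxx / 6 * ((q 0 - p 0) * ((q 0 - p 0) * (q 0 - p 0)))
      + cxxy / 2 * ((q 0 - p 0) * ((q 0 - p 0) * (q 1 - p 1)))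
      + (cxyy / 2 * ((q 0 - p 0) * ((q 1 - p 1) * (q 1 - p 1)))
      + cyyy / 6 * ((q 1 - p 1) * ((q 1 - p 1) * (q 1 - p 1))))))

section

variable {c cx cy cxx cxy cyy cxxx cxxy cxyy cyyy : ℝ}

theorem taylorCubic_mem {q : Plane} :
    taylorCubic p c cx cy cxx cxy cyy cxxx cxxy cxyy cyyy ∈ SmoothNear ℝ q := by
  refine Filter.Eventually.of_forall fun x => ContDiff.contDiffAt ?_
  unfold taylorCubic
  fun_prop

theorem taylorCubic_self : taylorCubic p c cx cy cxx cxy cyy cxxx cxxy cxyy cyyy p = c := by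
  simp [taylorCubic]

theorem pd_coord_sub (j i : Fin 2) (c : ℝ) (q : Plane) :
    pd j (fun x : Plane => x i - c) q = if i = j then 1 else 0 := by
  rw [pd, fderiv_sub_const]
  rw [show (fun x : Plane => x i) = (ContinuousLinearMap.proj i : Plane →L[ℝ] ℝ) from rfl,
    ContinuousLinearMap.fderiv]
  simp [Pi.single_apply]

theorem pd_zero_taylorCubic : pd 0 (taylorCubic p c cx cy cxx cxy cyy cxxx cxxy cxyy cyyy) =
    taylorCubic p cx cxx cxy cxxx cxxy cxyy 0 0 0 0 := by
  funext q
  unfold taylorCubic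
  simp (disch := fun_prop) only [pd_add, pd_mul, pd_const, pd_coord_sub]
  simp
  ring

theorem pd_one_taylorCubic : pd 1 (taylorCubic p c cx cy cxx cxy cyy cxxx cxxy cxyy cyyy) =
    taylorCubic p cy cxy cyy cxxy cxyy cyyy 0 0 0 0 := by
  funext q
  unfold taylorCubic
  simp (disch := fun_prop) only [pd_add, pd_mul, pd_const, pd_coord_sub]
  simp
  ring

end

/-- Every value extends to a 3-jet of a vector field with zero derivatives, for which the 1-jet
of the deformation velocity vanishes. -/
theorem exists_symmetry_jet {S : Plane → Fibre} (hS : S ∈ SmoothNear Fibre p) (v : Plane) :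
    ∃ X : SmoothNear Plane p, X.1 p = v ∧ (∀ j, pd j X.1 p = 0) ∧ jet 1 (psiGerm X ⟨S, hS⟩) = 0 ∧
      pd 0 (pd 0 X.1) p = ![(2 * pd 1 S p 0 - pd 0 S p 1) * v 0
          + (pd 1 S p 1 - 2 * pd 0 S p 2) / 3 * v 1, pd 0 S p 0 * v 0 + pd 1 S p 0 * v 1] ∧
      pd 0 (pd 1 X.1) p = ![(pd 1 S p 1 - 2 * pd 0 S p 2) / 3 * v 0 - pd 0 S p 3 * v 1,
          pd 1 S p 0 * v 0 + (2 * pd 1 S p 1 - pd 0 S p 2) / 3 * v 1] ∧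
      pd 1 (pd 1 X.1) p = ![-(pd 0 S p 3 * v 0) - pd 1 S p 3 * v 1,
          (2 * pd 1 S p 1 - pd 0 S p 2) / 3 * v 0 + (pd 1 S p 2 - 2 * pd 0 S p 3) * v 1] := by
  -- With zero first derivatives, `ψ_X = 0` is four equations for the six second derivatives. The
  -- two left free are fixed by requiring, for the fields `X`, `Y` with values `∂_x`, `∂_y`, that
  -- `X_xy = Y_xx` and `X_yy = Y_xy`. The numbers `m`, `n` solve `-m + 2n = ∂_y a¹`, `-2m + n = ∂_x
  -- a²`, with `S = (a⁰, a¹, a², a³)`.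
  obtain ⟨m, hm⟩ : ∃ m, m = (pd 1 S p 1 - 2 * pd 0 S p 2) / 3 := ⟨_, rfl⟩
  obtain ⟨n, hn⟩ : ∃ n, n = (2 * pd 1 S p 1 - pd 0 S p 2) / 3 := ⟨_, rfl⟩
  obtain ⟨X0xx, hX0xx⟩ : ∃ t, t = (2 * pd 1 S p 0 - pd 0 S p 1) * v 0 + m * v 1 := ⟨_, rfl⟩
  obtain ⟨X0xy, hX0xy⟩ : ∃ t, t = m * v 0 - pd 0 S p 3 * v 1 := ⟨_, rfl⟩
  obtain ⟨X0yy, hX0yy⟩ : ∃ t, t = -(pd 0 S p 3 * v 0) - pd 1 S p 3 * v 1 := ⟨_, rfl⟩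
  obtain ⟨X1xx, hX1xx⟩ : ∃ t, t = pd 0 S p 0 * v 0 + pd 1 S p 0 * v 1 := ⟨_, rfl⟩
  obtain ⟨X1xy, hX1xy⟩ : ∃ t, t = pd 1 S p 0 * v 0 + n * v 1 := ⟨_, rfl⟩
  obtain ⟨X1yy, hX1yy⟩ : ∃ t, t = n * v 0 + (pd 1 S p 2 - 2 * pd 0 S p 3) * v 1 := ⟨_, rfl⟩
  obtain ⟨D, hD⟩ : ∃ D : Fin 2 → Fin 4 → ℝ,
    ∀ j i, D j i = pd j (pd 0 S) p i * v 0 + pd j (pd 1 S) p i * v 1 := ⟨_, fun _ _ => rfl⟩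
  -- The derivatives of `ψ_X` give eight equations for the eight third derivatives of `X`, with the
  -- terms of lower order collected in the `R`'s. The system is uniquely solvable, and its solution
  -- is the last four arguments of each `taylorCubic` below.
  obtain ⟨R0x, hR0x⟩ : ∃ t, t = D 0 0 + 2 * S p 0 * X0xx - S p 0 * X1xy + S p 1 * X1xx := ⟨_, rfl⟩
  obtain ⟨R0y, hR0y⟩ : ∃ t, t = D 1 0 + 2 * S p 0 * X0xy - S p 0 * X1yy + S p 1 * X1xy := ⟨_, rfl⟩
  obtain ⟨R1x, hR1x⟩ : ∃ t, t = D 0 1 + 3 * S p 0 * X0xy + S p 1 * X0xx + 2 * S p 2 * X1xx :=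
    ⟨_, rfl⟩
  obtain ⟨R1y, hR1y⟩ : ∃ t, t = D 1 1 + 3 * S p 0 * X0yy + S p 1 * X0xy + 2 * S p 2 * X1xy :=
    ⟨_, rfl⟩
  obtain ⟨R2x, hR2x⟩ : ∃ t, t = D 0 2 + 2 * S p 1 * X0xy + S p 2 * X1xy + 3 * S p 3 * X1xx :=
    ⟨_, rfl⟩
  obtain ⟨R2y, hR2y⟩ : ∃ t, t = D 1 2 + 2 * S p 1 * X0yy + S p 2 * X1yy + 3 * S p 3 * X1xy :=
    ⟨_, rfl⟩
  obtain ⟨R3x, hR3x⟩ : ∃ t, t = -(D 0 3 + S p 2 * X0xy - S p 3 * X0xx + 2 * S p 3 * X1xy) :=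
    ⟨_, rfl⟩
  obtain ⟨R3y, hR3y⟩ : ∃ t, t = -(D 1 3 + S p 2 * X0yy - S p 3 * X0xy + 2 * S p 3 * X1yy) :=
    ⟨_, rfl⟩
  obtain ⟨X, hX⟩ : ∃ X : Plane → Plane, X = fun q =>
    ![taylorCubic p (v 0) 0 0 X0xx X0xy X0yy (2 * R0y - R1x) ((R1y - 2 * R2x) / 3) R3x R3y q,
      taylorCubic p (v 1) 0 0 X1xx X1xy X1yy R0x R0y ((2 * R1y - R2x) / 3) (R2y + 2 * R3x) q] :=
    ⟨_, rfl⟩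
  have hm' : X ∈ SmoothNear Plane p := by
    refine pi_mem fun i => ?_
    rw [hX]
    fin_cases i <;> exact taylorCubic_mem
  have c0 : (fun q => X q 0) = taylorCubic p (v 0) 0 0 X0xx X0xy X0yy (2 * R0y - R1x)
      ((R1y - 2 * R2x) / 3) R3x R3y := by rw [hX]; rfl
  have c1 : (fun q => X q 1) = taylorCubic p (v 1) 0 0 X1xx X1xy X1yy R0x R0y
      ((2 * R1y - R2x) / 3) (R2y + 2 * R3x) := by rw [hX]; rfl
  have d0 : ∀ i, X p i = v i := fun i => by
    rw [hX]; fin_cases i <;> exact taylorCubic_self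
  have d1 : ∀ j i, pd j X p i = pd j (fun q => X q i) p := fun j i =>
    (pd_apply (differentiableAt_of_mem hm') i).symm
  have d2 : ∀ k j i, pd k (pd j X) p i = pd k (pd j (fun q => X q i)) p := fun k j i =>
    (pd_pd_apply hm' j i).symm
  have d3 : ∀ l k j i, pd l (pd k (pd j X)) p i = pd l (pd k (pd j (fun q => X q i))) p :=
    fun l k j i => by
      rw [← pd_pd_apply (pd_mem j hm'), pd_congr (pd_congr' (pd_apply' hm' i))]
  refine ⟨⟨X, hm'⟩, funext d0, fun j => funext fun i => ?_, ?_, ?_, ?_, ?_⟩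
  · fin_cases j <;> fin_cases i <;>
      simp only [Fin.zero_eta, Fin.mk_one, d1, c0, c1, pd_zero_taylorCubic, pd_one_taylorCubic,
        taylorCubic_self, Pi.zero_apply]
  · rw [jet_one_eq_zero_iff]
    constructor
    · change psi X S p = 0
      funext i
      fin_cases i <;>
        simp only [psi, Fin.zero_eta, Fin.mk_one, Fin.reduceFinMk, Matrix.cons_val, d0, d1, d2, c0,
          c1, pd_zero_taylorCubic, pd_one_taylorCubic, taylorCubic_self, Pi.zero_apply, hX0xx,
          hX0xy, hX0yy, hX1xx, hX1xy, hX1yy, hm, hn] <;> ring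
    · intro j
      change pd j (psi X S) p = 0
      rw [pd_psi hm' hS]
      funext i
      fin_cases j <;> fin_cases i <;>
        simp only [Fin.zero_eta, Fin.mk_one, Fin.reduceFinMk, Matrix.cons_val, d0, d1, d2, d3, c0,
          c1, pd_zero_taylorCubic, pd_one_taylorCubic, taylorCubic_self, Pi.zero_apply, hR0x,
          hR0y, hR1x, hR1y, hR2x, hR2y, hR3x, hR3y, hD] <;> ring
  all_goals
    funext i
    change pd _ (pd _ X) p i = _
    fin_cases i <;>
      simp only [Fin.zero_eta, Fin.mk_one, Matrix.cons_val, d2, c0, c1, pd_zero_taylorCubic,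
        pd_one_taylorCubic, taylorCubic_self, hX0xx, hX0xy, hX0yy, hX1xx, hX1xy, hX1yy, hm, hn]

end

end CubicODE

end

/-! ### The form `ω_H` of a special subspace, and existence of special subspaces. -/

noncomputable section

namespace CubicODE

section

variable {p : Plane}

theorem bracket_self (m : ℕ) (ξ : Jet Plane p (m + 1)) : bracket m ξ ξ = 0 := by
  obtain ⟨X, rfl⟩ := Submodule.Quotient.mk_surjective _ ξ
  change jet m (lieB X X) = 0
  rw [show lieB X X = 0 from Subtype.ext (funext fun q => sub_self _)]
  rfl

theorem bracket_swap (m : ℕ) (ξ η : Jet Plane p (m + 1)) : bracket m ξ η = -bracket m η ξ := by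
  obtain ⟨X, rfl⟩ := Submodule.Quotient.mk_surjective _ ξ
  obtain ⟨Y, rfl⟩ := Submodule.Quotient.mk_surjective _ η
  change jet m (lieB X Y) = -jet m (lieB Y X)
  rw [lieB_swap, jet_neg]

/-- On a two-dimensional `H` the alternating bracket is determined by its value on a basis, so `ω_H`
amounts to a single jet. -/
theorem bracket_comb (m : ℕ) (ξ η : Jet Plane p (m + 1)) (c d c' d' : ℝ) :
    bracket m (c • ξ + d • η) (c' • ξ + d' • η) = (c * d' - d * c') • bracket m ξ η := by
  simp only [map_add, map_smul, LinearMap.add_apply, LinearMap.smul_apply,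
    bracket_self, bracket_swap m η ξ]
  module

theorem horizontalLift_mem {k : ℕ} {θ : Jet Fibre p (k + 1)}
    {H : Submodule ℝ (Jet Plane p (k + 2))} (hH : IsHorizontal k θ H) (v : Plane) :
    horizontalLift hH v ∈ H :=
  ((LinearEquiv.ofBijective _ hH.bijective).symm v).2

theorem value_horizontalLift {k : ℕ} {θ : Jet Fibre p (k + 1)}
    {H : Submodule ℝ (Jet Plane p (k + 2))} (hH : IsHorizontal k θ H) (v : Plane) :
    value (F := Plane) (p := p) (k + 2) (horizontalLift hH v) = v :=
  (LinearEquiv.ofBijective _ hH.bijective).apply_symm_apply v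

theorem omegaH_eq_zero_iff {k : ℕ} {θ : Jet Fibre p (k + 1)}
    {H : Submodule ℝ (Jet Plane p (k + 2))} (hH : IsHorizontal k θ H) :
    omegaH hH = 0 ↔
      bracket (k + 1) (horizontalLift hH ![1, 0]) (horizontalLift hH ![0, 1]) = 0 := by
  refine ⟨fun h => ?_, fun h => LinearMap.ext fun v => LinearMap.ext fun w => ?_⟩
  · exact LinearMap.congr_fun (LinearMap.congr_fun h ![1, 0]) ![0, 1]
  · have e : ∀ u : Plane, horizontalLift hH u =
        u 0 • horizontalLift hH ![1, 0] + u 1 • horizontalLift hH ![0, 1] := fun u => by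
      rw [← map_smul, ← map_smul, ← map_add]
      congr 1
      ext i; fin_cases i <;> simp
    change bracket (k + 1) (horizontalLift hH v) (horizontalLift hH w) = 0
    rw [e v, e w, bracket_comb, h, smul_zero]

/-- For a special subspace `H` the 2-form `ω_H` is given by `F¹` and `F²`. -/
theorem omegaH_eq_zero_iff_F {S : Plane → Fibre} (hS : S ∈ SmoothNear Fibre p)
    {H : Submodule ℝ (Jet Plane p 3)} (hH : IsSpecial (jet 2 ⟨S, hS⟩) H) :
    omegaH hH.horizontal = 0 ↔ F1 S p = 0 ∧ F2 S p = 0 := by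
  have mX := horizontalLift_mem hH.horizontal ![1, 0]
  have mY := horizontalLift_mem hH.horizontal ![0, 1]
  obtain ⟨X, eX, hX, hX'⟩ := exists_of_mem_spaceA (hH.horizontal.subset mX)
  obtain ⟨Y, eY, hY, hY'⟩ := exists_of_mem_spaceA (hH.horizontal.subset mY)
  have hXp : X.1 p = ![1, 0] := by
    have := value_horizontalLift hH.horizontal ![1, 0]
    rwa [← eX] at this
  have hYp : Y.1 p = ![0, 1] := by
    have := value_horizontalLift hH.horizontal ![0, 1]
    rwa [← eY] at this
  have hb := hH.bracket_eq_zero _ mX _ mY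
  rw [omegaH_eq_zero_iff]
  rw [← eX, ← eY] at hb ⊢
  change jet 1 (lieB X Y) = 0 at hb
  change jet 2 (lieB X Y) = 0 ↔ _
  rw [jet_one_eq_zero_iff] at hb
  obtain ⟨hW, hW'⟩ := hb
  obtain ⟨e1, e2, e3⟩ := pd_pd_lieB_eq hS hXp hYp hX hX' hY hY' (congrFun hW)
    (fun j => congrFun (hW' j))
  rw [jet_two_eq_zero_iff]
  constructor
  -- Two entries suffice: `F¹` is read off from the first component of the `xx`-derivative, `F²`
  -- from the second component of the `yy`-derivative.
  · rintro ⟨-, h⟩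
    have h1 := congrFun (e1.symm.trans ((h 0).2 0)) 0
    have h2 := congrFun (e3.symm.trans ((h 1).2 1)) 1
    simpa using And.intro h1 h2
  · rintro ⟨h1, h2⟩
    have z : ![(0 : ℝ), 0] = 0 := by ext i; fin_cases i <;> rfl
    simp only [h1, h2, mul_zero, z] at e1 e2 e3
    refine ⟨hW, fun j => ⟨hW' j, fun k => ?_⟩⟩
    fin_cases j <;> fin_cases k
    · exact e1
    · exact (pd_comm (lieB X Y).2).trans e2
    · exact e2
    · exact e3

/-- The span of two symmetry jets with values `∂_x` and `∂_y` serves. It is horizontal since these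
values form a basis of `T_p`. -/
theorem exists_isSpecial {S : Plane → Fibre} (hS : S ∈ SmoothNear Fibre p) :
    ∃ H : Submodule ℝ (Jet Plane p 3), IsSpecial (jet 2 ⟨S, hS⟩) H := by
  obtain ⟨X, hX, hX1, hXs, hXxx, hXxy, hXyy⟩ := exists_symmetry_jet hS ![1, 0]
  obtain ⟨Y, hY, hY1, hYs, hYxx, hYxy, hYyy⟩ := exists_symmetry_jet hS ![0, 1]
  have hv : ∀ c d : ℝ, value (F := Plane) (p := p) 3 (c • jet 3 X + d • jet 3 Y) = ![c, d] :=
      fun c d => by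
    change c • X.1 p + d • Y.1 p = _
    rw [hX, hY]
    ext i; fin_cases i <;> simp
  have hb : jet 1 (lieB X Y) = 0 := by
    rw [jet_one_eq_zero_iff]
    constructor
    · funext i
      rw [lieB_apply_self, hX1, hX1, hY1, hY1]
      simp
    · intro j
      funext i
      -- As first derivatives vanish, `∂_j [X, Y] = ∂_j ∂_x Y - ∂_j ∂_y X` at `p`, which is zero by
      -- the choice of second derivatives in `exists_symmetry_jet`.
      rw [pd_lieB, hX1, hX1, hX1, hY1, hY1, hY1, hX, hY]
      fin_cases j <;> fin_cases i <;>
        simp [pd_comm X.2, pd_comm Y.2, hXxx, hXxy, hXyy, hYxx, hYxy, hYyy]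
  refine ⟨Submodule.span ℝ {jet 3 X, jet 3 Y}, ⟨⟨?_, ?_, ?_⟩, ?_⟩⟩
  · intro ξ hξ
    obtain ⟨c, d, rfl⟩ := Submodule.mem_span_pair.1 hξ
    refine ⟨c • X + d • Y, ⟨S, hS⟩, rfl, rfl, ?_⟩
    rw [liftVF_mem_tangentK_iff, jet_psiGerm_add_smul, hXs, hYs, smul_zero, smul_zero, add_zero]
  · rw [injective_iff_map_eq_zero]
    rintro ⟨ξ, hξ⟩ h
    obtain ⟨c, d, rfl⟩ := Submodule.mem_span_pair.1 hξ
    have h' : ![c, d] = 0 := (hv c d).symm.trans h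
    have hc : c = 0 := congrFun h' 0
    have hd : d = 0 := congrFun h' 1
    apply Subtype.ext
    simp [hc, hd]
  · intro v
    refine ⟨⟨_, Submodule.mem_span_pair.2 ⟨v 0, v 1, rfl⟩⟩, (hv _ _).trans ?_⟩
    ext i; fin_cases i <;> rfl
  · intro ξ hξ η hη
    obtain ⟨c, d, rfl⟩ := Submodule.mem_span_pair.1 hξ
    obtain ⟨c', d', rfl⟩ := Submodule.mem_span_pair.1 hη
    rw [bracket_comb, map_smul]
    exact (congrArg _ hb).trans (smul_zero _)

/-- `omega2` uses an arbitrarily chosen special `H`; the criterion for `omegaH` holds for every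
special `H`, so the choice is immaterial here. -/
theorem omega2_eq_zero_iff {S : Plane → Fibre} (hS : S ∈ SmoothNear Fibre p) :
    omega2 (jet 2 ⟨S, hS⟩) = 0 ↔ F1 S p = 0 ∧ F2 S p = 0 := by
  have h := exists_isSpecial hS
  rw [omega2, dif_pos h]
  exact omegaH_eq_zero_iff_F hS h.choose_spec

end

end CubicODE

end

theorem mainTheorem6 (U : Set CubicODE.Plane) (hU : IsOpen U) (a : CubicODE.Plane → CubicODE.Fibre)
    (ha : ContDiffOn ℝ ∞ a U) :
    (CubicODE.ReducibleToLinear U a ↔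
      ∀ p (hp : p ∈ U), CubicODE.omega2 (CubicODE.jetSection hU ha 2 hp) = 0) ∧
    (CubicODE.ReducibleToLinear U a ↔
      ∀ p ∈ U, CubicODE.F1 a p = 0 ∧ CubicODE.F2 a p = 0) := by
  have h := CubicODE.reducible_iff hU ha
  exact ⟨h.trans (forall₂_congr fun p hp =>
    (CubicODE.omega2_eq_zero_iff (CubicODE.section_mem hU ha hp)).symm), h⟩
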